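/- Let $f\in C^2(\mathbb R)$ and $\nu\in\mathbb N$, and let $f^\nu$ be the piecewise affine interpolation of $f$ with nodes in $2^{-\nu}\mathbb Z$. **Wavefront tracking.** Let $u_0^\nu:\mathbb R\to 2^{-\nu}\mathbb Z$ be a compactly supported, right continuous, piecewise constant function with finitely many jumps. Let $u^\nu(t,x)$, $t\ge 0$, be right continuous in $x$, and suppose it is the wavefront tracking approximation with $u^\nu(0,\cdot)=u^\nu_0$. This means: at $t=0$ and at every collision time, the Riemann problems with flux $f^\nu$ at all points are solved by the self-similar solution $u(x/t)$, where $u(\xi)$ is the pseudoinverse of $\frac{d}{dw}\mathrm{conv}_{[u_l,u_r]}f^\nu$ if $u_l<u_r$, and of $\frac{d}{dw}\mathrm{conc}_{[u_r,u_l]}f^\nu$ if $u_l>u_r$ (derivatives of the lower convex and the upper concave envelope), and these solutions are pieced together; between collision times the finitely many jumps (wavefronts) travel with constant speed; the collision times are locally finite in $[0,\infty)$; at each time there is at most one collision, and it involves exactly two incoming wavefronts. **Wave representation.** Let $J=(0,\mathrm{TV}(u_0^\nu)]$, and let $(\mathtt X^\nu,\mathtt u^\nu,\mathtt a^\nu)$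 be the wave representation of $u^\nu$, i.e. functions such that 1. $\mathtt a^\nu(t,s)=\mathcal S^\nu(s)\chi_{[0,\mathtt T^\nu(s))}(t)$ with $\mathcal S^\nu:J\to\{-1,1\}$ and $\mathtt T^\nu:J\to[0,\infty]$ measurable; 2. $\mathtt X^\nu$ is defined on $\{(t,s)\in[0,\infty)\times J: t\le \mathtt T^\nu(s)\}$; $s\mapsto \mathtt X^\nu(t,s)$ is nondecreasing for all $t$, and $t\mapsto \mathtt X^\nu(t,s)$ is Lipschitz for all $s$; 3. for all $t\ge0$: $D_xu^\nu(t)=\mathtt X^\nu(t,\cdot)_\sharp(\mathtt a^\nu(t,\cdot)\mathcal L^1)$ and $|D_xu^\nu(t)|=\mathtt X^\nu(t,\cdot)_\sharp(|\mathtt a^\nu(t,\cdot)|\mathcal L^1)$; 4. for all $s\in J$ and $0\le t<\mathtt T^\nu(s)$, with $x=\mathtt X^\nu(t,s)$, $$\mathtt u^\nu(s)=D_xu^\nu(t)\big((-\infty,x)\big)+\int_{\{s'<s,\ \mathtt X^\nu(t,s')=x\}}\mathtt a^\nu(t,s')\,ds';$$ 5. $\mathtt X^\nu(t,\cdot)$,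 $\mathtt u^\nu$ and $\mathtt a^\nu(t,\cdot)$ are left continuous in $s$. Let $\sigma^\nu(t,s)=\frac{d}{dt}\mathtt X^\nu(t,s)$ be the speed of the wave $s$, extended right continuously in $t$ to the collision times (that is, the right derivative), and let $\mathrm{TV}(\sigma^\nu(s);[0,\mathtt T^\nu(s)))$ be the total variation of $t\mapsto\sigma^\nu(t,s)$ on $[0,\mathtt T^\nu(s))$. **Theorem.** The function $s\mapsto \mathrm{TV}(\sigma^\nu(s);[0,\mathtt T^\nu(s)))$ is Lebesgue measurable on $J$ and $$\int_J \mathrm{TV}\big(\sigma^\nu(s);[0,\mathtt T^\nu(s))\big)\,ds\ \le\ 3\,\|D^2f\|_\infty\,\big(\mathrm{TV}(u_0^\nu)\big)^2,$$ where $\|D^2f\|_\infty$ is the supremum of $|f''|$ over the smallest interval containing the values of $u^\nu_0$ (so the bound holds in particular with the supremum over $\mathbb R$). -/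

import Mathlib

open Set MeasureTheory Filter Topology

noncomputable section

/-- The piecewise affine interpolation `f^ν` of `f` with nodes in `2^{-ν} ℤ`: on the cell
`[2^{-ν} k, 2^{-ν} (k+1)]` it is the affine function that agrees with `f` at both endpoints. -/
def piecewiseAffineFlux (f : ℝ → ℝ) (ν : ℕ) (w : ℝ) : ℝ :=
  (1 - Int.fract (2 ^ ν * w)) * f ((⌊2 ^ ν * w⌋ : ℝ) / 2 ^ ν) +
    Int.fract (2 ^ ν * w) * f (((⌊2 ^ ν * w⌋ : ℝ) + 1) / 2 ^ ν)

/-- `conv_{[a,b]} g`: the largest convex function on `[a,b]` that is at most `g` there. -/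
def convEnvelope (g : ℝ → ℝ) (a b w : ℝ) : ℝ :=
  sSup {r : ℝ | ∃ φ : ℝ → ℝ, ConvexOn ℝ (Icc a b) φ ∧ (∀ z ∈ Icc a b, φ z ≤ g z) ∧ r = φ w}

/-- `conc_{[a,b]} g`: the smallest concave function on `[a,b]` that is at least `g` there. -/
def concEnvelope (g : ℝ → ℝ) (a b w : ℝ) : ℝ :=
  sInf {r : ℝ | ∃ φ : ℝ → ℝ, ConcaveOn ℝ (Icc a b) φ ∧ (∀ z ∈ Icc a b, g z ≤ φ z) ∧ r = φ w}

/-- The self-similar entropy solution `ũ(t,x) = riemannSolution g ul ur (x / t)` of the Riemann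
problem `u_t + g(u)_x = 0` with left state `ul` and right state `ur`: the right continuous
pseudoinverse of the derivative of `conv_{[ul,ur]} g` if `ul < ur`, and of the derivative of
`conc_{[ur,ul]} g` if `ur < ul`.  (The one-sided derivatives used below exist when `g` is piecewise
affine; in the first case they increase with `w`, in the second they decrease with `w`.) -/
def riemannSolution (g : ℝ → ℝ) (ul ur ξ : ℝ) : ℝ :=
  if ul ≤ ur then
    sSup (insert ul {w ∈ Ioc ul ur | derivWithin (convEnvelope g ul ur) (Iic w) w ≤ ξ})
  else
    sInf (insert ul {w ∈ Ico ur ul | derivWithin (concEnvelope g ur ul) (Ici w) w ≤ ξ})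

/-- `u` is described on the time interval `[t₀, t₁]` by `n` wavefronts, numbered from left to right.
The `i`-th one starts at time `t₀` from `y i`, has constant speed `c i`, and separates the constant
states `v i` (on its left) and `v (i + 1)` (on its right).  The fronts do not meet strictly between
`t₀` and `t₁`. -/
structure IsFrontPattern (u : ℝ → ℝ → ℝ) (t₀ t₁ : ℝ) (n : ℕ) (y c : Fin n → ℝ) (v : ℕ → ℝ) :
    Prop where
  left_state : v 0 = 0
  right_state : v n = 0
  jump_ne : ∀ i < n, v i ≠ v (i + 1)
  ordered : ∀ t ∈ Ioo t₀ t₁, StrictMono fun i : Fin n => y i + c i * (t - t₀)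
  value : ∀ t ∈ Icc t₀ t₁, ∀ x : ℝ,
    u t x = v (Finset.univ.filter fun i : Fin n => y i + c i * (t - t₀) ≤ x).card

/-- For a short time after `t₀`, `u` is obtained by piecing together the solutions of the
Riemann problems, with flux `g`, posed at the points `y` by the left and right limits of `u t₀`. -/
def SolvesRiemannProblemsAt (g : ℝ → ℝ) (u : ℝ → ℝ → ℝ) (t₀ : ℝ) : Prop :=
  ∀ y : ℝ, ∃ ε > 0, ∀ t ∈ Ioo t₀ (t₀ + ε), ∀ x ∈ Ioo (y - ε) (y + ε),
    u t x = riemannSolution g (Function.leftLim (u t₀) y) (u t₀ y) ((x - y) / (t - t₀))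

/-- `u` is a (compactly supported) wavefront tracking approximation with the piecewise affine flux
`f^ν`, with binary collisions: the initial datum takes values in `2^{-ν} ℤ`; between two
consecutive times of the locally finite sequence `t j` (which contains all collision times) the
jumps travel along straight lines; at each `t j` all Riemann problems are solved; and at each
time at most one collision occurs, which involves exactly two incoming wavefronts. -/
def IsWavefrontTracking (f : ℝ → ℝ) (ν : ℕ) (u : ℝ → ℝ → ℝ) : Prop :=
  (∀ x : ℝ, ∃ k : ℤ, u 0 x = k / 2 ^ ν) ∧
  ∃ t : ℕ → ℝ, t 0 = 0 ∧ StrictMono t ∧ Tendsto t atTop atTop ∧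
    ∀ j : ℕ, SolvesRiemannProblemsAt (piecewiseAffineFlux f ν) u (t j) ∧
      ∃ (n : ℕ) (y c : Fin n → ℝ) (v : ℕ → ℝ), IsFrontPattern u (t j) (t (j + 1)) n y c v ∧
        ∀ i i' k k' : Fin n, i < i' → k < k' →
          y i + c i * (t (j + 1) - t j) = y i' + c i' * (t (j + 1) - t j) →
          y k + c k * (t (j + 1) - t j) = y k' + c k' * (t (j + 1) - t j) →
          i = k ∧ i' = k'

/-- The interval of waves `J = (0, TV(u(0))]`. -/
def waveInterval (u : ℝ → ℝ → ℝ) : Set ℝ := Ioc 0 (eVariationOn (u 0) univ).toReal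

/-- The waves that exist at time `t`: those in `J` with `t < T s`. -/
def aliveWaves (u : ℝ → ℝ → ℝ) (T : ℝ → EReal) (t : ℝ) : Set ℝ :=
  {s ∈ waveInterval u | (t : EReal) < T s}

open scoped Classical in
/-- The signed existence interval `a(t,s) = S(s) χ_{[0,T(s))}(t)` of the wave `s`. -/
def signedExistence (S : ℝ → ℝ) (T : ℝ → EReal) (t s : ℝ) : ℝ :=
  if 0 ≤ t ∧ (t : EReal) < T s then S s else 0

/-- `(X, U, a)`, with `a = signedExistence S T`, is the wave representation of `u`.  The time of
existence `T s` is `⊤` for a wave that is never cancelled, and `X t s` is only relevant for `s ∈ J`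
and `0 ≤ t ≤ T s`.  For the compactly supported, right continuous `u t` one has
`|D_x u(t)|((-∞,x]) = TV(u(t); (-∞,x])` and `D_x u(t)((-∞,x)) = u(t,x-)`. -/
structure IsWaveRepresentation (u : ℝ → ℝ → ℝ) (X : ℝ → ℝ → ℝ) (U S : ℝ → ℝ) (T : ℝ → EReal) :
    Prop where
  measurable_sign : Measurable S
  measurable_time : Measurable T
  sign_eq : ∀ s ∈ waveInterval u, S s = 1 ∨ S s = -1
  time_nonneg : ∀ s ∈ waveInterval u, 0 ≤ T s
  monotone_position : ∀ t : ℝ, 0 ≤ t → MonotoneOn (X t) {s ∈ waveInterval u | (t : EReal) ≤ T s}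
  lipschitz_position : ∀ s ∈ waveInterval u, ∃ K : NNReal,
    LipschitzOnWith K (fun t => X t s) {t : ℝ | 0 ≤ t ∧ (t : EReal) ≤ T s}
  /-- `D_x u(t)` is the image of `a(t,·) ℒ¹` under `X(t,·)`. -/
  derivative : ∀ t : ℝ, 0 ≤ t → ∀ φ : ℝ → ℝ, ContDiff ℝ 1 φ →
    -∫ x, u t x * deriv φ x = ∫ s in waveInterval u, φ (X t s) * signedExistence S T t s
  /-- `|D_x u(t)|` is the image of `|a(t,·)| ℒ¹` under `X(t,·)`. -/
  variation : ∀ t : ℝ, 0 ≤ t → ∀ x : ℝ,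
    Measure.map (X t) (volume.restrict (aliveWaves u T t)) (Iic x) = eVariationOn (u t) (Iic x)
  value : ∀ t : ℝ, 0 ≤ t → ∀ s ∈ aliveWaves u T t,
    U s = Function.leftLim (u t) (X t s) +
      ∫ s' in {s' ∈ aliveWaves u T t | s' < s ∧ X t s' = X t s}, signedExistence S T t s'
  left_continuous_position : ∀ t : ℝ, 0 ≤ t → ∀ s ∈ waveInterval u, (t : EReal) ≤ T s →
    ContinuousWithinAt (X t) {s' ∈ waveInterval u | s' ≤ s ∧ (t : EReal) ≤ T s'} s
  left_continuous_value : ∀ s ∈ waveInterval u,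
    ContinuousWithinAt U {s' ∈ waveInterval u | s' ≤ s} s
  left_continuous_existence : ∀ t : ℝ, 0 ≤ t → ∀ s ∈ waveInterval u,
    ContinuousWithinAt (signedExistence S T t) {s' ∈ waveInterval u | s' ≤ s} s

/-- The speed `σ(t,s) = d/dt X(t,s)` of the wave `s`.  As `X(·,s)` is piecewise affine, its right
derivative is the derivative outside the collision times, extended to them right continuously. -/
def waveSpeed (X : ℝ → ℝ → ℝ) (t s : ℝ) : ℝ := derivWithin (fun τ => X τ s) (Ici t) t

/-- The total variation in time of the speed of the wave `s` on `[0, T s)`. -/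
def waveSpeedVariation (X : ℝ → ℝ → ℝ) (T : ℝ → EReal) (s : ℝ) : ENNReal :=
  eVariationOn (fun t => waveSpeed X t s) {t : ℝ | 0 ≤ t ∧ (t : EReal) < T s}

/-- `‖D²f‖_∞`, the supremum of `|f''|`, taken over the set `I`. -/
def supSecondDeriv (f : ℝ → ℝ) (I : Set ℝ) : ENNReal := ⨆ w ∈ I, ‖iteratedDeriv 2 f w‖ₑ

end

open Set MeasureTheory Filter Topology

noncomputable section

/-! Write g for the interpolated flux `f^ν`, and let K bound |f''| on the hull of the initial
values. The speed of a wave can change only where two fronts collide. Up to the reflection u ↦ -u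
(`FrontModel.neg`) the outer states of the collision are increasing, or they are equal and no wave
survives at that point.

Cancellation. If the two fronts have opposite signs, an amount δ of the stronger front disappears
together with the weaker one. The surviving part lies below chords shifted by δ, so a second
difference of g between nodes (`second_difference_le`) shows that the speed of every surviving wave
changes by at most Kδ. Integrated over all waves this is at most K · TV · δ. A wave disappears only
once, so all cancellations together cost at most K · TV².

Interaction. If fronts a < b and b < c with speeds σ₁ > σ₂ merge, the change of speed integrated
over the waves is 2D/(c - a) with D = (b - a)(c - b)(σ₁ - σ₂). Here D is the double integral of
g'(x) - g'(y) over x in [a, b], y in [b, c], and each pair contributes at most K(c - a). Hence 2K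
for each pair of waves would do, but this can be summed only if a pair of waves is charged at most
once in its history. Only those pairs are charged that have never been in a common front before
(`interaction_pairs`). Each of them meets now for the first time, so all interactions together cost
at most 2K · TV². This gives the constant 3.

Why pairs that have met are free. Let α be the least value of the waves left of b that have met some
wave right of b, and γ the greatest value of the waves right of b that have met some wave left of b.
The pairs that have met have values in [α, b] × [b, γ], and there the double integral is not
positive: the slope of g over [α, b] is at most its slope over [b, γ]. This is `FrontModel.contact`,
proved by induction over the stages. Whenever waves that have met get separated, a Riemann problem
has placed the boundary between them at a contact point of g with its convex envelope, and later
Riemann problems on either side do not destroy this.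

The reduction to this picture has two ingredients. The formula for the Riemann solver is turned into
statements on support lines of g at the states of a fan (`riemannSolution_fan_up`). The wave
representation is shown to follow the fronts: outside a null set, a wave alive in a stage stays in
one front with the sign of that front (`sign_waves_at`, `exists_regular_waves`). -/

/-! ### Counting the members of a finite sequence below a level -/

/-- The number of `i < n` with `z i ≤ x`. -/
def countLE (n : ℕ) (z : ℕ → ℝ) (x : ℝ) : ℕ := ((Finset.range n).filter fun i => z i ≤ x).card

/-- The number of `i < n` with `z i < x`. -/
def countLT (n : ℕ) (z : ℕ → ℝ) (x : ℝ) : ℕ := ((Finset.range n).filter fun i => z i < x).card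

theorem countLE_le (n : ℕ) (z : ℕ → ℝ) (x : ℝ) : countLE n z x ≤ n :=
  (Finset.card_filter_le _ _).trans (by simp)

theorem countLT_le_countLE (n : ℕ) (z : ℕ → ℝ) (x : ℝ) : countLT n z x ≤ countLE n z x :=
  Finset.card_le_card fun i hi => by
    simp only [Finset.mem_filter] at hi ⊢
    exact ⟨hi.1, hi.2.le⟩

theorem countLE_mono (n : ℕ) (z : ℕ → ℝ) : Monotone (countLE n z) := fun x x' h =>
  Finset.card_le_card fun i hi => by
    simp only [Finset.mem_filter] at hi ⊢
    exact ⟨hi.1, hi.2.trans h⟩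

theorem Finset.mem_iff_lt_card_of_lower (s : Finset ℕ) (hs : ∀ i ∈ s, ∀ k < i, k ∈ s) (i : ℕ) :
    i ∈ s ↔ i < s.card := by
  constructor
  · intro hi
    have : Finset.range (i + 1) ⊆ s := fun k hk => by
      rcases Nat.lt_or_ge k i with h | h
      · exact hs i hi k h
      · have : k = i := by simp at hk; omega
        exact this ▸ hi
    simpa using Finset.card_le_card this
  · intro hi
    by_contra hn
    have : s ⊆ Finset.range i := fun k hk => by
      by_contra h
      simp only [Finset.mem_range, not_lt] at h
      rcases h.lt_or_eq with h | h
      · exact hn (hs k hk i h)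
      · exact hn (h ▸ hk)
    have := Finset.card_le_card this
    simp at this
    omega

theorem lt_countLE_iff {n : ℕ} {z : ℕ → ℝ} (hz : ∀ i k, i ≤ k → k < n → z i ≤ z k) {x : ℝ} {i : ℕ} :
    i < countLE n z x ↔ i < n ∧ z i ≤ x := by
  rw [countLE, ← Finset.mem_iff_lt_card_of_lower]
  · simp
  · intro i hi k hk
    simp only [Finset.mem_filter, Finset.mem_range] at hi ⊢
    exact ⟨hk.trans hi.1, (hz k i hk.le hi.1).trans hi.2⟩

theorem lt_countLT_iff {n : ℕ} {z : ℕ → ℝ} (hz : ∀ i k, i ≤ k → k < n → z i ≤ z k) {x : ℝ} {i : ℕ} :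
    i < countLT n z x ↔ i < n ∧ z i < x := by
  rw [countLT, ← Finset.mem_iff_lt_card_of_lower]
  · simp
  · intro i hi k hk
    simp only [Finset.mem_filter, Finset.mem_range] at hi ⊢
    exact ⟨hk.trans hi.1, (hz k i hk.le hi.1).trans_lt hi.2⟩

theorem countLT_le_iff {n : ℕ} {z : ℕ → ℝ} (hz : ∀ i k, i ≤ k → k < n → z i ≤ z k) {x : ℝ} {i : ℕ}
    (hi : i < n) : countLT n z x ≤ i ↔ x ≤ z i := by
  rw [← not_lt, lt_countLT_iff hz]
  simp [hi]

theorem countLE_le_iff {n : ℕ} {z : ℕ → ℝ} (hz : ∀ i k, i ≤ k → k < n → z i ≤ z k) {x : ℝ} {i : ℕ}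
    (hi : i < n) : countLE n z x ≤ i ↔ x < z i := by
  rw [← not_lt, lt_countLE_iff hz]
  simp [hi]

/-! ### Total variation of sequences -/

theorem eVariationOn_nat_Iic (a : ℕ → ℝ) (m : ℕ) :
    eVariationOn a (Iic m) = ∑ i ∈ Finset.range m, edist (a i) (a (i + 1)) := by
  induction m with
  | zero =>
    simp only [Finset.range_zero, Finset.sum_empty]
    exact eVariationOn.subsingleton _ (fun x hx y hy => by simp_all)
  | succ m ih =>
    have h : (Iic (m + 1) : Set ℕ) = Iic m ∪ {m, m + 1} := by
      ext k
      simp only [mem_Iic, mem_union, mem_insert_iff, mem_singleton_iff]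
      omega
    rw [h, eVariationOn.union a (x := m) ⟨by simp, fun k hk => by simpa using hk⟩
      ⟨by simp, fun k hk => by rcases hk with h | h <;> simp_all⟩, ih, eVariationOn.pair,
      Finset.sum_range_succ]

/-- A downward closed set of naturals is an initial segment or everything, so consecutive increments
exhaust the variation. The increment from `i` to `i + 1` is counted exactly if `i + 1` belongs to
the set. The set will consist of the stages in which a given wave is alive. -/
theorem eVariationOn_nat_lower (a : ℕ → ℝ) (B : Set ℕ) (hB : ∀ i ∈ B, ∀ k ≤ i, k ∈ B) :
    eVariationOn a B =
      ∑' i, (B.indicator (fun k => edist (a (k - 1)) (a k)) (i + 1) : ENNReal) := by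
  apply le_antisymm
  · refine iSup_le ?_
    rintro ⟨n, w, hw, hwB⟩
    have h1 : ∑ i ∈ Finset.range n, edist (a (w (i + 1))) (a (w i)) ≤ eVariationOn a (Iic (w n)) := by
      have := eVariationOn.sum_le_of_monotoneOn_Iic (f := a) (s := Iic (w n)) (n := n) (u := w)
        (hw.monotoneOn _) (fun i hi => hw hi)
      exact this
    refine h1.trans ?_
    rw [eVariationOn_nat_Iic]
    refine le_trans (le_of_eq ?_) (ENNReal.sum_le_tsum (Finset.range (w n)))
    refine Finset.sum_congr rfl fun i hi => ?_
    rw [indicator_of_mem]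
    · simp
    · exact hB _ (hwB n) _ (by simpa using hi)
  · rw [ENNReal.tsum_eq_iSup_nat]
    refine iSup_le fun m => ?_
    by_cases hne : B.Nonempty
    swap
    · have : B = ∅ := not_nonempty_iff_eq_empty.1 hne
      simp [this]
    have h0 : 0 ∈ B := by
      obtain ⟨i, hi⟩ := hne
      exact hB i hi 0 (Nat.zero_le _)
    suffices H : ∃ k ∈ B, ∑ i ∈ Finset.range m,
        (B.indicator (fun k => edist (a (k - 1)) (a k)) (i + 1) : ENNReal) ≤
          ∑ i ∈ Finset.range k, edist (a i) (a (i + 1)) by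
      obtain ⟨k, hk, hle⟩ := H
      rw [← eVariationOn_nat_Iic] at hle
      exact hle.trans (eVariationOn.mono _ fun i hi => hB k hk i hi)
    induction m with
    | zero => exact ⟨0, h0, by simp⟩
    | succ m ih =>
      by_cases hm : m + 1 ∈ B
      · refine ⟨m + 1, hm, Finset.sum_le_sum fun i _ => ?_⟩
        refine (indicator_le_self _ _ _).trans (by simp)
      · obtain ⟨k, hk, hle⟩ := ih
        refine ⟨k, hk, ?_⟩
        rw [Finset.sum_range_succ, indicator_of_notMem hm, add_zero]
        exact hle

/-! ### Distribution of the rank function of a set of finite measure -/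

/-- Up to ε, the sublevel set is contained in `F ∩ Iio s` for one of its own points `s` near its
supremum, and the measure of that is the rank of `s`. Inside a front the value of a wave is its rank
up to a sign and a constant, so this controls how many waves have values in a given interval. -/
theorem volume_rank_le {F : Set ℝ} {L : ℝ} (hF : F ⊆ Icc 0 L) (r : ℝ) :
    volume {s ∈ F | (volume (F ∩ Iio s)).toReal ≤ r} ≤ ENNReal.ofReal r := by
  set E := {s ∈ F | (volume (F ∩ Iio s)).toReal ≤ r} with hE
  have hfin : ∀ s, volume (F ∩ Iio s) ≠ ⊤ := fun s =>
    ((measure_mono (inter_subset_left.trans hF)).trans_lt (by simp)).ne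
  rcases E.eq_empty_or_nonempty with he | hne
  · simp [he]
  have hbdd : BddAbove E := ⟨L, fun s hs => (hF hs.1).2⟩
  refine ENNReal.le_of_forall_pos_le_add fun ε hε _ => ?_
  obtain ⟨s, hs, hlt⟩ := exists_lt_of_lt_csSup hne (show sSup E - ε < sSup E by
    have : (0 : ℝ) < ε := hε
    linarith)
  have hsub : E ⊆ (F ∩ Iio s) ∪ Icc s (sSup E) := fun x hx => by
    rcases lt_or_ge x s with h | h
    · exact Or.inl ⟨hx.1, h⟩
    · exact Or.inr ⟨h, le_csSup hbdd hx⟩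
  refine (measure_mono hsub).trans ((measure_union_le _ _).trans (add_le_add ?_ ?_))
  · rw [← ENNReal.ofReal_toReal (hfin s)]
    exact ENNReal.ofReal_le_ofReal hs.2
  · rw [Real.volume_Icc, ENNReal.ofReal_le_iff_le_toReal (by simp)]
    simp
    linarith

theorem volume_le_rank {F : Set ℝ} {L : ℝ} (hF : F ⊆ Icc 0 L) (r : ℝ) :
    volume {s ∈ F | r ≤ (volume (F ∩ Iio s)).toReal} ≤ ENNReal.ofReal ((volume F).toReal - r) := by
  set E := {s ∈ F | r ≤ (volume (F ∩ Iio s)).toReal} with hE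
  have hfin : ∀ B ⊆ F, volume B ≠ ⊤ := fun B hB =>
    ((measure_mono (hB.trans hF)).trans_lt (by simp)).ne
  rcases E.eq_empty_or_nonempty with he | hne
  · simp [he]
  have hbdd : BddBelow E := ⟨0, fun s hs => (hF hs.1).1⟩
  refine ENNReal.le_of_forall_pos_le_add fun ε hε _ => ?_
  have hε' : (0 : ℝ) < ε := hε
  obtain ⟨s, hs, hlt⟩ := exists_lt_of_csInf_lt hne (show sInf E < sInf E + ε by linarith)
  have hsub : E ⊆ (F ∩ Ici s) ∪ Icc (sInf E) s := fun x hx => by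
    rcases le_or_gt s x with h | h
    · exact Or.inl ⟨hx.1, h⟩
    · exact Or.inr ⟨csInf_le hbdd hx, h.le⟩
  refine (measure_mono hsub).trans ((measure_union_le _ _).trans (add_le_add ?_ ?_))
  · have hsplit : volume (F ∩ Iio s) + volume (F ∩ Ici s) = volume F := by
      rw [← measure_inter_add_sdiff F measurableSet_Iio]
      congr 2
      ext x; simp
    have h2 : (volume (F ∩ Iio s)).toReal + (volume (F ∩ Ici s)).toReal = (volume F).toReal := by
      rw [← hsplit, ENNReal.toReal_add (hfin _ inter_subset_left) (hfin _ inter_subset_left)]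
    rw [← ENNReal.ofReal_toReal (hfin (F ∩ Ici s) inter_subset_left)]
    exact ENNReal.ofReal_le_ofReal (by have := hs.2; linarith)
  · rw [Real.volume_Icc, ENNReal.ofReal_le_iff_le_toReal (by simp)]
    simp
    linarith

/-! ### The piecewise affine flux -/

theorem piecewiseAffineFlux_cell (f : ℝ → ℝ) (ν : ℕ) (k : ℤ) {θ : ℝ} (h0 : 0 ≤ θ) (h1 : θ ≤ 1) :
    piecewiseAffineFlux f ν ((k + θ) / 2 ^ ν) =
      (1 - θ) * f (k / 2 ^ ν) + θ * f ((k + 1) / 2 ^ ν) := by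
  have h2 : (2 : ℝ) ^ ν * ((k + θ) / 2 ^ ν) = k + θ := by field_simp
  unfold piecewiseAffineFlux
  rw [h2]
  rcases h1.lt_or_eq with h | h
  · have hfl : ⌊(k : ℝ) + θ⌋ = k := by
      rw [Int.floor_eq_iff]; constructor <;> linarith
    have hfr : Int.fract ((k : ℝ) + θ) = θ := by
      rw [Int.fract, hfl]; ring
    rw [hfl, hfr]
  -- For θ = 1 the point is the left end of the next cell, where the floor jumps.
  · subst h
    have : (k : ℝ) + 1 = ((k + 1 : ℤ) : ℝ) := by push_cast; ring
    rw [this, Int.floor_intCast, Int.fract_intCast]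
    simp

theorem piecewiseAffineFlux_node (f : ℝ → ℝ) (ν : ℕ) (k : ℤ) :
    piecewiseAffineFlux f ν (k / 2 ^ ν) = f (k / 2 ^ ν) := by
  have := piecewiseAffineFlux_cell f ν k le_rfl zero_le_one
  simpa using this

theorem exists_cell (ν : ℕ) (w : ℝ) :
    ∃ (k : ℤ) (θ : ℝ), 0 ≤ θ ∧ θ < 1 ∧ w = (k + θ) / 2 ^ ν :=
  ⟨⌊2 ^ ν * w⌋, Int.fract (2 ^ ν * w), Int.fract_nonneg _, Int.fract_lt_one _, by
    rw [Int.floor_add_fract]; field_simp⟩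

/-- Between nodes the interpolation has the chords of `f`. An increment splits into a part of a
cell, whole cells and another part of a cell, and all of these have chords of slope at most `M`. -/
theorem piecewiseAffineFlux_sub_le {f : ℝ → ℝ} {ν : ℕ} {i k : ℤ} {M : ℝ}
    (hM : ∀ p q, (i : ℝ) / 2 ^ ν ≤ p → p ≤ q → q ≤ k / 2 ^ ν → f q - f p ≤ M * (q - p))
    {w w' : ℝ} (hw : (i : ℝ) / 2 ^ ν ≤ w) (hww : w ≤ w') (hw' : w' ≤ k / 2 ^ ν) :
    piecewiseAffineFlux f ν w' - piecewiseAffineFlux f ν w ≤ M * (w' - w) := by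
  have hN : (0 : ℝ) < 2 ^ ν := by positivity
  obtain ⟨a, θ, h0, h1, rfl⟩ := exists_cell ν w
  obtain ⟨b, η, e0, e1, rfl⟩ := exists_cell ν w'
  rw [piecewiseAffineFlux_cell f ν a h0 h1.le, piecewiseAffineFlux_cell f ν b e0 e1.le]
  rw [div_le_div_iff_of_pos_right hN] at hw hww hw'
  have hia : i ≤ a := by
    have : (i : ℝ) < a + 1 := by linarith
    have : i < a + 1 := by exact_mod_cast this
    omega
  have hab : a ≤ b := by
    have : (a : ℝ) < b + 1 := by linarith
    have : a < b + 1 := by exact_mod_cast this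
    omega
  have hiaR : (i : ℝ) ≤ a := by exact_mod_cast hia
  have cell : ∀ d : ℤ, i ≤ d → d + 1 ≤ k → f ((d + 1) / 2 ^ ν) - f (d / 2 ^ ν) ≤ M / 2 ^ ν := by
    intro d hd hd'
    have hdR : (i : ℝ) ≤ d := by exact_mod_cast hd
    have hdR' : (d : ℝ) + 1 ≤ k := by exact_mod_cast hd'
    refine (hM _ _ ?_ ?_ ?_).trans (le_of_eq ?_)
    · rwa [div_le_div_iff_of_pos_right hN]
    · rw [div_le_div_iff_of_pos_right hN]; linarith
    · rwa [div_le_div_iff_of_pos_right hN]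
    · field_simp; ring
  rcases hab.lt_or_eq with hlt | heq
  · have hlt' : a + 1 ≤ b := hlt
    have hltR : (a : ℝ) + 1 ≤ b := by exact_mod_cast hlt'
    have hbk : b ≤ k := by
      have : (b : ℝ) ≤ k := by linarith
      exact_mod_cast this
    have hbkR : (b : ℝ) ≤ k := by exact_mod_cast hbk
    have c1 : (1 - θ) * (f ((a + 1) / 2 ^ ν) - f (a / 2 ^ ν)) ≤ (1 - θ) * (M / 2 ^ ν) :=
      mul_le_mul_of_nonneg_left (cell a hia (by omega)) (by linarith)
    have c2 : f (b / 2 ^ ν) - f ((a + 1) / 2 ^ ν) ≤ M * (b / 2 ^ ν - (a + 1) / 2 ^ ν) := by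
      apply hM
      · rw [div_le_div_iff_of_pos_right hN]; linarith
      · rwa [div_le_div_iff_of_pos_right hN]
      · rwa [div_le_div_iff_of_pos_right hN]
    -- If η = 0, the cell to the right of `b` may stick out of the interval, but then it contributes
    -- nothing.
    have c3 : η * (f ((b + 1) / 2 ^ ν) - f (b / 2 ^ ν)) ≤ η * (M / 2 ^ ν) := by
      rcases e0.lt_or_eq with h | h
      · refine mul_le_mul_of_nonneg_left (cell b (by omega) ?_) e0
        have : (b : ℝ) < k := by linarith
        have : b < k := by exact_mod_cast this
        omega
      · simp [← h]
    have : M * ((b + η) / 2 ^ ν - (a + θ) / 2 ^ ν) = (1 - θ) * (M / 2 ^ ν) +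
        M * (b / 2 ^ ν - (a + 1) / 2 ^ ν) + η * (M / 2 ^ ν) := by field_simp; ring
    rw [this]
    linarith
  · subst heq
    have hθ : θ ≤ η := by linarith
    have c : (η - θ) * (f ((a + 1) / 2 ^ ν) - f (a / 2 ^ ν)) ≤ (η - θ) * (M / 2 ^ ν) := by
      rcases hθ.lt_or_eq with h | h
      · refine mul_le_mul_of_nonneg_left (cell a hia ?_) (by linarith)
        have : (a : ℝ) < k := by linarith
        have : a < k := by exact_mod_cast this
        omega
      · simp [h]
    have : M * ((a + η) / 2 ^ ν - (a + θ) / 2 ^ ν) = (η - θ) * (M / 2 ^ ν) := by field_simp; ring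
    rw [this]
    linarith

theorem piecewiseAffineFlux_neg (f : ℝ → ℝ) (ν : ℕ) (w : ℝ) :
    piecewiseAffineFlux (fun x => -f x) ν w = -piecewiseAffineFlux f ν w := by
  unfold piecewiseAffineFlux; ring

theorem abs_deriv_sub_le {f : ℝ → ℝ} (hf : ContDiff ℝ 2 f) {H : Set ℝ} (hH : Convex ℝ H) {K : ℝ}
    (hK : ∀ w ∈ H, |iteratedDeriv 2 f w| ≤ K) {p q : ℝ} (hp : p ∈ H) (hq : q ∈ H) :
    |deriv f q - deriv f p| ≤ K * |q - p| := by
  have hd : ContDiff ℝ 1 (deriv f) := by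
    have := (contDiff_succ_iff_deriv (n := 1) (f := f)).1 (by simpa [one_add_one_eq_two] using hf)
    exact this.2.2
  refine hH.norm_image_sub_le_of_norm_deriv_le (f := deriv f) (fun x _ =>
    (hd.differentiable (by norm_num)).differentiableAt) (fun x hx => ?_) hp hq
  have := hK x hx
  rwa [iteratedDeriv_succ, iteratedDeriv_one] at this

theorem exists_slope_bounds {f : ℝ → ℝ} (hf : ContDiff ℝ 2 f) {a b K : ℝ} (hab : a < b)
    (hK : ∀ w ∈ Icc a b, |iteratedDeriv 2 f w| ≤ K) :
    ∃ m M, M - m ≤ K * (b - a) ∧ ∀ p q, a ≤ p → p ≤ q → q ≤ b →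
      m * (q - p) ≤ f q - f p ∧ f q - f p ≤ M * (q - p) := by
  have hd : Continuous (deriv f) := hf.continuous_deriv (by norm_num)
  have hdiff : Differentiable ℝ f := hf.differentiable (by norm_num)
  have hne : (Icc a b).Nonempty := ⟨a, le_rfl, hab.le⟩
  obtain ⟨x, hx, hmin⟩ := isCompact_Icc.exists_isMinOn hne hd.continuousOn
  obtain ⟨y, hy, hmax⟩ := isCompact_Icc.exists_isMaxOn hne hd.continuousOn
  refine ⟨deriv f x, deriv f y, ?_, fun p q hp hpq hq => ⟨?_, ?_⟩⟩
  · have h1 := abs_deriv_sub_le hf (convex_Icc a b) hK hx hy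
    have h2 : |y - x| ≤ b - a := by
      rw [abs_le]; constructor <;> linarith [hx.1, hx.2, hy.1, hy.2]
    have hK0 : 0 ≤ K := (abs_nonneg _).trans (hK a ⟨le_rfl, hab.le⟩)
    exact (le_abs_self _).trans (h1.trans (mul_le_mul_of_nonneg_left h2 hK0))
  · refine (convex_Icc a b).mul_sub_le_image_sub_of_le_deriv hdiff.continuous.continuousOn
      hdiff.differentiableOn (fun w hw => ?_) p ⟨hp, hpq.trans hq⟩ q ⟨hp.trans hpq, hq⟩ hpq
    exact hmin (interior_subset hw)
  · refine (convex_Icc a b).image_sub_le_mul_sub_of_deriv_le hdiff.continuous.continuousOn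
      hdiff.differentiableOn (fun w hw => ?_) p ⟨hp, hpq.trans hq⟩ q ⟨hp.trans hpq, hq⟩ hpq
    exact hmax (interior_subset hw)

theorem piecewiseAffineFlux_slope_bounds {f : ℝ → ℝ} (hf : ContDiff ℝ 2 f) {ν : ℕ} {i k : ℤ} {K : ℝ}
    (hik : (i : ℝ) / 2 ^ ν < k / 2 ^ ν)
    (hK : ∀ w ∈ Icc ((i : ℝ) / 2 ^ ν) (k / 2 ^ ν), |iteratedDeriv 2 f w| ≤ K) :
    ∃ m M, M - m ≤ K * (k / 2 ^ ν - i / 2 ^ ν) ∧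
      ∀ p q, (i : ℝ) / 2 ^ ν ≤ p → p ≤ q → q ≤ k / 2 ^ ν →
        m * (q - p) ≤ piecewiseAffineFlux f ν q - piecewiseAffineFlux f ν p ∧
          piecewiseAffineFlux f ν q - piecewiseAffineFlux f ν p ≤ M * (q - p) := by
  obtain ⟨m, M, hmM, h⟩ := exists_slope_bounds hf hik hK
  refine ⟨m, M, hmM, fun p q hp hpq hq => ⟨?_, ?_⟩⟩
  · have := piecewiseAffineFlux_sub_le (f := fun x => -f x) (ν := ν) (i := i) (k := k) (M := -m)
      (fun p q hp hpq hq => by have := (h p q hp hpq hq).1; linarith) hp hpq hq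
    rw [piecewiseAffineFlux_neg, piecewiseAffineFlux_neg] at this
    linarith
  · exact piecewiseAffineFlux_sub_le (fun p q hp hpq hq => (h p q hp hpq hq).2) hp hpq hq

/-- Mean value inequality on [p, q] for x ↦ f(x + (r - q)) - f(x). If p, q, r are nodes, so is p + r
- q, and the bound holds for the interpolation too, although the latter has kinks. -/
theorem second_difference_le {f : ℝ → ℝ} (hf : ContDiff ℝ 2 f) {H : Set ℝ} (hH : Convex ℝ H) {K : ℝ}
    (hK : ∀ w ∈ H, |iteratedDeriv 2 f w| ≤ K) {p q r : ℝ} (hp : p ∈ H) (hr : r ∈ H)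
    (hpq : p ≤ q) (hqr : q ≤ r) :
    |f r - f q - f (p + r - q) + f p| ≤ K * (r - q) * (q - p) := by
  have hdiff : Differentiable ℝ f := hf.differentiable (by norm_num)
  have hsub : Icc p r ⊆ H := hH.ordConnected.out hp hr
  have hder : ∀ x, HasDerivAt (fun x => f (x + (r - q)) - f x) (deriv f (x + (r - q)) - deriv f x) x :=
    fun x => ((hdiff _).hasDerivAt.comp_add_const x (r - q)).sub (hdiff x).hasDerivAt
  have := (convex_Icc p q).norm_image_sub_le_of_norm_deriv_le
    (f := fun x => f (x + (r - q)) - f x) (C := K * (r - q))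
    (fun x _ => (hder x).differentiableAt) (fun x hx => ?_)
    (x := p) (y := q) ⟨le_rfl, hpq⟩ ⟨hpq, le_rfl⟩
  · rw [Real.norm_eq_abs, Real.norm_eq_abs, abs_of_nonneg (sub_nonneg.2 hpq)] at this
    have e : f r - f q - f (p + r - q) + f p = f (q + (r - q)) - f q - (f (p + (r - q)) - f p) := by
      rw [show q + (r - q) = r by ring, show p + (r - q) = p + r - q by ring]; ring
    rw [e]
    exact this
  · rw [(hder x).deriv, Real.norm_eq_abs]
    have h := abs_deriv_sub_le hf hH hK (p := x) (q := x + (r - q))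
      (hsub ⟨hx.1, by linarith [hx.2]⟩) (hsub ⟨by linarith [hx.1], by linarith [hx.2]⟩)
    rwa [show x + (r - q) - x = r - q by ring, abs_of_nonneg (sub_nonneg.2 hqr)] at h

/-! ### Convex envelopes -/

section Envelope

variable {g : ℝ → ℝ} {a b L : ℝ}

theorem convEnvelope_set_nonempty (hL : ∀ w ∈ Icc a b, ∀ w' ∈ Icc a b, |g w - g w'| ≤ L * |w - w'|)
    (hL0 : 0 ≤ L) (hab : a ≤ b) (w : ℝ) :
    {r : ℝ | ∃ φ : ℝ → ℝ, ConvexOn ℝ (Icc a b) φ ∧ (∀ z ∈ Icc a b, φ z ≤ g z) ∧ r = φ w}.Nonempty := by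
  refine ⟨_, fun _ => g a - L * (b - a), convexOn_const _ (convex_Icc a b), fun z hz => ?_, rfl⟩
  have h1 := (abs_le.1 (hL z hz a ⟨le_rfl, hab⟩)).1
  have h2 : L * |z - a| ≤ L * (b - a) := by
    rw [abs_of_nonneg (by linarith [hz.1])]
    exact mul_le_mul_of_nonneg_left (by linarith [hz.2]) hL0
  linarith

theorem convEnvelope_le (hL : ∀ w ∈ Icc a b, ∀ w' ∈ Icc a b, |g w - g w'| ≤ L * |w - w'|)
    (hL0 : 0 ≤ L) {w : ℝ} (hw : w ∈ Icc a b) : convEnvelope g a b w ≤ g w := by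
  refine csSup_le (convEnvelope_set_nonempty hL hL0 (hw.1.trans hw.2) w) ?_
  rintro r ⟨φ, -, h, rfl⟩
  exact h w hw

theorem le_convEnvelope {φ : ℝ → ℝ} (hφ : ConvexOn ℝ (Icc a b) φ) (h : ∀ z ∈ Icc a b, φ z ≤ g z)
    {w : ℝ} (hw : w ∈ Icc a b) : φ w ≤ convEnvelope g a b w := by
  refine le_csSup ⟨g w, ?_⟩ ⟨φ, hφ, h, rfl⟩
  rintro r ⟨ψ, -, h, rfl⟩
  exact h w hw

theorem convexOn_convEnvelope (hL : ∀ w ∈ Icc a b, ∀ w' ∈ Icc a b, |g w - g w'| ≤ L * |w - w'|)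
    (hL0 : 0 ≤ L) : ConvexOn ℝ (Icc a b) (convEnvelope g a b) := by
  refine ⟨convex_Icc a b, fun x hx y hy p q hp hq hpq => ?_⟩
  refine csSup_le (convEnvelope_set_nonempty hL hL0 (hx.1.trans hx.2) _) ?_
  rintro r ⟨φ, hφ, h, rfl⟩
  refine (hφ.2 hx hy hp hq hpq).trans ?_
  exact add_le_add (smul_le_smul_of_nonneg_left (le_convEnvelope hφ h hx) hp)
    (smul_le_smul_of_nonneg_left (le_convEnvelope hφ h hy) hq)

theorem convexOn_line (s : Set ℝ) (hs : Convex ℝ s) (r p x : ℝ) :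
    ConvexOn ℝ s fun w => r + p * (w - x) := by
  refine ⟨hs, fun u _ v _ α β _ _ hαβ => le_of_eq ?_⟩
  simp only [smul_eq_mul]
  have : β = 1 - α := by linarith
  subst this
  ring

theorem derivWithin_Iio_eq_Iic' (f : ℝ → ℝ) (x : ℝ) :
    derivWithin f (Iio x) x = derivWithin f (Iic x) x := by
  by_cases h : DifferentiableWithinAt ℝ f (Iio x) x
  · exact (h.hasDerivWithinAt.Iic_of_Iio.derivWithin (uniqueDiffOn_Iic x x (by simp))).symm
  · have h' : ¬ DifferentiableWithinAt ℝ f (Iic x) x := fun h' => h (h'.mono Iio_subset_Iic_self)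
    rw [derivWithin_zero_of_not_differentiableWithinAt h,
      derivWithin_zero_of_not_differentiableWithinAt h']

theorem affine_nonneg_of_Ioo {α β p q : ℝ} (hpq : p < q) (h : ∀ w ∈ Ioo p q, 0 ≤ α + β * w) :
    0 ≤ α + β * p ∧ 0 ≤ α + β * q := by
  have hc : IsClosed {w : ℝ | 0 ≤ α + β * w} := isClosed_le (by fun_prop) (by fun_prop)
  have := closure_minimal (s := Ioo p q) (fun w hw => h w hw) hc
  rw [closure_Ioo hpq.ne] at this
  exact ⟨this ⟨le_rfl, hpq.le⟩, this ⟨hpq.le, le_rfl⟩⟩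

/-- In the interior this is convexity. At the right end `b` it must also be known that the left
derivative exists, since `derivWithin` would otherwise be 0. There the Lipschitz bound of `g` puts a
line of slope `L` below the envelope, so the difference quotients are monotone and bounded. -/
theorem convEnvelope_derivWithin_le_right
    (hL : ∀ w ∈ Icc a b, ∀ w' ∈ Icc a b, |g w - g w'| ≤ L * |w - w'|) (hL0 : 0 ≤ L)
    {w w' : ℝ} (hw : a < w) (hww : w < w') (hw' : w' ≤ b) :
    derivWithin (convEnvelope g a b) (Iic w) w ≤ derivWithin (convEnvelope g a b) (Iic w') w' := by
  set C := convEnvelope g a b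
  have hC : ConvexOn ℝ (Icc a b) C := convexOn_convEnvelope hL hL0
  have hwi : w ∈ interior (Icc a b) := by rw [interior_Icc]; exact ⟨hw, by linarith⟩
  have hw'm : w' ∈ Icc a b := ⟨by linarith, hw'⟩
  have h1 : derivWithin C (Iio w) w ≤ slope C w w' :=
    (hC.leftDeriv_le_rightDeriv_of_mem_interior hwi).trans
      (hC.rightDeriv_le_slope_of_mem_interior hwi hw'm hww)
  rw [← derivWithin_Iio_eq_Iic', ← derivWithin_Iio_eq_Iic']
  refine h1.trans ?_
  rcases hw'.lt_or_eq with h | h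
  · refine hC.slope_le_leftDeriv_of_mem_interior (interior_subset hwi) ?_ hww
    rw [interior_Icc]; exact ⟨by linarith, h⟩
  · refine hC.slope_le_leftDeriv (interior_subset hwi) hw'm hww ?_
    subst h
    have hb : ∀ z ∈ Icc a w', g w' + L * (z - w') ≤ C z := fun z hz =>
      le_convEnvelope (φ := fun z => g w' + L * (z - w')) (convexOn_line _ (convex_Icc _ _) _ _ _)
        (fun y hy => by
          have := (abs_le.1 (hL y hy w' hw'm)).1
          rw [abs_of_nonpos (by linarith [hy.2])] at this
          nlinarith) hz
    have hmono : MonotoneOn (slope C w') (Ioo a w') :=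
      (hC.slope_mono hw'm).mono fun z hz => ⟨⟨hz.1.le, hz.2.le⟩, by simpa using hz.2.ne⟩
    have hbdd : BddAbove (slope C w' '' Ioo a w') := by
      refine ⟨L, ?_⟩
      rintro _ ⟨z, hz, rfl⟩
      rw [slope_def_field, div_le_iff_of_neg (by linarith [hz.2])]
      have h1 := hb z ⟨hz.1.le, hz.2.le⟩
      have h2 : C w' ≤ g w' := convEnvelope_le hL hL0 hw'm
      linarith
    have := hmono.tendsto_nhdsWithin_Ioo_left ⟨w, hw, hww⟩ hbdd
    exact ((hasDerivWithinAt_iff_tendsto_slope' (by simp)).2 this).differentiableWithinAt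

theorem convEnvelope_subgradient
    (hL : ∀ w ∈ Icc a b, ∀ w' ∈ Icc a b, |g w - g w'| ≤ L * |w - w'|) (hL0 : 0 ≤ L)
    {w z : ℝ} (hz : z ∈ Ioo a b) (hw : w ∈ Icc a b) :
    convEnvelope g a b z + derivWithin (convEnvelope g a b) (Iic z) z * (w - z) ≤
      convEnvelope g a b w := by
  set C := convEnvelope g a b
  have hC : ConvexOn ℝ (Icc a b) C := convexOn_convEnvelope hL hL0
  have hzi : z ∈ interior (Icc a b) := by rwa [interior_Icc]
  rw [← derivWithin_Iio_eq_Iic']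
  rcases lt_trichotomy w z with h | h | h
  · have := hC.slope_le_leftDeriv_of_mem_interior hw hzi h
    rw [slope_def_field, div_le_iff₀ (by linarith)] at this
    linarith
  · simp [h]
  · have := (hC.leftDeriv_le_rightDeriv_of_mem_interior hzi).trans
      (hC.rightDeriv_le_slope_of_mem_interior hzi hw h)
    rw [slope_def_field, le_div_iff₀ (by linarith)] at this
    linarith

/-- Where the envelope has a kink at a point at which it is below `g`, it could be raised. -/
theorem convEnvelope_lift_kink
    (hL : ∀ w ∈ Icc a b, ∀ w' ∈ Icc a b, |g w - g w'| ≤ L * |w - w'|) (hL0 : 0 ≤ L)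
    {x r p q : ℝ} (hx : x ∈ Icc a b) (hpq : p < q)
    (hleft : ∀ w ∈ Icc a b, w ≤ x → r + p * (w - x) ≤ convEnvelope g a b w)
    (hright : ∀ w ∈ Icc a b, x ≤ w → r + q * (w - x) ≤ convEnvelope g a b w) (hr : r < g x) :
    ∃ θ > 0, ∀ w ∈ Icc a b, r + θ + (p + q) / 2 * (w - x) ≤ convEnvelope g a b w := by
  set C := convEnvelope g a b
  set l := (p + q) / 2 with hl
  set η := g x - r with hη
  have hη0 : 0 < η := by linarith
  have hden : 0 < L + |l| + 1 := by positivity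
  set δ := η / 2 / (L + |l| + 1) with hδ
  have hδ0 : 0 < δ := by positivity
  have hδe : δ * (L + |l| + 1) = η / 2 := by rw [hδ]; field_simp
  -- Within δ of x, the Lipschitz bound keeps the raised line of mean slope below g. Farther away,
  -- the kink leaves a gap of at least (q - p)/2 · δ between that line and the envelope.
  set θ := min (η / 2) ((q - p) / 2 * δ) with hθ
  have hθ0 : 0 < θ := lt_min (by linarith) (mul_pos (by linarith) hδ0)
  have hθ1 : θ ≤ η / 2 := min_le_left _ _
  have hθ2 : θ ≤ (q - p) / 2 * δ := min_le_right _ _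
  have hC : ConvexOn ℝ (Icc a b) C := convexOn_convEnvelope hL hL0
  refine ⟨θ, hθ0, fun w hw => ?_⟩
  -- The maximum of the envelope and the raised line is convex and at most g, so it cannot exceed
  -- the envelope.
  have key := le_convEnvelope (g := g) (hC.sup (convexOn_line _ (convex_Icc a b) (r + θ) l x))
    (fun z hz => ?_) hw
  · exact le_sup_right.trans key
  · refine sup_le (convEnvelope_le hL hL0 hz) ?_
    by_cases hzx : |z - x| < δ
    · have h1 := (abs_le.1 (hL z hz x hx)).1
      have h2 : l * (z - x) ≤ |l| * |z - x| := by rw [← abs_mul]; exact le_abs_self _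
      have h3 : (L + |l|) * |z - x| ≤ (L + |l|) * δ :=
        mul_le_mul_of_nonneg_left hzx.le (by positivity)
      nlinarith
    · push Not at hzx
      refine le_trans ?_ (convEnvelope_le hL hL0 hz)
      rcases le_total z x with h | h
      · refine le_trans ?_ (hleft z hz h)
        rw [abs_of_nonpos (by linarith)] at hzx
        have : (q - p) / 2 * δ ≤ (q - p) / 2 * (x - z) :=
          mul_le_mul_of_nonneg_left (by linarith) (by linarith)
        have e : l * (z - x) = p * (z - x) - (q - p) / 2 * (x - z) := by rw [hl]; ring
        linarith
      · refine le_trans ?_ (hright z hz h)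
        rw [abs_of_nonneg (by linarith)] at hzx
        have : (q - p) / 2 * δ ≤ (q - p) / 2 * (z - x) :=
          mul_le_mul_of_nonneg_left (by linarith) (by linarith)
        have e : l * (z - x) = q * (z - x) - (q - p) / 2 * (z - x) := by rw [hl]; ring
        linarith

end Envelope

/-! ### The fan structure of the solution of a Riemann problem -/

theorem countLE_self {m : ℕ} {c : ℕ → ℝ} (hc : ∀ i k, i < k → k < m → c i < c k) {k : ℕ}
    (hk : k < m) : countLE m c (c k) = k + 1 := by
  have hz : ∀ i k, i ≤ k → k < m → c i ≤ c k := fun i k h hk =>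
    h.lt_or_eq.elim (fun h => (hc i k h hk).le) (fun h => h ▸ le_rfl)
  apply le_antisymm
  · by_cases h : k + 1 < m
    · rw [countLE_le_iff hz h]; exact hc _ _ (by omega) h
    · exact (countLE_le _ _ _).trans (by omega)
  · exact (lt_countLE_iff hz).2 ⟨hk, le_rfl⟩

theorem countLE_below {m : ℕ} {c : ℕ → ℝ} (hc : ∀ i k, i < k → k < m → c i < c k) {k : ℕ}
    (hk : k < m) : ∃ ξ₀ < c k, ∀ ξ ∈ Ioo ξ₀ (c k), countLE m c ξ = k := by
  have hz : ∀ i k, i ≤ k → k < m → c i ≤ c k := fun i k h hk =>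
    h.lt_or_eq.elim (fun h => (hc i k h hk).le) (fun h => h ▸ le_rfl)
  rcases Nat.eq_zero_or_pos k with rfl | hpos
  · refine ⟨c 0 - 1, by linarith, fun ξ hξ => ?_⟩
    exact Nat.le_zero.1 ((countLE_le_iff hz hk).2 hξ.2)
  · refine ⟨c (k - 1), hc _ _ (by omega) hk, fun ξ hξ => le_antisymm ((countLE_le_iff hz hk).2 hξ.2) ?_⟩
    have := (lt_countLE_iff hz (x := ξ) (i := k - 1)).2 ⟨by omega, hξ.1.le⟩
    omega

/-- Upward Riemann problems: a solution that is a fan of `m` fronts with states `V` and speeds `c`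
has its states at contact points of the flux with support lines of slopes `c`. -/
theorem riemannSolution_fan_up {g : ℝ → ℝ} {L : ℝ} {m : ℕ} {V c : ℕ → ℝ}
    (hL : ∀ w ∈ Icc (V 0) (V m), ∀ w' ∈ Icc (V 0) (V m), |g w - g w'| ≤ L * |w - w'|) (hL0 : 0 ≤ L)
    (h0m : V 0 ≤ V m) (hc : ∀ i k, i < k → k < m → c i < c k) (hV : ∀ k < m, V k ≠ V (k + 1))
    (hR : ∀ ξ, riemannSolution g (V 0) (V m) ξ = V (countLE m c ξ)) {k : ℕ} (hk : k < m) :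
    V 0 ≤ V k ∧ V k < V (k + 1) ∧ V (k + 1) ≤ V m ∧
      c k * (V (k + 1) - V k) = g (V (k + 1)) - g (V k) ∧
      ∀ w ∈ Icc (V 0) (V m), g (V k) + c k * (w - V k) ≤ g w := by
  set a := V 0 with ha
  set b := V m with hb
  set C := convEnvelope g a b with hC
  set D : ℝ → ℝ := fun w => derivWithin C (Iic w) w with hD
  set E : ℝ → Set ℝ := fun ξ => insert a {w ∈ Ioc a b | D w ≤ ξ} with hE
  have hRE : ∀ ξ, V (countLE m c ξ) = sSup (E ξ) := fun ξ => by
    rw [← hR, riemannSolution, if_pos h0m]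
  have hEsub : ∀ ξ, E ξ ⊆ Icc a b := fun ξ w hw => by
    rcases hw with h | h
    · rw [h]; exact ⟨le_rfl, h0m⟩
    · exact ⟨h.1.1.le, h.1.2⟩
  have hEbdd : ∀ ξ, BddAbove (E ξ) := fun ξ => ⟨b, fun w hw => (hEsub ξ hw).2⟩
  have hEne : ∀ ξ, (E ξ).Nonempty := fun ξ => ⟨a, mem_insert _ _⟩
  have hEmono : ∀ ξ ξ', ξ ≤ ξ' → sSup (E ξ) ≤ sSup (E ξ') := fun ξ ξ' h =>
    csSup_le_csSup (hEbdd _) (hEne _) (insert_subset_insert fun w hw => ⟨hw.1, hw.2.trans h⟩)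
  -- At ξ = c k the fan shows V (k + 1), and just below c k it shows V k. Both states thereby become
  -- suprema of sublevel sets of the slope D.
  have hup : ∀ k < m, V (k + 1) = sSup (E (c k)) := fun k hk => by
    rw [← hRE, countLE_self hc hk]
  have hlow : ∀ k < m, ∃ ξ₀ < c k, ∀ ξ ∈ Ioo ξ₀ (c k), V k = sSup (E ξ) := fun k hk => by
    obtain ⟨ξ₀, h, hξ⟩ := countLE_below hc hk
    exact ⟨ξ₀, h, fun ξ h => by rw [← hRE, hξ ξ h]⟩
  have hmem : ∀ ξ, sSup (E ξ) ∈ Icc a b := fun ξ =>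
    ⟨le_csSup (hEbdd ξ) (mem_insert _ _), csSup_le (hEne ξ) fun w hw => (hEsub ξ hw).2⟩
  have hlt : ∀ k < m, V k < V (k + 1) := fun k hk => by
    refine lt_of_le_of_ne ?_ (hV k hk)
    obtain ⟨ξ₀, h, hξ⟩ := hlow k hk
    obtain ⟨ξ, hξ'⟩ := exists_between h
    rw [hξ ξ hξ', hup k hk]
    exact hEmono _ _ hξ'.2.le
  have hge : ∀ k < m, a ≤ V k := fun k hk => by
    obtain ⟨ξ₀, h, hξ⟩ := hlow k hk
    obtain ⟨ξ, hξ'⟩ := exists_between h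
    rw [hξ ξ hξ']; exact (hmem ξ).1
  have hle : ∀ k < m, V (k + 1) ≤ b := fun k hk => by
    rw [hup k hk]; exact (hmem _).2
  -- the left derivative of the envelope
  have hD1 : ∀ k < m, ∀ w, a < w → w < V (k + 1) → D w ≤ c k := fun k hk w haw hw => by
    rw [hup k hk] at hw
    obtain ⟨w', hw', hlt'⟩ := exists_lt_of_lt_csSup (hEne _) hw
    rcases hw' with h | h
    · rw [h] at hlt'; linarith
    · exact (convEnvelope_derivWithin_le_right hL hL0 haw hlt' h.1.2).trans h.2
  have hD2 : ∀ k < m, ∀ w, V k < w → w ≤ b → c k ≤ D w := fun k hk w hVw hwb => by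
    obtain ⟨ξ₀, h, hξ⟩ := hlow k hk
    refine le_of_forall_lt_imp_le_of_dense fun ξ hξc => ?_
    by_contra hcon
    push Not at hcon
    have h1 : max ξ ((ξ₀ + c k) / 2) ∈ Ioo ξ₀ (c k) :=
      ⟨lt_max_of_lt_right (by linarith), max_lt hξc (by linarith)⟩
    have h2 : w ≤ sSup (E (max ξ ((ξ₀ + c k) / 2))) :=
      le_csSup (hEbdd _) (Or.inr ⟨⟨(hge k hk).trans_lt hVw, hwb⟩, hcon.le.trans (le_max_left _ _)⟩)
    rw [← hξ _ h1] at h2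
    linarith
  -- Between V k and V (k + 1) the slope D is squeezed to c k.
  have hsub : ∀ k < m, ∀ z ∈ Ioo (V k) (V (k + 1)), ∀ w ∈ Icc a b, C z + c k * (w - z) ≤ C w := by
    intro k hk z hz w hw
    have hza : a < z := (hge k hk).trans_lt hz.1
    have hzb : z < b := hz.2.trans_le (hle k hk)
    have hDz : D z = c k := le_antisymm (hD1 k hk z hza hz.2) (hD2 k hk z hz.1 hzb.le)
    rw [← hDz]
    exact convEnvelope_subgradient hL hL0 ⟨hza, hzb⟩ hw
  -- the support lines
  set ℓ : ℕ → ℝ → ℝ := fun k w => C ((V k + V (k + 1)) / 2) + c k * (w - (V k + V (k + 1)) / 2) with hℓ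
  have hmid : ∀ k < m, (V k + V (k + 1)) / 2 ∈ Ioo (V k) (V (k + 1)) := fun k hk =>
    ⟨by linarith [hlt k hk], by linarith [hlt k hk]⟩
  have hIoo : ∀ k < m, Ioo (V k) (V (k + 1)) ⊆ Icc a b := fun k hk w hw =>
    ⟨(hge k hk).trans hw.1.le, hw.2.le.trans (hle k hk)⟩
  have hℓC : ∀ k < m, ∀ w ∈ Icc a b, ℓ k w ≤ C w := fun k hk w hw => hsub k hk _ (hmid k hk) w hw
  have hCℓ : ∀ k < m, ∀ w ∈ Ioo (V k) (V (k + 1)), C w = ℓ k w := fun k hk w hw => by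
    refine le_antisymm ?_ (hℓC k hk w (hIoo k hk hw))
    have := hsub k hk w hw _ (hIoo k hk (hmid k hk))
    simp only [hℓ]
    linarith
  have hℓsub : ∀ k w x, ℓ k w = ℓ k x + c k * (w - x) := fun k w x => by simp only [hℓ]; ring
  have hCg : ∀ w ∈ Icc a b, C w ≤ g w := fun w hw => convEnvelope_le hL hL0 hw
  have hVmem : ∀ k < m, V k ∈ Icc a b := fun k hk =>
    ⟨hge k hk, (hlt k hk).le.trans (hle k hk)⟩
  have hVmem' : ∀ k < m, V (k + 1) ∈ Icc a b := fun k hk =>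
    ⟨(hge k hk).trans (hlt k hk).le, hle k hk⟩
  have cmp : ∀ k < m, ∀ i < m,
      ℓ i (V k) ≤ ℓ k (V k) ∧ ℓ i (V (k + 1)) ≤ ℓ k (V (k + 1)) := fun k hk i hi => by
    have := affine_nonneg_of_Ioo (α := ℓ k 0 - ℓ i 0) (β := c k - c i) (hlt k hk) fun w hw => by
      have h1 := hℓC i hi w (hIoo k hk hw)
      rw [hCℓ k hk w hw, hℓsub k w 0, hℓsub i w 0] at h1
      linarith
    rw [hℓsub k (V k) 0, hℓsub i (V k) 0, hℓsub k (V (k + 1)) 0, hℓsub i (V (k + 1)) 0]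
    constructor <;> linarith [this.1, this.2]
  -- On (V k, V (k + 1)) the envelope is the line ℓ k, so by continuity no line below the envelope
  -- can be strictly above ℓ k at an end of this interval.
  have noLift : ∀ k < m, ∀ θ > 0, ∀ l,
      (¬ ∀ w ∈ Icc a b, ℓ k (V k) + θ + l * (w - V k) ≤ C w) ∧
      (¬ ∀ w ∈ Icc a b, ℓ k (V (k + 1)) + θ + l * (w - V (k + 1)) ≤ C w) := by
    intro k hk θ hθ l
    constructor <;> intro hcon
    · have := (affine_nonneg_of_Ioo (α := -θ - (c k - l) * V k) (β := c k - l) (hlt k hk) fun w hw => by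
        have h1 := hcon w (hIoo k hk hw)
        rw [hCℓ k hk w hw, hℓsub k w (V k)] at h1
        linarith).1
      linarith
    · have := (affine_nonneg_of_Ioo (α := -θ - (c k - l) * V (k + 1)) (β := c k - l) (hlt k hk)
        fun w hw => by
          have h1 := hcon w (hIoo k hk hw)
          rw [hCℓ k hk w hw, hℓsub k w (V (k + 1))] at h1
          linarith).2
      linarith
  -- If the envelope stayed below g at V k, the kink between the slopes c (k - 1) and c k could be
  -- raised. At V 0 there is nothing on the left, so any slope smaller than c k may serve as the
  -- left one.
  have left_eq : ∀ k < m, ℓ k (V k) = g (V k) := fun k hk => by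
    refine le_antisymm ((hℓC k hk _ (hVmem k hk)).trans (hCg _ (hVmem k hk))) ?_
    by_contra hcon
    push Not at hcon
    have hright : ∀ w ∈ Icc a b, V k ≤ w → ℓ k (V k) + c k * (w - V k) ≤ C w := fun w hw _ => by
      rw [← hℓsub]; exact hℓC k hk w hw
    rcases Nat.eq_zero_or_pos k with h0 | hpos
    · obtain ⟨θ, hθ, h⟩ := convEnvelope_lift_kink hL hL0 (p := c k - 1) (hVmem k hk) (by linarith)
        (fun w hw hwk => by
          have : w = V k := le_antisymm hwk (by rw [h0]; exact hw.1)
          rw [this]; simpa using hℓC k hk _ (hVmem k hk)) hright hcon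
      exact (noLift k hk θ hθ _).1 h
    · obtain ⟨θ, hθ, h⟩ := convEnvelope_lift_kink hL hL0 (p := c (k - 1)) (hVmem k hk)
        (hc _ _ (by omega) hk)
        (fun w hw _ => by
          have h1 := hℓC (k - 1) (by omega) w hw
          have h2 := (cmp (k - 1) (by omega) k hk).2
          rw [show k - 1 + 1 = k by omega] at h2
          rw [hℓsub (k - 1) w (V k)] at h1
          linarith) hright hcon
      exact (noLift k hk θ hθ _).1 h
  have right_eq : ∀ k < m, ℓ k (V (k + 1)) = g (V (k + 1)) := fun k hk => by
    refine le_antisymm ((hℓC k hk _ (hVmem' k hk)).trans (hCg _ (hVmem' k hk))) ?_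
    by_cases hkm : k + 1 < m
    · rw [← left_eq (k + 1) hkm]
      exact (cmp k hk (k + 1) hkm).2
    · have hkm' : V (k + 1) = b := by rw [hb]; congr 1; omega
      by_contra hcon
      push Not at hcon
      obtain ⟨θ, hθ, h⟩ := convEnvelope_lift_kink hL hL0 (p := c k) (q := c k + 1) (hVmem' k hk)
        (by linarith) (fun w hw _ => by rw [← hℓsub]; exact hℓC k hk w hw)
        (fun w hw hwk => by
          have : w = V (k + 1) := le_antisymm (by rw [hkm']; exact hw.2) hwk
          rw [this]; simpa using hℓC k hk _ (hVmem' k hk)) hcon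
      exact (noLift k hk θ hθ _).2 h
  refine ⟨hge k hk, hlt k hk, hle k hk, ?_, fun w hw => ?_⟩
  · rw [← left_eq k hk, ← right_eq k hk, hℓsub k (V (k + 1)) (V k)]; ring
  · rw [← left_eq k hk, ← hℓsub]
    exact (hℓC k hk w hw).trans (hCg w hw)

/-! ### Reflection `u ↦ -u` -/

theorem concEnvelope_eq_neg (g : ℝ → ℝ) (a b w : ℝ) :
    concEnvelope g a b w = -convEnvelope (fun z => -g (-z)) (-b) (-a) (-w) := by
  unfold concEnvelope convEnvelope
  rw [Real.sInf_def]
  congr 2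
  ext r
  simp only [Set.mem_neg, mem_ofPred_eq]
  have neg_mem : ∀ {x}, x ∈ Icc a b → -x ∈ Icc (-b) (-a) := fun {x} hx =>
    ⟨neg_le_neg hx.2, neg_le_neg hx.1⟩
  have neg_mem' : ∀ {x}, x ∈ Icc (-b) (-a) → -x ∈ Icc a b := fun {x} hx =>
    ⟨by linarith [hx.2], by linarith [hx.1]⟩
  constructor
  · rintro ⟨φ, hφ, h, hr⟩
    refine ⟨fun z => -φ (-z), ⟨convex_Icc _ _, fun x hx y hy p q hp hq hpq => ?_⟩,
      fun z hz => neg_le_neg (h _ (neg_mem' hz)), by simp only [neg_neg]; linarith⟩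
    have := hφ.2 (neg_mem' hx) (neg_mem' hy) hp hq hpq
    simp only [smul_eq_mul] at this ⊢
    rw [show -(p * x + q * y) = p * -x + q * -y by ring]
    linarith
  · rintro ⟨φ, hφ, h, hr⟩
    refine ⟨fun z => -φ (-z), ⟨convex_Icc _ _, fun x hx y hy p q hp hq hpq => ?_⟩,
      fun z hz => ?_, by simp only []; linarith⟩
    · have := hφ.2 (neg_mem hx) (neg_mem hy) hp hq hpq
      simp only [smul_eq_mul] at this ⊢
      rw [show -(p * x + q * y) = p * -x + q * -y by ring]
      linarith
    · have := h _ (neg_mem hz)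
      simp only [neg_neg] at this
      linarith

theorem riemannSolution_eq_neg (g : ℝ → ℝ) {ul ur : ℝ} (h : ur < ul) (ξ : ℝ) :
    riemannSolution g ul ur ξ = -riemannSolution (fun z => -g (-z)) (-ul) (-ur) ξ := by
  unfold riemannSolution
  rw [if_neg (not_le.2 h), if_pos (by linarith), Real.sInf_def]
  congr 2
  ext w
  have hder : derivWithin (concEnvelope g ur ul) (Ici (-w)) (-w) =
      derivWithin (convEnvelope (fun z => -g (-z)) (-ul) (-ur)) (Iic w) w := by
    have : concEnvelope g ur ul = -fun x => convEnvelope (fun z => -g (-z)) (-ul) (-ur) (-x) :=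
      funext fun x => concEnvelope_eq_neg g ur ul x
    rw [this, derivWithin.neg, derivWithin_comp_neg]
    simp
  simp only [Set.mem_neg, mem_insert_iff, mem_ofPred_eq, hder, mem_Ico, mem_Ioc]
  constructor
  · rintro (h | ⟨⟨h1, h2⟩, h3⟩)
    · left; linarith
    · right; exact ⟨⟨by linarith, by linarith⟩, h3⟩
  · rintro (h | ⟨⟨h1, h2⟩, h3⟩)
    · left; linarith
    · right; exact ⟨⟨by linarith, by linarith⟩, h3⟩

theorem riemannSolution_fan_down {g : ℝ → ℝ} {L : ℝ} {m : ℕ} {V c : ℕ → ℝ}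
    (hL : ∀ w ∈ Icc (V m) (V 0), ∀ w' ∈ Icc (V m) (V 0), |g w - g w'| ≤ L * |w - w'|) (hL0 : 0 ≤ L)
    (h0m : V m < V 0) (hc : ∀ i k, i < k → k < m → c i < c k) (hV : ∀ k < m, V k ≠ V (k + 1))
    (hR : ∀ ξ, riemannSolution g (V 0) (V m) ξ = V (countLE m c ξ)) {k : ℕ} (hk : k < m) :
    V k ≤ V 0 ∧ V (k + 1) < V k ∧ V m ≤ V (k + 1) ∧
      c k * (V (k + 1) - V k) = g (V (k + 1)) - g (V k) ∧
      ∀ w ∈ Icc (V m) (V 0), g w ≤ g (V k) + c k * (w - V k) := by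
  obtain ⟨h1, h2, h3, h4, h5⟩ := riemannSolution_fan_up (g := fun z => -g (-z)) (V := fun i => -V i)
    (c := c) (m := m) (L := L) (fun w hw w' hw' => by
      have := hL (-w) ⟨by linarith [hw.2], by linarith [hw.1]⟩ (-w')
        ⟨by linarith [hw'.2], by linarith [hw'.1]⟩
      rw [show -g (-w) - -g (-w') = -(g (-w) - g (-w')) by ring, abs_neg]
      rwa [show -w - -w' = -(w - w') by ring, abs_neg] at this) hL0 (by linarith) hc
    (fun k hk h => hV k hk (by linarith)) (fun ξ => by
      have := hR ξ
      rw [riemannSolution_eq_neg g h0m] at this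
      linarith) hk
  simp only [neg_neg] at h4 h5
  refine ⟨by linarith, by linarith, by linarith, by linarith, fun w hw => ?_⟩
  have := h5 (-w) ⟨by linarith [hw.2], by linarith [hw.1]⟩
  simp only [neg_neg] at this
  linarith

/-! ### Wavefront tracking in terms of waves -/

/-- Piecewise constant data in stages `j = 0, 1, …`, seen from the waves.  In stage `j` there are
`num j` fronts with states `state j`, speeds `speed j`, positions `start j` and `endpoint j` at the
beginning and at the end of the stage; `front j s` is the front that contains the wave `s`. -/
structure FrontModel where
  flux : ℝ → ℝ
  K : ℝ
  L : ℝ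
  states : Set ℝ
  value : ℝ → ℝ
  sign : ℝ → ℝ
  alive : ℕ → Set ℝ
  front : ℕ → ℝ → ℕ
  num : ℕ → ℕ
  state : ℕ → ℕ → ℝ
  speed : ℕ → ℕ → ℝ
  start : ℕ → ℕ → ℝ
  endpoint : ℕ → ℕ → ℝ
  K_nonneg : 0 ≤ K
  continuous_flux : ContinuousOn flux (convexHull ℝ states)
  slope_bounds : ∀ a ∈ states, ∀ b ∈ states, a < b → ∃ m M, M - m ≤ K * (b - a) ∧
    ∀ p q, a ≤ p → p ≤ q → q ≤ b → m * (q - p) ≤ flux q - flux p ∧ flux q - flux p ≤ M * (q - p)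
  second_difference : ∀ p ∈ states, ∀ q ∈ states, ∀ r ∈ states, p ≤ q → q ≤ r →
    |flux r - flux q - flux (p + r - q) + flux p| ≤ K * (r - q) * (q - p)
  state_mem : ∀ j, ∀ i ≤ num j, state j i ∈ states
  alive_anti : Antitone alive
  alive_zero : alive 0 ⊆ Icc 0 L
  measurableSet_front : ∀ j i, MeasurableSet {s ∈ alive j | front j s = i}
  front_lt : ∀ j, ∀ s ∈ alive j, front j s < num j
  front_mono : ∀ j, ∀ s ∈ alive j, ∀ s' ∈ alive j, s ≤ s' → front j s ≤ front j s'
  volume_front : ∀ j, ∀ i < num j,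
    volume {s ∈ alive j | front j s = i} = ENNReal.ofReal |state j (i + 1) - state j i|
  state_ne : ∀ j, ∀ i < num j, state j i ≠ state j (i + 1)
  sign_eq : ∀ j, ∀ s ∈ alive j, sign s = if state j (front j s) < state j (front j s + 1) then 1 else -1
  value_eq : ∀ j, ∀ s ∈ alive j, value s = state j (front j s) +
    sign s * (volume ({s' ∈ alive j | front j s' = front j s} ∩ Iio s)).toReal
  speed_eq : ∀ j, ∀ i < num j,
    speed j i * (state j (i + 1) - state j i) = flux (state j (i + 1)) - flux (state j i)
  start_mono : ∀ j i k, i ≤ k → k < num j → start j i ≤ start j k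
  endpoint_mono : ∀ j i k, i ≤ k → k < num j → endpoint j i ≤ endpoint j k
  speed_lt : ∀ j i k, i < k → k < num j → start j i = start j k → speed j i < speed j k
  speed_lt_of_endpoint : ∀ j i k, i < k → k < num j → endpoint j i = endpoint j k → speed j k < speed j i
  binary : ∀ j i i' k k', i < i' → i' < num j → k < k' → k' < num j →
    endpoint j i = endpoint j i' → endpoint j k = endpoint j k' → i = k ∧ i' = k'
  start_eq_endpoint : ∀ j, ∀ s ∈ alive (j + 1), start (j + 1) (front (j + 1) s) = endpoint j (front j s)
  state_left : ∀ j x, state j (countLT (num j) (endpoint j) x) =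
    state (j + 1) (countLT (num (j + 1)) (start (j + 1)) x)
  state_right : ∀ j x, state j (countLE (num j) (endpoint j) x) =
    state (j + 1) (countLE (num (j + 1)) (start (j + 1)) x)
  fan_ne : ∀ j, ∀ k < num j, state j (countLT (num j) (start j) (start j k)) ≠
    state j (countLE (num j) (start j) (start j k))
  fan_up : ∀ j, ∀ k < num j, ∀ a b, a = state j (countLT (num j) (start j) (start j k)) →
    b = state j (countLE (num j) (start j) (start j k)) → a < b →
    a ≤ state j k ∧ state j k < state j (k + 1) ∧ state j (k + 1) ≤ b ∧
      ∀ w ∈ Icc a b, flux (state j k) + speed j k * (w - state j k) ≤ flux w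
  fan_down : ∀ j, ∀ k < num j, ∀ a b, a = state j (countLT (num j) (start j) (start j k)) →
    b = state j (countLE (num j) (start j) (start j k)) → b < a →
    state j k ≤ a ∧ state j (k + 1) < state j k ∧ b ≤ state j (k + 1) ∧
      ∀ w ∈ Icc b a, flux w ≤ flux (state j k) + speed j k * (w - state j k)

namespace FrontModel

/-- The reflection `u ↦ -u`. -/
def neg (M : FrontModel) : FrontModel where
  flux := fun w => -M.flux (-w)
  K := M.K
  L := M.L
  states := -M.states
  value := fun s => -M.value s
  sign := fun s => -M.sign s
  alive := M.alive
  front := M.front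
  num := M.num
  state := fun j i => -M.state j i
  speed := M.speed
  start := M.start
  endpoint := M.endpoint
  K_nonneg := M.K_nonneg
  continuous_flux := by
    refine (M.continuous_flux.comp continuous_neg.continuousOn fun w hw => ?_).neg
    rw [convexHull_neg] at hw
    exact hw
  slope_bounds := fun a ha b hb hab => by
    obtain ⟨m, N, h, h'⟩ := M.slope_bounds (-b) hb (-a) ha (by linarith)
    refine ⟨m, N, by linarith, fun p q hp hpq hq => ?_⟩
    have := h' (-q) (-p) (by linarith) (by linarith) (by linarith)
    constructor <;> linarith [this.1, this.2]
  second_difference := fun p hp q hq r hr hpq hqr => by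
    have := M.second_difference (-r) hr (-q) hq (-p) hp (by linarith) (by linarith)
    rw [show -r + -p - -q = -(p + r - q) by ring] at this
    rw [← abs_neg]
    convert this using 1
    · congr 1; ring
    · ring
  state_mem := fun j i hi => by simpa using M.state_mem j i hi
  alive_anti := M.alive_anti
  alive_zero := M.alive_zero
  measurableSet_front := M.measurableSet_front
  front_lt := M.front_lt
  front_mono := M.front_mono
  volume_front := fun j i hi => by
    rw [M.volume_front j i hi, ← abs_neg]; congr 2; ring
  state_ne := fun j i hi h => M.state_ne j i hi (neg_injective h)
  sign_eq := fun j s hs => by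
    have h1 := M.sign_eq j s hs
    have h2 := M.state_ne j _ (M.front_lt j s hs)
    rcases lt_or_gt_of_ne h2 with h | h
    · rw [if_pos h] at h1
      rw [if_neg (by linarith), h1]
    · rw [if_neg (by linarith)] at h1
      rw [if_pos (by linarith), h1, neg_neg]
  value_eq := fun j s hs => by rw [M.value_eq j s hs]; ring
  speed_eq := fun j i hi => by
    have := M.speed_eq j i hi
    simp only [neg_neg]
    linarith
  start_mono := M.start_mono
  endpoint_mono := M.endpoint_mono
  speed_lt := M.speed_lt
  speed_lt_of_endpoint := M.speed_lt_of_endpoint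
  binary := M.binary
  start_eq_endpoint := M.start_eq_endpoint
  state_left := fun j x => by rw [M.state_left]
  state_right := fun j x => by rw [M.state_right]
  fan_ne := fun j k hk h => M.fan_ne j k hk (neg_injective h)
  fan_up := fun j k hk a b ha hb hab => by
    obtain ⟨h1, h2, h3, h4⟩ := M.fan_down j k hk (-a) (-b) (by rw [ha, neg_neg]) (by rw [hb, neg_neg])
      (by linarith)
    refine ⟨by linarith, by linarith, by linarith, fun w hw => ?_⟩
    have := h4 (-w) ⟨by linarith [hw.2], by linarith [hw.1]⟩
    simp only [neg_neg]
    linarith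
  fan_down := fun j k hk a b ha hb hab => by
    obtain ⟨h1, h2, h3, h4⟩ := M.fan_up j k hk (-a) (-b) (by rw [ha, neg_neg]) (by rw [hb, neg_neg])
      (by linarith)
    refine ⟨by linarith, by linarith, by linarith, fun w hw => ?_⟩
    have := h4 (-w) ⟨by linarith [hw.2], by linarith [hw.1]⟩
    simp only [neg_neg]
    linarith

variable (M : FrontModel)

/-- The waves of the front `i` in stage `j`. -/
def waves (j i : ℕ) : Set ℝ := {s ∈ M.alive j | M.front j s = i}

/-- The waves `p` and `q` have been in the same front in one of the stages up to `j`. -/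
def met (j : ℕ) (p q : ℝ) : Prop :=
  ∃ i ≤ j, p ∈ M.alive i ∧ q ∈ M.alive i ∧ M.front i p = M.front i q

variable {M}

theorem met_mono {j : ℕ} {p q : ℝ} (h : M.met j p q) : M.met (j + 1) p q := by
  obtain ⟨i, hi, h⟩ := h
  exact ⟨i, by omega, h⟩

theorem waves_subset (j i : ℕ) : M.waves j i ⊆ Icc 0 M.L := fun _ hs =>
  M.alive_zero (M.alive_anti (Nat.zero_le j) hs.1)

theorem volume_waves_up {j i : ℕ} (hi : i < M.num j) (hup : M.state j i < M.state j (i + 1)) :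
    (volume (M.waves j i)).toReal = M.state j (i + 1) - M.state j i := by
  rw [waves, M.volume_front j i hi, abs_of_pos (by linarith), ENNReal.toReal_ofReal (by linarith)]

theorem value_up {j i : ℕ} {s : ℝ} (hs : s ∈ M.waves j i)
    (hup : M.state j i < M.state j (i + 1)) :
    M.value s = M.state j i + (volume (M.waves j i ∩ Iio s)).toReal := by
  have h1 := M.value_eq j s hs.1
  have h2 := M.sign_eq j s hs.1
  rw [hs.2] at h1 h2
  rw [if_pos hup] at h2
  rw [h1, h2, one_mul]
  rfl

theorem value_mem_Icc {j i : ℕ} {s : ℝ} (hs : s ∈ M.waves j i)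
    (hup : M.state j i < M.state j (i + 1)) :
    M.value s ∈ Icc (M.state j i) (M.state j (i + 1)) := by
  have hi : i < M.num j := hs.2 ▸ M.front_lt j s hs.1
  have h := value_up hs hup
  have h2 : (volume (M.waves j i ∩ Iio s)).toReal ≤ (volume (M.waves j i)).toReal :=
    ENNReal.toReal_mono ((measure_mono (waves_subset j i)).trans_lt (by simp)).ne
      (measure_mono inter_subset_left)
  rw [volume_waves_up hi hup] at h2
  exact ⟨by rw [h]; linarith [ENNReal.toReal_nonneg (a := volume (M.waves j i ∩ Iio s))],
    by rw [h]; linarith⟩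

/-- In an upward front the value exceeds the left state by the rank of the wave. -/
theorem volume_value_le {j i : ℕ} (hup : M.state j i < M.state j (i + 1)) (r : ℝ) :
    volume {s ∈ M.waves j i | M.value s ≤ r} ≤ ENNReal.ofReal (r - M.state j i) := by
  refine le_trans (measure_mono fun s hs => ?_) (volume_rank_le (waves_subset (M := M) j i) _)
  exact ⟨hs.1, by have := value_up hs.1 hup; linarith [hs.2]⟩

theorem volume_le_value {j i : ℕ} (hi : i < M.num j) (hup : M.state j i < M.state j (i + 1)) (r : ℝ) :
    volume {s ∈ M.waves j i | r ≤ M.value s} ≤ ENNReal.ofReal (M.state j (i + 1) - r) := by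
  refine le_trans (measure_mono fun s hs => ?_) ((volume_le_rank (waves_subset (M := M) j i)
    (r - M.state j i)).trans (ENNReal.ofReal_le_ofReal ?_))
  · exact ⟨hs.1, by have := value_up hs.1 hup; linarith [hs.2]⟩
  · have := volume_waves_up hi hup
    linarith

end FrontModel

/-! ### Waves that have met -/

namespace FrontModel

variable {M : FrontModel}

theorem waves_nonempty {j i : ℕ} (hi : i < M.num j) : (M.waves j i).Nonempty := by
  by_contra h
  have h1 := M.volume_front j i hi
  rw [show {s ∈ M.alive j | M.front j s = i} = ∅ from not_nonempty_iff_eq_empty.1 h] at h1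
  have h2 : 0 < |M.state j (i + 1) - M.state j i| :=
    abs_pos.2 (sub_ne_zero.2 (M.state_ne j i hi).symm)
  simp only [measure_empty] at h1
  exact (ENNReal.ofReal_pos.2 h2).ne h1

theorem sign_eq_one_iff {j : ℕ} {s : ℝ} (hs : s ∈ M.alive j) :
    M.sign s = 1 ↔ M.state j (M.front j s) < M.state j (M.front j s + 1) := by
  rw [M.sign_eq j s hs]
  split_ifs with h
  · simp [h]
  · simp [h]; norm_num

theorem alive_le {i j : ℕ} (h : i ≤ j) {s : ℝ} (hs : s ∈ M.alive j) : s ∈ M.alive i :=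
  M.alive_anti h hs

/-- The numbering of fronts is monotone in the wave, so in the stage where `p` and `q` shared a
front, every wave between them that was alive was in it too. A wave alive now was alive then. -/
theorem met_between {j : ℕ} {p q r : ℝ} (h : M.met j p q) (hr : r ∈ M.alive j) (hpr : p ≤ r)
    (hrq : r ≤ q) : M.sign r = M.sign p ∧ M.met j p r ∧ M.met j r q := by
  obtain ⟨i, hi, hp, hq, hpq⟩ := h
  have hr' := alive_le hi hr
  have h1 := M.front_mono i p hp r hr' hpr
  have h2 := M.front_mono i r hr' q hq hrq
  have h3 : M.front i r = M.front i p := by omega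
  refine ⟨?_, ⟨i, hi, hp, hr', h3.symm⟩, ⟨i, hi, hr', hq, h3.trans hpq⟩⟩
  rw [M.sign_eq i r hr', M.sign_eq i p hp, h3]

theorem met_sign {j : ℕ} {p q : ℝ} (h : M.met j p q) : M.sign q = M.sign p := by
  obtain ⟨i, hi, hp, hq, hpq⟩ := h
  rw [M.sign_eq i q hq, M.sign_eq i p hp, hpq]

theorem lt_of_front_lt {j : ℕ} {p q : ℝ} (hp : p ∈ M.alive j) (hq : q ∈ M.alive j)
    (h : M.front j p < M.front j q) : p < q := by
  by_contra hcon
  have := M.front_mono j q hq p hp (not_lt.1 hcon)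
  omega

/-- Every front contains waves, and those of a front strictly between the fronts of `p` and `q` lie
between `p` and `q`. So all fronts between two waves that have met point in the same direction. -/
theorem met_front {j i : ℕ} {p q : ℝ} (h : M.met j p q) (hp : p ∈ M.alive j) (hq : q ∈ M.alive j)
    (hpi : M.front j p ≤ i) (hiq : i ≤ M.front j q) :
    ∃ s ∈ M.waves j i, M.sign s = M.sign p := by
  rcases hpi.eq_or_lt with h1 | h1
  · exact ⟨p, ⟨hp, h1⟩, rfl⟩
  rcases hiq.eq_or_lt with h2 | h2
  · exact ⟨q, ⟨hq, h2.symm⟩, met_sign h⟩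
  obtain ⟨s, hs⟩ := waves_nonempty (h2.trans (M.front_lt j q hq))
  exact ⟨s, hs, (met_between h hs.1 (lt_of_front_lt hp hs.1 (by rw [hs.2]; exact h1)).le
    (lt_of_front_lt hs.1 hq (by rw [hs.2]; exact h2)).le).1⟩

theorem sign_of_met {j i : ℕ} {p q : ℝ} (h : M.met j p q) (hp : p ∈ M.alive j) (hq : q ∈ M.alive j)
    (hpi : M.front j p ≤ i) (hiq : i ≤ M.front j q) (hup : M.state j i < M.state j (i + 1)) :
    M.sign p = 1 := by
  obtain ⟨s, hs, hsp⟩ := met_front h hp hq hpi hiq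
  rw [← hsp, sign_eq_one_iff hs.1, hs.2]
  exact hup

theorem up_of_met {j i : ℕ} {p q : ℝ} (h : M.met j p q) (hp : p ∈ M.alive j) (hq : q ∈ M.alive j)
    (hpi : M.front j p ≤ i) (hiq : i ≤ M.front j q) (hsgn : M.sign p = 1) :
    M.state j i < M.state j (i + 1) := by
  obtain ⟨s, hs, hsp⟩ := met_front h hp hq hpi hiq
  have := (sign_eq_one_iff hs.1).1 (hsp.trans hsgn)
  rwa [hs.2] at this

theorem state_le_of_up {j a b : ℕ} (hab : a ≤ b)
    (h : ∀ k, a ≤ k → k < b → M.state j k < M.state j (k + 1)) : M.state j a ≤ M.state j b := by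
  induction b, hab using Nat.le_induction with
  | base => exact le_rfl
  | succ b hb ih => exact (ih fun k h1 h2 => h k h1 (by omega)).trans (h b hb (by omega)).le

theorem value_mem {j : ℕ} {s : ℝ} (hs : s ∈ M.alive j) (hsgn : M.sign s = 1) :
    M.value s ∈ Icc (M.state j (M.front j s)) (M.state j (M.front j s + 1)) :=
  value_mem_Icc ⟨hs, rfl⟩ ((sign_eq_one_iff hs).1 hsgn)

theorem value_le_of_met {j i : ℕ} {p q : ℝ} (h : M.met j p q) (hp : p ∈ M.alive j)
    (hq : q ∈ M.alive j) (hpi : M.front j p ≤ i) (hiq : i ≤ M.front j q) (hsgn : M.sign p = 1) :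
    M.value p ≤ M.state j (i + 1) :=
  (value_mem hp hsgn).2.trans (state_le_of_up (by omega) fun _ h1 h2 =>
    up_of_met h hp hq (by omega) (by omega) hsgn)

theorem le_value_of_met {j i : ℕ} {p q : ℝ} (h : M.met j p q) (hp : p ∈ M.alive j)
    (hq : q ∈ M.alive j) (hpi : M.front j p ≤ i) (hiq : i ≤ M.front j q) (hsgn : M.sign p = 1) :
    M.state j i ≤ M.value q :=
  (state_le_of_up hiq fun _ h1 h2 => up_of_met h hp hq (by omega) (by omega) hsgn).trans
    (value_mem hq ((met_sign h).trans hsgn)).1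

/-- If the values stayed ε below the right state, the front would contain too few waves. The value
itself need not be attained, hence the closure. -/
theorem state_mem_closure_right {j i : ℕ} (hi : i < M.num j)
    (hup : M.state j i < M.state j (i + 1)) :
    M.state j (i + 1) ∈ closure (M.value '' M.waves j i) := by
  rw [Metric.mem_closure_iff]
  intro ε hε
  by_contra hcon
  push Not at hcon
  have hsub : M.waves j i ⊆ {s ∈ M.waves j i | M.value s ≤ M.state j (i + 1) - ε} := fun s hs => by
    refine ⟨hs, ?_⟩
    have := hcon _ (mem_image_of_mem _ hs)
    rw [Real.dist_eq, abs_of_nonneg (by linarith [(value_mem_Icc hs hup).2])] at this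
    linarith
  have h1 := (measure_mono hsub).trans (volume_value_le hup _)
  rw [waves, M.volume_front j i hi, abs_of_pos (by linarith)] at h1
  have := (ENNReal.ofReal_lt_ofReal_iff (q := M.state j (i + 1) - M.state j i)
    (p := M.state j (i + 1) - ε - M.state j i) (by linarith)).2 (by linarith)
  exact absurd h1 (not_le.2 this)

theorem state_mem_closure_left {j i : ℕ} (hi : i < M.num j)
    (hup : M.state j i < M.state j (i + 1)) :
    M.state j i ∈ closure (M.value '' M.waves j i) := by
  rw [Metric.mem_closure_iff]
  intro ε hε
  by_contra hcon
  push Not at hcon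
  have hsub : M.waves j i ⊆ {s ∈ M.waves j i | M.state j i + ε ≤ M.value s} := fun s hs => by
    refine ⟨hs, ?_⟩
    have := hcon _ (mem_image_of_mem _ hs)
    rw [Real.dist_eq, abs_of_nonpos (by linarith [(value_mem_Icc hs hup).1])] at this
    linarith
  have h1 := (measure_mono hsub).trans (volume_le_value hi hup _)
  rw [waves, M.volume_front j i hi, abs_of_pos (by linarith)] at h1
  have := (ENNReal.ofReal_lt_ofReal_iff (q := M.state j (i + 1) - M.state j i)
    (p := M.state j (i + 1) - (M.state j i + ε)) (by linarith)).2 (by linarith)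
  exact absurd h1 (not_le.2 this)

theorem continuousOn_flux_Icc {a b : ℝ} (ha : a ∈ M.states) (hb : b ∈ M.states) :
    ContinuousOn M.flux (Icc a b) :=
  M.continuous_flux.mono ((convex_convexHull ℝ M.states).ordConnected.out
    (subset_convexHull ℝ _ ha) (subset_convexHull ℝ _ hb))

/-- A closed relation between fluxes and values extends from waves of a front to limit values. -/
theorem closure_value_le {j i : ℕ} (hi : i < M.num j) (hup : M.state j i < M.state j (i + 1))
    {P : Set ℝ} (hP : P ⊆ M.waves j i) {x : ℝ} (hx : x ∈ closure (M.value '' P)) {α β γ : ℝ}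
    (h : ∀ s ∈ P, 0 ≤ α * M.flux (M.value s) + β * M.value s + γ) :
    0 ≤ α * M.flux x + β * x + γ := by
  have hsub : M.value '' P ⊆ Icc (M.state j i) (M.state j (i + 1)) := by
    rintro _ ⟨s, hs, rfl⟩
    exact value_mem_Icc (hP hs) hup
  have hc : ContinuousWithinAt (fun w => α * M.flux w + β * w + γ) (M.value '' P) x := by
    have h1 : ContinuousWithinAt M.flux (M.value '' P) x :=
      (continuousOn_flux_Icc (M.state_mem j i hi.le) (M.state_mem j (i + 1) hi) x
        (closure_minimal hsub isClosed_Icc hx)).mono hsub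
    exact ((continuousWithinAt_const.mul h1).add
      (continuousWithinAt_const.mul continuousWithinAt_id)).add continuousWithinAt_const
  have := hc.mem_closure (t := Ici 0) hx (by rintro _ ⟨s, hs, rfl⟩; exact h s hs)
  rwa [closure_Ici] at this

/-- The left and right states of the fan through an upward front. -/
theorem fan_of_up {j i : ℕ} (hi : i < M.num j) (hup : M.state j i < M.state j (i + 1)) {a b : ℝ}
    (ha : a = M.state j (countLT (M.num j) (M.start j) (M.start j i)))
    (hb : b = M.state j (countLE (M.num j) (M.start j) (M.start j i))) :
    a ≤ M.state j i ∧ M.state j (i + 1) ≤ b ∧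
      ∀ w ∈ Icc a b, M.flux (M.state j i) + M.speed j i * (w - M.state j i) ≤ M.flux w := by
  rcases lt_or_gt_of_ne (M.fan_ne j i hi) with h | h
  · rw [← ha, ← hb] at h
    obtain ⟨h1, h2, h3, h4⟩ := M.fan_up j i hi a b ha hb h
    exact ⟨h1, h3, h4⟩
  · rw [← ha, ← hb] at h
    obtain ⟨h1, h2, h3, h4⟩ := M.fan_down j i hi a b ha hb h
    linarith

theorem chord_le {j i : ℕ} (hi : i < M.num j) (hup : M.state j i < M.state j (i + 1)) {w : ℝ}
    (hw : w ∈ Icc (M.state j i) (M.state j (i + 1))) :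
    M.flux (M.state j i) + M.speed j i * (w - M.state j i) ≤ M.flux w := by
  obtain ⟨h1, h2, h3⟩ := fan_of_up hi hup rfl rfl
  exact h3 w ⟨h1.trans hw.1, hw.2.trans h2⟩

/-! ### The contact property -/

/-- The boundary `state j (i + 1)` between two upward fronts is a contact point of the flux with its
convex envelope, on the interval of the values of waves that have met waves beyond the boundary. -/
def Contact (M : FrontModel) (j : ℕ) : Prop :=
  ∀ i, i + 1 < M.num j → M.state j i < M.state j (i + 1) → M.state j (i + 1) < M.state j (i + 2) →
    ∀ p ∈ M.alive j, ∀ q ∈ M.alive j, M.front j p ≤ i → i < M.front j q →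
      (∃ r ∈ M.alive j, i < M.front j r ∧ M.met j p r) →
      (∃ r ∈ M.alive j, M.front j r ≤ i ∧ M.met j r q) →
      (M.flux (M.state j (i + 1)) - M.flux (M.value p)) * (M.value q - M.state j (i + 1)) ≤
        (M.flux (M.value q) - M.flux (M.state j (i + 1))) * (M.state j (i + 1) - M.value p)

/-- The support line at the boundary, of slope `speed (j + 1) i`, lies below the flux on the whole
fan, which settles the waves `p` of the same fan. If `p` comes from farther left, the left state a
of the fan was a boundary in stage `j`. Contact there says that the slope over [value p, a] is at
most the slope over [a, b], hence at most that of the support line, so the line stays below the flux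
as far as `value p`. -/
theorem contact_left {j i : ℕ} (ih : M.Contact j) (hi : i + 1 < M.num (j + 1))
    (hup : M.state (j + 1) i < M.state (j + 1) (i + 1)) {p r : ℝ} (hp : p ∈ M.alive (j + 1))
    (hr : r ∈ M.alive (j + 1)) (hpi : M.front (j + 1) p ≤ i) (hir : i < M.front (j + 1) r)
    (hmet : M.met j p r) :
    M.value p ≤ M.state (j + 1) (i + 1) ∧
      M.flux (M.state (j + 1) (i + 1)) +
        M.speed (j + 1) i * (M.value p - M.state (j + 1) (i + 1)) ≤ M.flux (M.value p) := by
  have hi' : i < M.num (j + 1) := by omega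
  have hsgn : M.sign p = 1 := sign_of_met (met_mono hmet) hp hr hpi hir.le hup
  refine ⟨value_le_of_met (met_mono hmet) hp hr hpi hir.le hsgn, ?_⟩
  set x := M.start (j + 1) i with hx
  set a := M.state (j + 1) (countLT (M.num (j + 1)) (M.start (j + 1)) x) with ha
  set b := M.state (j + 1) (i + 1) with hb
  obtain ⟨hai, hib, hsup⟩ := fan_of_up hi' hup ha rfl
  have hRH := M.speed_eq (j + 1) i hi'
  rw [← hb] at hRH
  set c := M.speed (j + 1) i
  have hline : ∀ w ∈ Icc a (M.state (j + 1) (countLE (M.num (j + 1)) (M.start (j + 1)) x)),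
      M.flux b + c * (w - b) ≤ M.flux w := fun w hw => by
    have := hsup w hw; linarith
  have hpx : M.start (j + 1) (M.front (j + 1) p) ≤ x := M.start_mono _ _ _ hpi hi'
  have hpU := value_mem hp hsgn
  have hpup := (sign_eq_one_iff hp).1 hsgn
  rcases hpx.eq_or_lt with hpx | hpx
  · obtain ⟨h1, h2, -⟩ := fan_of_up (M.front_lt _ p hp) hpup rfl rfl
    rw [hpx] at h1 h2
    exact hline _ ⟨h1.trans hpU.1, hpU.2.trans h2⟩
  · have hpj := alive_le (Nat.le_succ j) hp
    have hrj := alive_le (Nat.le_succ j) hr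
    set m := countLT (M.num j) (M.endpoint j) x with hm
    have ham : a = M.state j m := (M.state_left j x).symm
    have hpm : M.front j p < m :=
      (lt_countLT_iff (M.endpoint_mono j)).2 ⟨M.front_lt j p hpj, by rw [← M.start_eq_endpoint j p hp]; exact hpx⟩
    have hmr : ∀ q ∈ M.alive (j + 1), i ≤ M.front (j + 1) q → m ≤ M.front j q := fun q hq hiq => by
      refine (countLT_le_iff (M.endpoint_mono j) (M.front_lt j q (alive_le (Nat.le_succ j) hq))).2 ?_
      rw [← M.start_eq_endpoint j q hq]
      exact M.start_mono _ _ _ hiq (M.front_lt _ q hq)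
    have hmr' := hmr r hr hir.le
    have hm1 : m - 1 + 1 = m := by omega
    have hmn : m < M.num j := hmr'.trans_lt (M.front_lt j r hrj)
    have hcont := ih (m - 1) (by omega)
      (up_of_met hmet hpj hrj (by omega) (by omega) hsgn)
      (up_of_met hmet hpj hrj (by omega) (by omega) hsgn) p hpj
    have hpa : M.value p ≤ a := by
      have := value_le_of_met (i := m - 1) hmet hpj hrj (by omega) (by omega) hsgn
      rwa [hm1, ← ham] at this
    rw [hm1, ← ham] at hcont
    have hfrontp : M.front (j + 1) p < i := by
      by_contra hcon
      have := M.start_mono (j + 1) _ _ (not_lt.1 hcon) (M.front_lt _ p hp)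
      linarith
    -- Contact at a holds against the values of all waves of front i; these accumulate at its right
    -- state b.
    have key := closure_value_le (M := M) (α := a - M.value p)
      (β := -(M.flux a - M.flux (M.value p)))
      (γ := (M.flux a - M.flux (M.value p)) * a - M.flux a * (a - M.value p))
      hi' hup Subset.rfl (state_mem_closure_right hi' hup) (fun q hq => by
        have hqj := alive_le (Nat.le_succ j) hq.1
        have hpq : M.met j p q := (met_between hmet hqj
          (lt_of_front_lt hp hq.1 (by rw [hq.2]; exact hfrontp)).le
          (lt_of_front_lt hq.1 hr (by rw [hq.2]; exact hir)).le).2.1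
        have hmq := hmr q hq.1 hq.2.ge
        have := hcont q hqj (by omega) (by omega) ⟨r, hrj, by omega, hmet⟩ ⟨p, hpj, by omega, hpq⟩
        linarith)
    rw [← hb] at key
    have hab : a < b := hai.trans_lt hup
    have h1 := hline a ⟨le_rfl, hab.le.trans hib⟩
    have h2 : (M.flux b - M.flux a) * (a - M.value p) ≤ c * (b - a) * (a - M.value p) :=
      mul_le_mul_of_nonneg_right (by linarith) (by linarith)
    have h3 : (M.flux a - M.flux (M.value p)) * (b - a) ≤ c * (a - M.value p) * (b - a) := by
      linarith
    have h4 := le_of_mul_le_mul_right h3 (by linarith)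
    linarith

/-- The mirror image of `contact_left`, with the same support line. Both fronts have to start at one
point, so that the line of front `i` supports the flux up to the right state of the fan that also
contains front `i + 1`. -/
theorem contact_right {j i : ℕ} (ih : M.Contact j) (hi : i + 1 < M.num (j + 1))
    (hup : M.state (j + 1) i < M.state (j + 1) (i + 1))
    (hup' : M.state (j + 1) (i + 1) < M.state (j + 1) (i + 2))
    (heq : M.start (j + 1) i = M.start (j + 1) (i + 1)) {q r : ℝ} (hq : q ∈ M.alive (j + 1))
    (hr : r ∈ M.alive (j + 1)) (hri : M.front (j + 1) r ≤ i) (hiq : i < M.front (j + 1) q)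
    (hmet : M.met j r q) :
    M.state (j + 1) (i + 1) ≤ M.value q ∧
      M.flux (M.state (j + 1) (i + 1)) +
        M.speed (j + 1) i * (M.value q - M.state (j + 1) (i + 1)) ≤ M.flux (M.value q) := by
  have hi' : i < M.num (j + 1) := by omega
  have hsgnr : M.sign r = 1 := sign_of_met (met_mono hmet) hr hq hri hiq.le hup
  have hsgn : M.sign q = 1 := (met_sign hmet).trans hsgnr
  refine ⟨le_value_of_met (met_mono hmet) hr hq (by omega) hiq hsgnr, ?_⟩
  set x := M.start (j + 1) i with hx
  set a := M.state (j + 1) (countLE (M.num (j + 1)) (M.start (j + 1)) x) with ha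
  set b := M.state (j + 1) (i + 1) with hb
  obtain ⟨hai, hib, hsup⟩ := fan_of_up hi' hup rfl ha
  obtain ⟨-, hib', -⟩ := fan_of_up hi hup' rfl rfl
  rw [← heq, ← ha] at hib'
  have hRH := M.speed_eq (j + 1) i hi'
  rw [← hb] at hRH
  set c := M.speed (j + 1) i
  have hline : ∀ w ∈ Icc (M.state (j + 1) (countLT (M.num (j + 1)) (M.start (j + 1)) x)) a,
      M.flux b + c * (w - b) ≤ M.flux w := fun w hw => by
    have := hsup w hw; linarith
  have hqx : x ≤ M.start (j + 1) (M.front (j + 1) q) := M.start_mono _ _ _ hiq.le (M.front_lt _ q hq)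
  have hqU := value_mem hq hsgn
  have hqup := (sign_eq_one_iff hq).1 hsgn
  rcases hqx.eq_or_lt with hqx | hqx
  · obtain ⟨h1, h2, -⟩ := fan_of_up (M.front_lt _ q hq) hqup rfl rfl
    rw [← hqx] at h1 h2
    exact hline _ ⟨h1.trans hqU.1, hqU.2.trans h2⟩
  · have hqj := alive_le (Nat.le_succ j) hq
    have hrj := alive_le (Nat.le_succ j) hr
    set m := countLE (M.num j) (M.endpoint j) x with hm
    have ham : a = M.state j m := (M.state_right j x).symm
    have hmq : m ≤ M.front j q :=
      (countLE_le_iff (M.endpoint_mono j) (M.front_lt j q hqj)).2 (by rw [← M.start_eq_endpoint j q hq]; exact hqx)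
    have hrm : ∀ p ∈ M.alive (j + 1), M.front (j + 1) p ≤ i + 1 → M.front j p < m := fun p hp hpi => by
      refine (lt_countLE_iff (M.endpoint_mono j)).2 ⟨M.front_lt j p (alive_le (Nat.le_succ j) hp), ?_⟩
      rw [← M.start_eq_endpoint j p hp, heq]
      exact M.start_mono _ _ _ hpi hi
    have hrm' := hrm r hr (by omega)
    have hm1 : m - 1 + 1 = m := by omega
    have hmn : m < M.num j := hmq.trans_lt (M.front_lt j q hqj)
    have hcont := ih (m - 1) (by omega)
      (up_of_met hmet hrj hqj (by omega) (by omega) hsgnr)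
      (up_of_met hmet hrj hqj (by omega) (by omega) hsgnr)
    have hpa : a ≤ M.value q := by
      have := le_value_of_met (i := m) hmet hrj hqj (by omega) (by omega) hsgnr
      rwa [← ham] at this
    rw [hm1, ← ham] at hcont
    have hfrontq : i + 1 < M.front (j + 1) q := by
      by_contra hcon
      have := M.start_mono (j + 1) _ _ (not_lt.1 hcon) hi
      linarith
    have key := closure_value_le (M := M) (α := M.value q - a)
      (β := -(M.flux (M.value q) - M.flux a))
      (γ := (M.flux (M.value q) - M.flux a) * a - M.flux a * (M.value q - a))
      hi hup' Subset.rfl (state_mem_closure_left hi hup') (fun p hp => by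
        have hpj := alive_le (Nat.le_succ j) hp.1
        have hpq : M.met j p q := (met_between hmet hpj
          (lt_of_front_lt hr hp.1 (by rw [hp.2]; omega)).le
          (lt_of_front_lt hp.1 hq (by rw [hp.2]; exact hfrontq)).le).2.2
        have hmp := hrm p hp.1 hp.2.le
        have := hcont p hpj q hqj (by omega) (by omega) ⟨q, hqj, by omega, hpq⟩ ⟨r, hrj, by omega, hmet⟩
        linarith)
    rw [← hb] at key
    have hab : b < a := hup'.trans_le hib'
    have h1 := hline a ⟨hai.trans (hup.le.trans hib), le_rfl⟩
    have h2 : c * (a - b) * (M.value q - a) ≤ (M.flux a - M.flux b) * (M.value q - a) :=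
      mul_le_mul_of_nonneg_right (by linarith) (by linarith)
    have h3 : c * (M.value q - a) * (a - b) ≤ (M.flux (M.value q) - M.flux a) * (a - b) := by
      linarith
    have h4 := le_of_mul_le_mul_right h3 (by linarith)
    linarith

/-- In stage 0 no waves of different fronts have met. Later, waves separated by the boundary can
only have met in an earlier stage. If the boundary lies inside a fan, one support line through it
lies below the flux at both values; comparing it on the two sides gives the inequality. -/
theorem contact (M : FrontModel) (j : ℕ) : M.Contact j := by
  induction j with
  | zero =>
    rintro i hi hup hup' p hp q hq hpi hiq ⟨r, hr, hir, k, hk, -, -, hpr⟩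
    obtain rfl : k = 0 := by omega
    omega
  | succ j ih =>
    rintro i hi hup hup' p hp q hq hpi hiq ⟨r, hr, hir, hmet⟩ ⟨r', hr', hri', hmet'⟩
    have hmetj : M.met j p r := by
      obtain ⟨k, hk, h1, h2, h3⟩ := hmet
      rcases Nat.lt_or_ge k (j + 1) with h | h
      · exact ⟨k, by omega, h1, h2, h3⟩
      · obtain rfl : k = j + 1 := by omega
        omega
    have hmetj' : M.met j r' q := by
      obtain ⟨k, hk, h1, h2, h3⟩ := hmet'
      rcases Nat.lt_or_ge k (j + 1) with h | h
      · exact ⟨k, by omega, h1, h2, h3⟩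
      · obtain rfl : k = j + 1 := by omega
        omega
    have hi' : i < M.num (j + 1) := by omega
    rcases (M.start_mono (j + 1) i (i + 1) (by omega) hi).eq_or_lt with heq | hlt
    · obtain ⟨h1, h2⟩ := contact_left ih hi hup hp hr hpi hir hmetj
      obtain ⟨h3, h4⟩ := contact_right ih hi hup hup' heq hq hr' hri' hiq hmetj'
      set b := M.state (j + 1) (i + 1)
      set c := M.speed (j + 1) i
      have h5 : (M.flux b - M.flux (M.value p)) * (M.value q - b) ≤
          c * (b - M.value p) * (M.value q - b) :=
        mul_le_mul_of_nonneg_right (by linarith) (by linarith)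
      have h6 : c * (M.value q - b) * (b - M.value p) ≤
          (M.flux (M.value q) - M.flux b) * (b - M.value p) :=
        mul_le_mul_of_nonneg_right (by linarith) (by linarith)
      linarith
    -- The two fronts start at different points, so their common state is a value between these
    -- points at the end of stage j. It was a boundary there too, with the same waves on either
    -- side.
    · set x := M.start (j + 1) i with hx
      set m := countLE (M.num j) (M.endpoint j) x with hm
      have hcount : countLE (M.num (j + 1)) (M.start (j + 1)) x = i + 1 := by
        apply le_antisymm
        · exact (countLE_le_iff (M.start_mono (j + 1)) hi).2 hlt
        · exact (lt_countLE_iff (M.start_mono (j + 1))).2 ⟨hi', le_rfl⟩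
      have hbm : M.state (j + 1) (i + 1) = M.state j m := by
        rw [← hcount]; exact (M.state_right j x).symm
      have hsgn : M.sign p = 1 := sign_of_met hmet hp hr hpi hir.le hup
      have hleft : ∀ s ∈ M.alive (j + 1), M.front (j + 1) s ≤ i → M.front j s < m := fun s hs hsi => by
        refine (lt_countLE_iff (M.endpoint_mono j)).2 ⟨M.front_lt j s (alive_le (Nat.le_succ j) hs), ?_⟩
        rw [← M.start_eq_endpoint j s hs]
        exact M.start_mono _ _ _ hsi hi'
      have hright : ∀ s ∈ M.alive (j + 1), i < M.front (j + 1) s → m ≤ M.front j s := fun s hs hsi => by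
        refine (countLE_le_iff (M.endpoint_mono j) (M.front_lt j s (alive_le (Nat.le_succ j) hs))).2 ?_
        rw [← M.start_eq_endpoint j s hs]
        exact hlt.trans_le (M.start_mono _ _ _ hsi (M.front_lt _ s hs))
      have hpj := alive_le (Nat.le_succ j) hp
      have hqj := alive_le (Nat.le_succ j) hq
      have hrj := alive_le (Nat.le_succ j) hr
      have h1 := hleft p hp hpi
      have h2 := hright q hq hiq
      have h3 := hright r hr hir
      have h4 := hleft r' hr' hri'
      have hm1 : m - 1 + 1 = m := by omega
      have hmn : m < M.num j := h3.trans_lt (M.front_lt j r hrj)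
      have := ih (m - 1) (by omega) (up_of_met hmetj hpj hrj (by omega) (by omega) hsgn)
        (up_of_met hmetj hpj hrj (by omega) (by omega) hsgn) p hpj q hqj (by omega) (by omega)
        ⟨r, hrj, by omega, hmetj⟩ ⟨r', alive_le (Nat.le_succ j) hr', by omega, hmetj'⟩
      rwa [hm1, ← hbm] at this

end FrontModel

/-! ### The interaction estimate -/

/-- The left side is the double integral of g'(x) - g'(y) over [a, b] × [b, c]. By contact, the part
over [α, b] × [b, γ] is not positive. On the rest the integrand is at most M - m, and the second
factor on the right is the area of the rest. -/
theorem interaction_algebra {g : ℝ → ℝ} {a α b γ c m M K : ℝ} (haα : a ≤ α) (hαb : α ≤ b)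
    (hbγ : b ≤ γ) (hγc : γ ≤ c) (hmM : M - m ≤ K * (c - a))
    (hg : ∀ p q, a ≤ p → p ≤ q → q ≤ c → m * (q - p) ≤ g q - g p ∧ g q - g p ≤ M * (q - p))
    (hcontact : (g b - g α) * (γ - b) ≤ (g γ - g b) * (b - α)) :
    (g b - g a) * (c - b) - (g c - g b) * (b - a) ≤
      K * (c - a) * ((b - a) * (c - b) - (b - α) * (γ - b)) := by
  have h1 : (g α - g a) * (c - b) ≤ M * (α - a) * (c - b) :=
    mul_le_mul_of_nonneg_right (hg a α le_rfl haα (by linarith)).2 (by linarith)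
  have h2 : (g b - g α) * (c - γ) ≤ M * (b - α) * (c - γ) :=
    mul_le_mul_of_nonneg_right (hg α b haα hαb (by linarith)).2 (by linarith)
  have h3 : m * (c - γ) * (b - a) ≤ (g c - g γ) * (b - a) :=
    mul_le_mul_of_nonneg_right (hg γ c (by linarith) hγc le_rfl).1 (by linarith)
  have h4 : m * (γ - b) * (α - a) ≤ (g γ - g b) * (α - a) :=
    mul_le_mul_of_nonneg_right (hg b γ (by linarith) hbγ hγc).1 (by linarith)
  have h5 : 0 ≤ (b - a) * (c - b) - (b - α) * (γ - b) := by
    nlinarith [mul_nonneg (sub_nonneg.2 haα) (sub_nonneg.2 (hbγ.trans hγc)),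
      mul_nonneg (sub_nonneg.2 hαb) (sub_nonneg.2 hγc)]
  have h6 := mul_le_mul_of_nonneg_right hmM h5
  nlinarith

theorem counts_of_level {n : ℕ} {z : ℕ → ℝ} (hz : ∀ i k, i ≤ k → k < n → z i ≤ z k) {x : ℝ}
    {i i' : ℕ} (hii : i ≤ i') (hi' : i' < n) (h : ∀ k < n, z k = x ↔ i ≤ k ∧ k ≤ i') :
    countLT n z x = i ∧ countLE n z x = i' + 1 := by
  have h1 : z i = x := (h i (by omega)).2 ⟨le_rfl, hii⟩
  have h2 : z i' = x := (h i' hi').2 ⟨hii, le_rfl⟩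
  constructor
  · refine le_antisymm ((countLT_le_iff hz (by omega)).2 h1.ge) ?_
    rcases Nat.eq_zero_or_pos i with h0 | h0
    · omega
    · have : i - 1 < countLT n z x := (lt_countLT_iff hz).2 ⟨by omega,
        lt_of_le_of_ne (h1 ▸ hz _ _ (by omega) (by omega)) fun he => by
          have := (h (i - 1) (by omega)).1 he
          omega⟩
      omega
  · refine le_antisymm ?_ ((lt_countLE_iff hz).2 ⟨hi', h2.le⟩)
    by_cases hn : i' + 1 < n
    · refine (countLE_le_iff hz hn).2 (lt_of_le_of_ne (h2 ▸ hz _ _ (by omega) hn) fun he => ?_)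
      have := (h (i' + 1) hn).1 he.symm
      omega
    · exact (countLE_le _ _ _).trans (by omega)

namespace FrontModel

variable {M : FrontModel}

/-- The change of the speed of the wave `s` from stage `j` to the next one. -/
def jump (M : FrontModel) (j : ℕ) (s : ℝ) : ENNReal :=
  edist (M.speed j (M.front j s)) (M.speed (j + 1) (M.front (j + 1) s))

/-- The pairs of waves that are in the same front in stage `j + 1` for the first time. -/
def newPairs (M : FrontModel) (j : ℕ) : Set (ℝ × ℝ) :=
  {w | M.met (j + 1) w.1 w.2 ∧ ¬ M.met j w.1 w.2}

/-- If the chord of the outer states lies below the flux, it is the convex envelope, and every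
outgoing front has its slope. Concretely, chord and support line of the front both lie below the
flux, and each is compared with the other where the other touches the flux. -/
theorem speed_eq_of_chord {j k : ℕ} (hk : k < M.num (j + 1)) {a b c : ℝ} (hab : a < b)
    (ha : a = M.state (j + 1) (countLT (M.num (j + 1)) (M.start (j + 1)) (M.start (j + 1) k)))
    (hb : b = M.state (j + 1) (countLE (M.num (j + 1)) (M.start (j + 1)) (M.start (j + 1) k)))
    (hc : c * (b - a) = M.flux b - M.flux a)
    (hchord : ∀ w ∈ Icc a b, M.flux a + c * (w - a) ≤ M.flux w) : M.speed (j + 1) k = c := by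
  obtain ⟨h1, h2, h3, h4⟩ := M.fan_up (j + 1) k hk a b ha hb hab
  have hRH := M.speed_eq (j + 1) k hk
  set v := M.state (j + 1) k
  set v' := M.state (j + 1) (k + 1)
  set d := M.speed (j + 1) k
  have e1 := h4 a ⟨le_rfl, hab.le⟩
  have e2 := h4 b ⟨hab.le, le_rfl⟩
  have e3 := hchord v ⟨h1, by linarith⟩
  have e4 := hchord v' ⟨by linarith, h3⟩
  apply le_antisymm
  · exact le_of_mul_le_mul_right (a := b - v) (by linarith) (by linarith)
  · exact le_of_mul_le_mul_right (a := v' - a) (by linarith) (by linarith)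

/-- A front that meets no other one poses the Riemann problem of its own two states, and its chord
already lies below the flux. So the dividing times may include times without collisions. -/
theorem speed_eq_of_single_up {j i : ℕ} (hi : i < M.num j) (hup : M.state j i < M.state j (i + 1))
    (h : ∀ k < M.num j, M.endpoint j k = M.endpoint j i → k = i) {k : ℕ} (hk : k < M.num (j + 1))
    (hki : M.start (j + 1) k = M.endpoint j i) : M.speed (j + 1) k = M.speed j i := by
  obtain ⟨h1, h2⟩ := counts_of_level (M.endpoint_mono j) (x := M.endpoint j i) (i := i) (i' := i) le_rfl hi
    fun k hk => ⟨fun he => by have := h k hk he; omega, fun he => by rw [show k = i by omega]⟩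
  refine speed_eq_of_chord hk hup ?_ ?_ (M.speed_eq j i hi) fun w hw => chord_le hi hup hw
  · rw [hki, ← M.state_left, h1]
  · rw [hki, ← M.state_right, h2]

theorem speed_eq_of_single {j i : ℕ} (hi : i < M.num j)
    (h : ∀ k < M.num j, M.endpoint j k = M.endpoint j i → k = i) {k : ℕ} (hk : k < M.num (j + 1))
    (hki : M.start (j + 1) k = M.endpoint j i) : M.speed (j + 1) k = M.speed j i := by
  rcases lt_or_gt_of_ne (M.state_ne j i hi) with hup | hup
  · exact speed_eq_of_single_up hi hup h hk hki
  · exact speed_eq_of_single_up (M := M.neg) (j := j) (i := i) hi (neg_lt_neg hup) h hk hki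

theorem jump_eq_zero {j : ℕ} {s : ℝ} (hs : s ∈ M.alive (j + 1))
    (h : ∀ k < M.num j, M.endpoint j k = M.endpoint j (M.front j s) → k = M.front j s) :
    M.jump j s = 0 := by
  rw [jump, speed_eq_of_single (M.front_lt j s (alive_le (Nat.le_succ j) hs)) h (M.front_lt _ s hs)
    (M.start_eq_endpoint j s hs), edist_self]

theorem measurableSet_alive (j : ℕ) : MeasurableSet (M.alive j) := by
  have : M.alive j = ⋃ i, M.waves j i := by
    ext s
    simp only [mem_iUnion]
    exact ⟨fun h => ⟨_, h, rfl⟩, fun ⟨i, h⟩ => h.1⟩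
  rw [this]
  exact MeasurableSet.iUnion fun i => M.measurableSet_front j i

theorem measurableSet_met (j : ℕ) : MeasurableSet {w : ℝ × ℝ | M.met j w.1 w.2} := by
  have : {w : ℝ × ℝ | M.met j w.1 w.2} = ⋃ i ∈ Iic j, ⋃ k, M.waves i k ×ˢ M.waves i k := by
    ext w
    simp only [mem_iUnion, mem_prod, exists_prop, mem_Iic]
    constructor
    · rintro ⟨i, hi, h1, h2, h3⟩
      exact ⟨i, hi, M.front i w.1, ⟨h1, rfl⟩, ⟨h2, h3.symm⟩⟩
    · rintro ⟨i, hi, k, ⟨h1, h2⟩, ⟨h3, h4⟩⟩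
      exact ⟨i, hi, h1, h3, h2.trans h4.symm⟩
  rw [this]
  exact MeasurableSet.biUnion (to_countable _) fun i _ => MeasurableSet.iUnion fun k =>
    (M.measurableSet_front i k).prod (M.measurableSet_front i k)

/-- The measure of the pairs of waves of two upward fronts that have not met yet. -/
theorem interaction_pairs {j i : ℕ} (hi : i + 1 < M.num j) (h1 : M.state j i < M.state j (i + 1))
    (h2 : M.state j (i + 1) < M.state j (i + 2)) {F₁ F₂ : Set ℝ} (hF₁ : F₁ ⊆ M.waves j i)
    (hF₂ : F₂ ⊆ M.waves j (i + 1))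
    (hv₁ : ENNReal.ofReal (M.state j (i + 1) - M.state j i) ≤ volume F₁)
    (hv₂ : ENNReal.ofReal (M.state j (i + 2) - M.state j (i + 1)) ≤ volume F₂) :
    ENNReal.ofReal ((M.flux (M.state j (i + 1)) - M.flux (M.state j i)) *
        (M.state j (i + 2) - M.state j (i + 1)) -
      (M.flux (M.state j (i + 2)) - M.flux (M.state j (i + 1))) *
        (M.state j (i + 1) - M.state j i)) ≤
    ENNReal.ofReal (M.K * (M.state j (i + 2) - M.state j i)) *
      volume (F₁ ×ˢ F₂ \ {w : ℝ × ℝ | M.met j w.1 w.2}) := by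
  have hi' : i < M.num j := by omega
  have hcont := M.contact j i hi h1 h2
  obtain ⟨m, N, hmN, hslope⟩ := M.slope_bounds _ (M.state_mem j i hi'.le) _
    (M.state_mem j (i + 2) hi) (h1.trans h2)
  set a := M.state j i
  set b := M.state j (i + 1)
  set c := M.state j (i + 2)
  set P := {p ∈ M.waves j i | ∃ q ∈ M.waves j (i + 1), M.met j p q} with hP
  set Q := {q ∈ M.waves j (i + 1) | ∃ p ∈ M.waves j i, M.met j p q} with hQ
  have hPsub : P ⊆ M.waves j i := fun _ h => h.1
  have hQsub : Q ⊆ M.waves j (i + 1) := fun _ h => h.1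
  obtain ⟨α, γ, haα, hαb, hbγ, hγc, hPα, hQγ, hαγ⟩ : ∃ α γ, a ≤ α ∧ α ≤ b ∧ b ≤ γ ∧ γ ≤ c ∧
      (∀ p ∈ P, α ≤ M.value p) ∧ (∀ q ∈ Q, M.value q ≤ γ) ∧
      (M.flux b - M.flux α) * (γ - b) ≤ (M.flux γ - M.flux b) * (b - α) := by
    -- If nothing has met across b, the free rectangle is degenerate and all pairs are charged.
    rcases P.eq_empty_or_nonempty with hPe | hPne
    · refine ⟨b, b, h1.le, le_rfl, le_rfl, h2.le, by simp [hPe], fun q hq => ?_, by simp⟩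
      obtain ⟨hq1, p, hp, hpq⟩ := hq
      have : p ∈ P := ⟨hp, q, hq1, hpq⟩
      simp [hPe] at this
    · have hQne : Q.Nonempty := by
        obtain ⟨p, hp, q, hq, hpq⟩ := hPne
        exact ⟨q, hq, p, hp, hpq⟩
      have hPm : ∀ p ∈ P, M.value p ∈ Icc a b := fun p hp => value_mem_Icc hp.1 h1
      have hQm : ∀ q ∈ Q, M.value q ∈ Icc b c := fun q hq => value_mem_Icc hq.1 h2
      have hPb : BddBelow (M.value '' P) := ⟨a, by rintro _ ⟨p, hp, rfl⟩; exact (hPm p hp).1⟩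
      have hQb : BddAbove (M.value '' Q) := ⟨c, by rintro _ ⟨q, hq, rfl⟩; exact (hQm q hq).2⟩
      have hPn := hPne.image M.value
      have hQn := hQne.image M.value
      have hα := csInf_mem_closure hPn hPb
      have hγ := csSup_mem_closure hQn hQb
      set α := sInf (M.value '' P)
      set γ := sSup (M.value '' Q)
      have hαm : α ∈ Icc a b := closure_minimal
        (by rintro _ ⟨p, hp, rfl⟩; exact hPm p hp) isClosed_Icc hα
      have hγm : γ ∈ Icc b c := closure_minimal
        (by rintro _ ⟨q, hq, rfl⟩; exact hQm q hq) isClosed_Icc hγ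
      refine ⟨α, γ, hαm.1, hαm.2, hγm.1, hγm.2, fun p hp => csInf_le hPb (mem_image_of_mem _ hp),
        fun q hq => le_csSup hQb (mem_image_of_mem _ hq), ?_⟩
      -- The waves p and q need not have met each other: it suffices that each has met some wave
      -- across the boundary. Therefore contact holds on all of P × Q, and it passes to the extreme
      -- values α and γ by closure.
      have hpq : ∀ p ∈ P, ∀ q ∈ Q, (M.flux b - M.flux (M.value p)) * (M.value q - b) ≤
          (M.flux (M.value q) - M.flux b) * (b - M.value p) := fun p hp q hq => by
        obtain ⟨hp1, r, hr, hpr⟩ := hp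
        obtain ⟨hq1, r', hr', hrq⟩ := hq
        exact hcont p hp1.1 q hq1.1 hp1.2.le (by rw [hq1.2]; omega)
          ⟨r, hr.1, by rw [hr.2]; omega, hpr⟩ ⟨r', hr'.1, hr'.2.le, hrq⟩
      have hp : ∀ p ∈ P, (M.flux b - M.flux (M.value p)) * (γ - b) ≤
          (M.flux γ - M.flux b) * (b - M.value p) := fun p hp => by
        have := closure_value_le (M := M) (α := b - M.value p) (β := -(M.flux b - M.flux (M.value p)))
          (γ := (M.flux b - M.flux (M.value p)) * b - M.flux b * (b - M.value p)) hi h2 hQsub hγ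
          (fun q hq => by have := hpq p hp q hq; linarith)
        linarith
      have := closure_value_le (M := M) (α := γ - b) (β := -(M.flux γ - M.flux b))
        (γ := (M.flux γ - M.flux b) * b - M.flux b * (γ - b)) hi' h1 hPsub hα
        (fun p hpP => by have := hp p hpP; linarith)
      linarith
  have halg := interaction_algebra haα hαb hbγ hγc hmN hslope hαγ
  refine (ENNReal.ofReal_le_ofReal halg).trans ?_
  rw [ENNReal.ofReal_mul (mul_nonneg M.K_nonneg (by linarith))]
  refine mul_le_mul_right ?_ _
  have hvP : volume P ≤ ENNReal.ofReal (b - α) :=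
    (measure_mono (show P ⊆ {s ∈ M.waves j i | α ≤ M.value s} from
      fun p hp => ⟨hp.1, hPα p hp⟩)).trans (volume_le_value hi' h1 α)
  have hvQ : volume Q ≤ ENNReal.ofReal (γ - b) :=
    (measure_mono (show Q ⊆ {s ∈ M.waves j (i + 1) | M.value s ≤ γ} from
      fun q hq => ⟨hq.1, hQγ q hq⟩)).trans (volume_value_le h2 γ)
  -- Pairs that have met lie in P × Q, whose measure is at most (b - α)(γ - b).
  have hcover : F₁ ×ˢ F₂ ⊆ (F₁ ×ˢ F₂ \ {w : ℝ × ℝ | M.met j w.1 w.2}) ∪ P ×ˢ Q := fun w hw => by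
    by_cases h : M.met j w.1 w.2
    · exact Or.inr ⟨⟨hF₁ hw.1, w.2, hF₂ hw.2, h⟩, ⟨hF₂ hw.2, w.1, hF₁ hw.1, h⟩⟩
    · exact Or.inl ⟨hw, h⟩
  have hv := (measure_mono hcover).trans (measure_union_le (μ := volume) _ _)
  rw [Measure.volume_eq_prod, Measure.prod_prod, Measure.prod_prod] at hv
  rw [ENNReal.ofReal_sub _ (mul_nonneg (by linarith) (by linarith)), tsub_le_iff_right,
    ENNReal.ofReal_mul (by linarith), ENNReal.ofReal_mul (by linarith)]
  exact (mul_le_mul' hv₁ hv₂).trans (hv.trans (add_le_add le_rfl (mul_le_mul' hvP hvQ)))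

end FrontModel

/-! ### Change of speed at a collision -/

namespace FrontModel

variable {M : FrontModel}

/-- The fronts `i` and `i + 1`, and no others, collide at the end of stage `j`. -/
def Collision (M : FrontModel) (j i : ℕ) : Prop :=
  i + 1 < M.num j ∧ ∀ k < M.num j, M.endpoint j k = M.endpoint j i ↔ i ≤ k ∧ k ≤ i + 1

theorem Collision.endpoint_eq {j i : ℕ} (h : M.Collision j i) : M.endpoint j (i + 1) = M.endpoint j i :=
  (h.2 (i + 1) h.1).2 ⟨by omega, le_rfl⟩

/-- A front between the two, or any other front ending at this point, would form a second colliding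
pair, which `binary` excludes. -/
theorem collision_of_endpoint_eq {j i i' : ℕ} (hii : i < i') (hi' : i' < M.num j)
    (h : M.endpoint j i = M.endpoint j i') : M.Collision j i := by
  obtain rfl : i' = i + 1 := by
    by_contra hne
    have h1 := M.endpoint_mono j i (i + 1) (by omega) (by omega)
    have h2 := M.endpoint_mono j (i + 1) i' (by omega) hi'
    have := M.binary j i i' i (i + 1) hii hi' (by omega) (by omega) h (le_antisymm h1 (h ▸ h2))
    omega
  refine ⟨hi', fun k hk => ⟨fun hki => ?_, fun hki => ?_⟩⟩
  · by_contra hcon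
    rcases Nat.lt_or_ge k i with h1 | h1
    · have := M.binary j k i i (i + 1) h1 (by omega) hii hi' hki h
      omega
    · have := M.binary j i k i (i + 1) (by omega) hk hii hi' hki.symm h
      omega
  · rcases Nat.lt_or_ge i k with h1 | h1
    · rw [show k = i + 1 by omega, h]
    · rw [show k = i by omega]

theorem Collision.states {j i : ℕ} (h : M.Collision j i) :
    M.state (j + 1) (countLT (M.num (j + 1)) (M.start (j + 1)) (M.endpoint j i)) = M.state j i ∧
      M.state (j + 1) (countLE (M.num (j + 1)) (M.start (j + 1)) (M.endpoint j i)) = M.state j (i + 2) := by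
  obtain ⟨h1, h2⟩ := counts_of_level (M.endpoint_mono j) (x := M.endpoint j i) (i := i) (i' := i + 1)
    (by omega) h.1 h.2
  exact ⟨by rw [← M.state_left, h1], by rw [← M.state_right, h2]⟩

theorem Collision.jump_eq_zero {j i : ℕ} (h : M.Collision j i) {s : ℝ} (hs : s ∈ M.alive (j + 1))
    (h1 : M.front j s ≠ i) (h2 : M.front j s ≠ i + 1) : M.jump j s = 0 := by
  have hsj := M.front_lt j s (alive_le (Nat.le_succ j) hs)
  refine FrontModel.jump_eq_zero hs fun k hk hks => ?_
  by_contra hne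
  have : ∀ a b, a < b → b < M.num j → M.endpoint j a = M.endpoint j b → a = i ∧ b = i + 1 :=
    fun a b hab hb hst => M.binary j a b i (i + 1) hab hb (by omega) h.1 hst h.endpoint_eq.symm
  rcases Nat.lt_or_gt_of_ne hne with hlt | hlt
  · have := this _ _ hlt hsj hks; omega
  · have := this _ _ hlt hk hks.symm; omega

/-- The front of a surviving wave after a collision with increasing outer states. -/
theorem Collision.survivor {j i : ℕ} (h : M.Collision j i) (hur : M.state j i < M.state j (i + 2))
    {s : ℝ} (hs : s ∈ M.alive (j + 1)) (hsi : M.front j s = i ∨ M.front j s = i + 1) {k : ℕ}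
    (hk : k = M.front (j + 1) s) :
    k < M.num (j + 1) ∧ M.start (j + 1) k = M.endpoint j i ∧ M.state j i ≤ M.state (j + 1) k ∧
      M.state (j + 1) k < M.state (j + 1) (k + 1) ∧ M.state (j + 1) (k + 1) ≤ M.state j (i + 2) ∧
      M.sign s = 1 ∧ ∀ w ∈ Icc (M.state j i) (M.state j (i + 2)),
        M.flux (M.state (j + 1) k) + M.speed (j + 1) k * (w - M.state (j + 1) k) ≤ M.flux w := by
  have hk' : k < M.num (j + 1) := hk ▸ M.front_lt _ s hs
  have hst : M.start (j + 1) k = M.endpoint j i := by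
    rw [hk, M.start_eq_endpoint j s hs]
    rcases hsi with h1 | h1
    · rw [h1]
    · rw [h1, h.endpoint_eq]
  obtain ⟨e1, e2⟩ := h.states
  obtain ⟨h1, h2, h3, h4⟩ := M.fan_up (j + 1) k hk' (M.state j i) (M.state j (i + 2))
    (by rw [hst, e1]) (by rw [hst, e2]) hur
  exact ⟨hk', hst, h1, h2, h3, (sign_eq_one_iff hs).2 (by rw [← hk]; exact h2), h4⟩

/-- A surviving wave of the colliding fronts would be in a front that leaves a point with equal
states on both sides, against `fan_ne`. -/
theorem step_bound_of_collision_eq {j i : ℕ} (h : M.Collision j i)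
    (hur : M.state j i = M.state j (i + 2)) : ∀ s ∈ M.alive (j + 1), M.jump j s = 0 := by
  intro s hs
  by_cases h1 : M.front j s = i ∨ M.front j s = i + 1
  · exfalso
    have hst : M.start (j + 1) (M.front (j + 1) s) = M.endpoint j i := by
      rw [M.start_eq_endpoint j s hs]
      rcases h1 with h1 | h1
      · rw [h1]
      · rw [h1, h.endpoint_eq]
    have := M.fan_ne (j + 1) _ (M.front_lt _ s hs)
    rw [hst, h.states.1, h.states.2] at this
    exact this hur
  · push Not at h1
    exact h.jump_eq_zero hs h1.1 h1.2

theorem setLIntegral_le_of_jump_le {j : ℕ} {c : ℝ}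
    (hc : ∀ s ∈ M.alive (j + 1), M.jump j s ≤ ENNReal.ofReal (M.K * c))
    (hk : ENNReal.ofReal c ≤ volume (M.alive j \ M.alive (j + 1))) :
    ∫⁻ s in M.alive (j + 1), M.jump j s ≤ 2 * ENNReal.ofReal M.K * volume (M.newPairs j) +
      ENNReal.ofReal M.K * volume (M.alive 0) * volume (M.alive j \ M.alive (j + 1)) := by
  calc ∫⁻ s in M.alive (j + 1), M.jump j s
      ≤ ∫⁻ s in M.alive (j + 1), ENNReal.ofReal (M.K * c) :=
        setLIntegral_mono' (measurableSet_alive _) hc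
    _ = ENNReal.ofReal M.K * ENNReal.ofReal c * volume (M.alive (j + 1)) := by
        rw [setLIntegral_const, ENNReal.ofReal_mul M.K_nonneg]
    _ ≤ ENNReal.ofReal M.K * volume (M.alive j \ M.alive (j + 1)) * volume (M.alive 0) := by
        gcongr
        exact M.alive_anti (Nat.zero_le _)
    _ ≤ _ := le_trans (le_of_eq (by ring)) le_add_self

/-- Collisions of two upward fronts. -/
theorem step_bound_interaction {j i : ℕ} (h : M.Collision j i)
    (h1 : M.state j i < M.state j (i + 1)) (h2 : M.state j (i + 1) < M.state j (i + 2)) :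
    ∫⁻ s in M.alive (j + 1), M.jump j s ≤ 2 * ENNReal.ofReal M.K * volume (M.newPairs j) := by
  have hi : i + 1 < M.num j := h.1
  have hi' : i < M.num j := by omega
  have hur := h1.trans h2
  have hσ : M.speed j (i + 1) < M.speed j i :=
    M.speed_lt_of_endpoint j i (i + 1) (by omega) hi h.endpoint_eq.symm
  have e1 := M.speed_eq j i hi'
  have e2 : M.speed j (i + 1) * (M.state j (i + 2) - M.state j (i + 1)) =
    M.flux (M.state j (i + 2)) - M.flux (M.state j (i + 1)) := M.speed_eq j (i + 1) hi
  have c1 := fun w hw => chord_le (M := M) (j := j) (i := i) (w := w) hi' h1 hw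
  have c2 : ∀ w ∈ Icc (M.state j (i + 1)) (M.state j (i + 2)), M.flux (M.state j (i + 1)) +
    M.speed j (i + 1) * (w - M.state j (i + 1)) ≤ M.flux w := fun w hw => chord_le hi h2 hw
  have hpairs := fun F₁ F₂ => interaction_pairs (M := M) (F₁ := F₁) (F₂ := F₂) hi h1 h2
  have v1 := M.volume_front j i hi'
  have v2 : volume (M.waves j (i + 1)) =
    ENNReal.ofReal |M.state j (i + 2) - M.state j (i + 1)| := M.volume_front j (i + 1) hi
  rw [abs_of_pos (by linarith)] at v1 v2
  change volume (M.waves j i) = _ at v1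
  obtain ⟨s1, s2⟩ := h.states
  set x := M.endpoint j i with hx
  set a := M.state j i
  set b := M.state j (i + 1)
  set c := M.state j (i + 2)
  set σ₁ := M.speed j i
  set σ₂ := M.speed j (i + 1)
  set lo := countLT (M.num (j + 1)) (M.start (j + 1)) x with hlo
  set hi₀ := countLE (M.num (j + 1)) (M.start (j + 1)) x with hhi
  set σ := (M.flux c - M.flux a) / (c - a) with hσdef
  have hσmul : σ * (c - a) = M.flux c - M.flux a := by
    rw [hσdef, div_mul_cancel₀]; linarith
  have hσsum : σ * (c - a) = σ₁ * (b - a) + σ₂ * (c - b) := by linarith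
  have hσ1 : σ ≤ σ₁ := le_of_mul_le_mul_right (a := c - a) (by nlinarith) (by linarith)
  have hσ2 : σ₂ ≤ σ := le_of_mul_le_mul_right (a := c - a) (by nlinarith) (by linarith)
  -- The new slope is a weighted mean of σ₁ ≥ σ₂. The long chord is therefore below the first chord,
  -- with which it shares the left end, and below the second one, with which it shares the right
  -- end.
  have hchord : ∀ w ∈ Icc a c, M.flux a + σ * (w - a) ≤ M.flux w := fun w hw => by
    rcases le_total w b with hwb | hwb
    · have := c1 w ⟨hw.1, hwb⟩
      nlinarith [mul_le_mul_of_nonneg_right hσ1 (sub_nonneg.2 hw.1)]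
    · have := c2 w ⟨hwb, hw.2⟩
      nlinarith [mul_le_mul_of_nonneg_right hσ2 (sub_nonneg.2 hw.2)]
  have hspeed : ∀ k < M.num (j + 1), M.start (j + 1) k = x → M.speed (j + 1) k = σ :=
    fun k hk hkx => speed_eq_of_chord hk hur (by rw [hkx, s1]) (by rw [hkx, s2]) hσmul hchord
  -- there is exactly one outgoing front
  have hlohi : lo < hi₀ := lt_of_le_of_ne (countLT_le_countLE _ _ _) fun he => by
    rw [he, s2] at s1; linarith
  have hlon : lo < M.num (j + 1) := hlohi.trans_le (countLE_le _ _ _)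
  have hstart : ∀ k, lo ≤ k → k < hi₀ → M.start (j + 1) k = x := fun k hk1 hk2 => by
    have := (lt_countLE_iff (M.start_mono (j + 1))).1 hk2
    exact le_antisymm this.2 ((countLT_le_iff (M.start_mono (j + 1)) this.1).1 hk1)
  have hhi1 : hi₀ = lo + 1 := by
    by_contra hne
    have hlt : lo + 1 < hi₀ := by omega
    have hn : lo + 1 < M.num (j + 1) := hlt.trans_le (countLE_le _ _ _)
    have x1 := hstart lo le_rfl hlohi
    have x2 := hstart (lo + 1) (by omega) hlt
    have := M.speed_lt (j + 1) lo (lo + 1) (by omega) hn (by rw [x1, x2])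
    rw [hspeed lo hlon x1, hspeed (lo + 1) hn x2] at this
    exact lt_irrefl _ this
  rw [hhi1] at s2
  have vlo := M.volume_front (j + 1) lo hlon
  rw [s1, s2, abs_of_pos (by linarith)] at vlo
  change volume (M.waves (j + 1) lo) = _ at vlo
  -- the waves of the outgoing front are those of the incoming ones
  set G := M.waves (j + 1) lo with hG
  have hGsub : G ⊆ (M.waves j i ∩ G) ∪ (M.waves j (i + 1) ∩ G) := fun s hs => by
    have hsj := alive_le (Nat.le_succ j) hs.1
    have := M.start_eq_endpoint j s hs.1
    rw [hs.2, hstart lo le_rfl hlohi] at this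
    have := (h.2 _ (M.front_lt j s hsj)).1 this.symm
    rcases this.1.eq_or_lt with h3 | h3
    · exact Or.inl ⟨⟨hsj, h3.symm⟩, hs⟩
    · exact Or.inr ⟨⟨hsj, by omega⟩, hs⟩
  -- The outgoing front needs waves of total measure c - a, which is all that the incoming ones
  -- have. So almost every incoming wave survives, and the surviving parts satisfy the measure
  -- hypotheses of `interaction_pairs`.
  have hvsum := (measure_mono hGsub).trans (measure_union_le (μ := volume) _ _)
  rw [vlo, show c - a = (b - a) + (c - b) by ring,
    ENNReal.ofReal_add (by linarith) (by linarith)] at hvsum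
  have hle1 : volume (M.waves j i ∩ G) ≤ ENNReal.ofReal (b - a) := v1 ▸ measure_mono inter_subset_left
  have hle2 : volume (M.waves j (i + 1) ∩ G) ≤ ENNReal.ofReal (c - b) :=
    v2 ▸ measure_mono inter_subset_left
  have hv1 : ENNReal.ofReal (b - a) ≤ volume (M.waves j i ∩ G) := by
    have := hvsum.trans (add_le_add le_rfl hle2)
    exact (ENNReal.add_le_add_iff_right ENNReal.ofReal_ne_top).1 this
  have hv2 : ENNReal.ofReal (c - b) ≤ volume (M.waves j (i + 1) ∩ G) := by
    have := hvsum.trans (add_le_add hle1 le_rfl)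
    exact (ENNReal.add_le_add_iff_left ENNReal.ofReal_ne_top).1 this
  have key := hpairs _ _ inter_subset_left inter_subset_left hv1 hv2
  have hnew : (M.waves j i ∩ G) ×ˢ (M.waves j (i + 1) ∩ G) \ {w : ℝ × ℝ | M.met j w.1 w.2} ⊆
      M.newPairs j := fun w hw =>
    ⟨⟨j + 1, le_rfl, hw.1.1.2.1, hw.1.2.2.1, hw.1.1.2.2.trans hw.1.2.2.2.symm⟩, hw.2⟩
  have key' := key.trans (mul_le_mul_right (measure_mono hnew) _)
  -- the integral of the jumps
  have hjump : ∀ s ∈ M.alive (j + 1), M.jump j s ≤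
      (M.waves j i).indicator (fun _ => ENNReal.ofReal (σ₁ - σ)) s +
        (M.waves j (i + 1)).indicator (fun _ => ENNReal.ofReal (σ - σ₂)) s := fun s hs => by
    have hsj := alive_le (Nat.le_succ j) hs
    have hst := M.start_eq_endpoint j s hs
    by_cases hs1 : M.front j s = i
    · rw [indicator_of_mem (show s ∈ M.waves j i from ⟨hsj, hs1⟩), jump, hs1,
        hspeed _ (M.front_lt _ s hs) (by rw [hst, hs1]), edist_dist, Real.dist_eq,
        abs_of_nonneg (by linarith)]
      exact le_self_add
    · by_cases hs2 : M.front j s = i + 1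
      · rw [indicator_of_mem (show s ∈ M.waves j (i + 1) from ⟨hsj, hs2⟩), jump, hs2,
          hspeed _ (M.front_lt _ s hs) (by rw [hst, hs2, h.endpoint_eq]), edist_dist, Real.dist_eq,
          abs_sub_comm, abs_of_nonneg (by linarith)]
        exact le_add_self
      · rw [h.jump_eq_zero hs hs1 hs2]; exact zero_le
  have hint : ∫⁻ s in M.alive (j + 1), M.jump j s ≤
      ENNReal.ofReal ((σ₁ - σ) * (b - a) + (σ - σ₂) * (c - b)) := by
    refine (setLIntegral_mono' (measurableSet_alive _) hjump).trans ?_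
    refine (setLIntegral_le_lintegral _ _).trans ?_
    have hm : ∀ k, MeasurableSet (M.waves j k) := M.measurableSet_front j
    rw [lintegral_add_left (measurable_const.indicator (hm i)), lintegral_indicator_const (hm i),
      lintegral_indicator_const (hm (i + 1)), v1, v2,
      ENNReal.ofReal_add (mul_nonneg (by linarith) (by linarith))
        (mul_nonneg (by linarith) (by linarith)), ENNReal.ofReal_mul (by linarith),
      ENNReal.ofReal_mul (by linarith)]
  refine hint.trans ?_
  set D := (M.flux b - M.flux a) * (c - b) - (M.flux c - M.flux b) * (b - a) with hD
  have hDeq : D = (b - a) * (c - b) * (σ₁ - σ₂) := by rw [hD, ← e1, ← e2]; ring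
  -- The weighted mean makes the loss of the left front equal to the gain of the right one, each
  -- D/(c - a).
  have hsum : ((σ₁ - σ) * (b - a) + (σ - σ₂) * (c - b)) = 2 * D / (c - a) := by
    rw [eq_div_iff (by linarith)]
    have : ((σ₁ - σ) * (b - a) + (σ - σ₂) * (c - b)) * (c - a) =
      (σ₁ * (c - a) - σ * (c - a)) * (b - a) + (σ * (c - a) - σ₂ * (c - a)) * (c - b) := by ring
    rw [this, hσsum, hDeq]; ring
  rw [hsum]
  -- No finiteness of this measure is at hand. In the infinite case with K = 0 the right side is 0 ·
  -- ⊤ = 0, and D ≤ 0 is read off from `key'` instead.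
  rcases eq_top_or_lt_top (volume (M.newPairs j)) with htop | hlt
  · rcases eq_or_lt_of_le M.K_nonneg with hK | hK
    · rw [← hK] at key'
      simp only [zero_mul, ENNReal.ofReal_zero, nonpos_iff_eq_zero, ENNReal.ofReal_eq_zero] at key'
      have : 2 * D / (c - a) ≤ 0 := div_nonpos_of_nonpos_of_nonneg (by linarith) (by linarith)
      rw [ENNReal.ofReal_of_nonpos this]
      exact zero_le
    · rw [htop, ENNReal.mul_top (by simpa using hK)]
      exact le_top
  · rw [← ENNReal.ofReal_toReal hlt.ne] at key' ⊢
    set N := (volume (M.newPairs j)).toReal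
    have hN : 0 ≤ N := ENNReal.toReal_nonneg
    rw [← ENNReal.ofReal_mul (mul_nonneg M.K_nonneg (by linarith)),
      ENNReal.ofReal_le_ofReal_iff (mul_nonneg (mul_nonneg M.K_nonneg (by linarith)) hN)] at key'
    rw [show (2 : ENNReal) = ENNReal.ofReal 2 by simp, ← ENNReal.ofReal_mul (by norm_num),
      ← ENNReal.ofReal_mul (mul_nonneg (by norm_num) M.K_nonneg)]
    refine ENNReal.ofReal_le_ofReal ?_
    rw [div_le_iff₀ (by linarith)]
    linarith

/-- Cancellation of the right part of an upward front. -/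
theorem step_bound_cancel_right {j i : ℕ} (h : M.Collision j i)
    (h1 : M.state j i < M.state j (i + 1)) (h2 : M.state j (i + 2) < M.state j (i + 1))
    (hur : M.state j i < M.state j (i + 2)) :
    (∀ s ∈ M.alive (j + 1), M.jump j s ≤
      ENNReal.ofReal (M.K * (M.state j (i + 1) - M.state j (i + 2)))) ∧
    ENNReal.ofReal (M.state j (i + 1) - M.state j (i + 2)) ≤
      volume (M.alive j \ M.alive (j + 1)) := by
  have hi : i + 1 < M.num j := h.1
  have hi' : i < M.num j := by omega
  constructor
  · intro s hs
    have hsj := alive_le (Nat.le_succ j) hs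
    by_cases hsi : M.front j s = i ∨ M.front j s = i + 1
    swap
    · push Not at hsi
      rw [h.jump_eq_zero hs hsi.1 hsi.2]; exact zero_le
    obtain ⟨hk, hst, k1, k2, k3, hsgn, hsup⟩ := h.survivor hur hs hsi rfl
    have hsi' : M.front j s = i := by
      rcases hsi with h3 | h3
      · exact h3
      · have := (sign_eq_one_iff hsj).1 hsgn
        rw [h3] at this
        linarith
    have hRH := M.speed_eq (j + 1) _ hk
    have e1 := M.speed_eq j i hi'
    rw [jump, hsi', edist_dist, Real.dist_eq]
    refine ENNReal.ofReal_le_ofReal ?_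
    have hc1 := fun w hw => chord_le (M := M) (j := j) (i := i) (w := w) hi' h1 hw
    set k := M.front (j + 1) s
    set v := M.state (j + 1) k with hv
    set v' := M.state (j + 1) (k + 1)
    set a := M.state j i with ha
    set m := M.state j (i + 1) with hm
    set r := M.state j (i + 2) with hr
    set c := M.speed (j + 1) k
    set σ := M.speed j i
    have hsd := M.second_difference v (M.state_mem (j + 1) k hk.le) r (M.state_mem j (i + 2) hi) m
      (M.state_mem j (i + 1) hi.le) (by linarith) h2.le
    have hlow : σ ≤ c := by
      have f1 := hsup a ⟨le_rfl, hur.le⟩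
      have f2 := hc1 v' ⟨by linarith, by linarith⟩
      exact le_of_mul_le_mul_right (a := v' - a) (by linarith) (by linarith)
    -- Shift [v, r] to the right by the cancelled amount, so that it ends at m. Over the shifted
    -- interval the flux has slope at most σ, as the old chord touches it at m and lies below it.
    -- The shift costs a second difference.
    have hupp : c ≤ σ + M.K * (m - r) := by
      have f1 := hsup r ⟨hur.le, le_rfl⟩
      have f2 := hc1 (v + m - r) ⟨by linarith, by linarith⟩
      have f3 := (abs_le.1 hsd).1
      exact le_of_mul_le_mul_right (a := r - v) (by linarith) (by linarith)
    rw [abs_sub_comm, abs_of_nonneg (by linarith)]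
    linarith
  · have hsub : M.waves j i ⊆ {s ∈ M.waves j i | M.value s ≤ M.state j (i + 2)} ∪
        (M.alive j \ M.alive (j + 1)) := fun s hs => by
      by_cases hs' : s ∈ M.alive (j + 1)
      · obtain ⟨hk, hst, k1, k2, k3, hsgn, hsup⟩ := h.survivor hur hs' (Or.inl hs.2) rfl
        exact Or.inl ⟨hs, (value_mem hs' hsgn).2.trans k3⟩
      · exact Or.inr ⟨hs.1, hs'⟩
    have hv := (measure_mono hsub).trans (measure_union_le (μ := volume) _ _)
    rw [waves, M.volume_front j i hi', abs_of_pos (by linarith)] at hv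
    have hv2 := hv.trans (add_le_add (volume_value_le h1 _) le_rfl)
    rw [show M.state j (i + 1) - M.state j i = (M.state j (i + 2) - M.state j i) +
      (M.state j (i + 1) - M.state j (i + 2)) by ring, ENNReal.ofReal_add (by linarith)
      (by linarith)] at hv2
    exact (ENNReal.add_le_add_iff_left ENNReal.ofReal_ne_top).1 hv2

/-- Cancellation of the left part of an upward front. -/
theorem step_bound_cancel_left {j i : ℕ} (h : M.Collision j i)
    (h1 : M.state j (i + 1) < M.state j i) (h2 : M.state j (i + 1) < M.state j (i + 2))
    (hur : M.state j i < M.state j (i + 2)) :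
    (∀ s ∈ M.alive (j + 1), M.jump j s ≤
      ENNReal.ofReal (M.K * (M.state j i - M.state j (i + 1)))) ∧
    ENNReal.ofReal (M.state j i - M.state j (i + 1)) ≤ volume (M.alive j \ M.alive (j + 1)) := by
  have hi : i + 1 < M.num j := h.1
  have hi' : i < M.num j := by omega
  constructor
  · intro s hs
    have hsj := alive_le (Nat.le_succ j) hs
    by_cases hsi : M.front j s = i ∨ M.front j s = i + 1
    swap
    · push Not at hsi
      rw [h.jump_eq_zero hs hsi.1 hsi.2]; exact zero_le
    obtain ⟨hk, hst, k1, k2, k3, hsgn, hsup⟩ := h.survivor hur hs hsi rfl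
    have hsi' : M.front j s = i + 1 := by
      rcases hsi with h3 | h3
      · have := (sign_eq_one_iff hsj).1 hsgn
        rw [h3] at this
        linarith
      · exact h3
    have hRH := M.speed_eq (j + 1) _ hk
    have e1 := M.speed_eq j (i + 1) hi
    rw [show i + 1 + 1 = i + 2 from rfl] at e1
    rw [jump, hsi', edist_dist, Real.dist_eq]
    refine ENNReal.ofReal_le_ofReal ?_
    have hc1 : ∀ w ∈ Icc (M.state j (i + 1)) (M.state j (i + 2)), M.flux (M.state j (i + 1)) +
      M.speed j (i + 1) * (w - M.state j (i + 1)) ≤ M.flux w := fun w hw => chord_le hi h2 hw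
    set k := M.front (j + 1) s
    set v := M.state (j + 1) k with hv
    set v' := M.state (j + 1) (k + 1)
    set l := M.state j i with hl
    set a := M.state j (i + 1) with ha
    set r := M.state j (i + 2) with hr
    set c := M.speed (j + 1) k
    set σ := M.speed j (i + 1)
    have hsd := M.second_difference a (M.state_mem j (i + 1) hi.le) l (M.state_mem j i hi'.le) v'
      (M.state_mem (j + 1) (k + 1) hk) h1.le (by linarith)
    have hupp : c ≤ σ := by
      have f1 := hsup r ⟨hur.le, le_rfl⟩
      have f2 := hc1 v ⟨by linarith, by linarith⟩
      exact le_of_mul_le_mul_right (a := r - v) (by linarith) (by linarith)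
    -- Now [l, v'] is shifted to the left so that it begins at a.
    have hlow : σ - M.K * (l - a) ≤ c := by
      have f1 := hsup l ⟨le_rfl, hur.le⟩
      have f2 := hc1 (a + v' - l) ⟨by linarith, by linarith⟩
      have f3 := (abs_le.1 hsd).1
      exact le_of_mul_le_mul_right (a := v' - l) (by linarith) (by linarith)
    rw [abs_of_nonneg (by linarith)]
    linarith
  · have hsub : M.waves j (i + 1) ⊆ {s ∈ M.waves j (i + 1) | M.state j i ≤ M.value s} ∪
        (M.alive j \ M.alive (j + 1)) := fun s hs => by
      by_cases hs' : s ∈ M.alive (j + 1)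
      · obtain ⟨hk, hst, k1, k2, k3, hsgn, hsup⟩ := h.survivor hur hs' (Or.inr hs.2) rfl
        exact Or.inl ⟨hs, k1.trans (value_mem hs' hsgn).1⟩
      · exact Or.inr ⟨hs.1, hs'⟩
    have hv := (measure_mono hsub).trans (measure_union_le (μ := volume) _ _)
    have v2 : volume (M.waves j (i + 1)) =
      ENNReal.ofReal |M.state j (i + 2) - M.state j (i + 1)| := M.volume_front j (i + 1) hi
    rw [v2, abs_of_pos (by linarith)] at hv
    have hv2 := hv.trans (add_le_add (volume_le_value hi h2 _) le_rfl)
    rw [show i + 1 + 1 = i + 2 from rfl, show M.state j (i + 2) - M.state j (i + 1) =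
      (M.state j (i + 2) - M.state j i) + (M.state j i - M.state j (i + 1)) by ring,
      ENNReal.ofReal_add (by linarith) (by linarith)] at hv2
    exact (ENNReal.add_le_add_iff_left ENNReal.ofReal_ne_top).1 hv2

theorem step_bound_up {j i : ℕ} (h : M.Collision j i) (hur : M.state j i < M.state j (i + 2)) :
    ∫⁻ s in M.alive (j + 1), M.jump j s ≤ 2 * ENNReal.ofReal M.K * volume (M.newPairs j) +
      ENNReal.ofReal M.K * volume (M.alive 0) * volume (M.alive j \ M.alive (j + 1)) := by
  have hi : i + 1 < M.num j := h.1
  rcases lt_or_gt_of_ne (M.state_ne j i (by omega)) with h1 | h1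
  · rcases lt_or_gt_of_ne (M.state_ne j (i + 1) hi) with h2 | h2
    · exact (step_bound_interaction h h1 h2).trans le_self_add
    · obtain ⟨h3, h4⟩ := step_bound_cancel_right h h1 h2 hur
      exact setLIntegral_le_of_jump_le h3 h4
  · obtain ⟨h3, h4⟩ := step_bound_cancel_left h h1 (h1.trans hur) hur
    exact setLIntegral_le_of_jump_le h3 h4

/-- Reflection changes neither the speeds nor which waves have met or are alive, so decreasing outer
states reduce to increasing ones. -/
theorem step_bound (M : FrontModel) (j : ℕ) :
    ∫⁻ s in M.alive (j + 1), M.jump j s ≤ 2 * ENNReal.ofReal M.K * volume (M.newPairs j) +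
      ENNReal.ofReal M.K * volume (M.alive 0) * volume (M.alive j \ M.alive (j + 1)) := by
  have hzero : (∀ s ∈ M.alive (j + 1), M.jump j s = 0) →
      ∫⁻ s in M.alive (j + 1), M.jump j s ≤ 2 * ENNReal.ofReal M.K * volume (M.newPairs j) +
      ENNReal.ofReal M.K * volume (M.alive 0) * volume (M.alive j \ M.alive (j + 1)) := fun h => by
    rw [setLIntegral_congr_fun (measurableSet_alive _) h]
    simp
  by_cases hcol : ∃ i, M.Collision j i
  · obtain ⟨i, h⟩ := hcol
    rcases lt_trichotomy (M.state j i) (M.state j (i + 2)) with hur | hur | hur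
    · exact step_bound_up h hur
    · exact hzero (step_bound_of_collision_eq h hur)
    · exact step_bound_up (M := M.neg) h (neg_lt_neg hur)
  · refine hzero fun s hs => jump_eq_zero hs fun k hk hks => ?_
    have hsj := M.front_lt j s (alive_le (Nat.le_succ j) hs)
    by_contra hne
    rcases Nat.lt_or_gt_of_ne hne with hlt | hlt
    · exact hcol ⟨_, collision_of_endpoint_eq hlt hsj hks⟩
    · exact hcol ⟨_, collision_of_endpoint_eq hlt hk hks.symm⟩

/-! ### Summation over the stages -/

theorem tsum_volume_new {α : Type*} [MeasurableSpace α] {μ : Measure α} {A : ℕ → Set α}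
    (hA : Monotone A) (hm : ∀ j, MeasurableSet (A j)) {B : Set α} (hB : ∀ j, A j ⊆ B) :
    ∑' j, μ (A (j + 1) \ A j) ≤ μ B := by
  rw [← measure_iUnion]
  · exact measure_mono (iUnion_subset fun j => sdiff_subset.trans (hB _))
  · have key : ∀ i j, i < j → Disjoint (A (i + 1) \ A i) (A (j + 1) \ A j) := fun i j hij =>
      Set.disjoint_left.2 fun x hx hx' => hx'.2 (hA (by omega : i + 1 ≤ j) hx.1)
    intro i j hij
    rcases Nat.lt_or_gt_of_ne hij with h | h
    · exact key i j h
    · exact (key j i h).symm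
  · exact fun j => (hm _).diff (hm _)

/-- A pair of waves is new in one stage only and a wave disappears once. This gives the quadratic
budget twice for the interactions and once for the cancellations. -/
theorem total_variation_bound (M : FrontModel) :
    ∑' j, ∫⁻ s in M.alive (j + 1), M.jump j s ≤
      3 * ENNReal.ofReal M.K * volume (M.alive 0) ^ 2 := by
  have h1 : ∑' j, volume (M.newPairs j) ≤ volume (M.alive 0) ^ 2 := by
    have := tsum_volume_new (μ := (volume : Measure (ℝ × ℝ)))
      (A := fun j => {w : ℝ × ℝ | M.met j w.1 w.2})
      (monotone_nat_of_le_succ fun j w hw => met_mono hw) measurableSet_met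
      (B := M.alive 0 ×ˢ M.alive 0) (fun j w hw => by
        obtain ⟨i, -, hp, hq, -⟩ := hw
        exact ⟨alive_le (Nat.zero_le _) hp, alive_le (Nat.zero_le _) hq⟩)
    rw [Measure.volume_eq_prod, Measure.prod_prod, ← pow_two] at this
    exact this
  have h2 : ∑' j, volume (M.alive j \ M.alive (j + 1)) ≤ volume (M.alive 0) := by
    have := tsum_volume_new (μ := (volume : Measure ℝ)) (A := fun j => M.alive 0 \ M.alive j)
      (fun i j hij => sdiff_subset_sdiff_right (M.alive_anti hij))
      (fun j => (measurableSet_alive _).diff (measurableSet_alive _))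
      (B := M.alive 0) (fun j => sdiff_subset)
    refine le_trans (ENNReal.tsum_le_tsum fun j => measure_mono fun s hs => ?_) this
    exact ⟨⟨alive_le (Nat.zero_le _) hs.1, hs.2⟩, fun h => h.2 hs.1⟩
  calc ∑' j, ∫⁻ s in M.alive (j + 1), M.jump j s
      ≤ ∑' j, (2 * ENNReal.ofReal M.K * volume (M.newPairs j) +
        ENNReal.ofReal M.K * volume (M.alive 0) * volume (M.alive j \ M.alive (j + 1))) :=
        ENNReal.tsum_le_tsum fun j => M.step_bound j
    _ = 2 * ENNReal.ofReal M.K * ∑' j, volume (M.newPairs j) +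
        ENNReal.ofReal M.K * volume (M.alive 0) * ∑' j, volume (M.alive j \ M.alive (j + 1)) := by
        rw [ENNReal.tsum_add, ENNReal.tsum_mul_left, ENNReal.tsum_mul_left]
    _ ≤ 2 * ENNReal.ofReal M.K * volume (M.alive 0) ^ 2 +
        ENNReal.ofReal M.K * volume (M.alive 0) * volume (M.alive 0) := by gcongr
    _ = 3 * ENNReal.ofReal M.K * volume (M.alive 0) ^ 2 := by ring

end FrontModel

/-! ### Step functions -/

section Step

variable {u : ℝ → ℝ} {n : ℕ} {z v : ℕ → ℝ}

theorem eventually_countLE_eq_countLT (n : ℕ) (z : ℕ → ℝ) (x : ℝ) :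
    ∀ᶠ x' in 𝓝[<] x, countLE n z x' = countLT n z x := by
  have h : ∀ i ∈ Finset.range n, ∀ᶠ x' in 𝓝[<] x, (z i ≤ x' ↔ z i < x) := fun i _ => by
    rcases lt_or_ge (z i) x with h | h
    · filter_upwards [Ioo_mem_nhdsLT h] with x' hx'
      exact ⟨fun _ => h, fun _ => hx'.1.le⟩
    · filter_upwards [self_mem_nhdsWithin] with x' hx'
      exact ⟨fun h' => h'.trans_lt hx', fun h' => absurd h' (not_lt.2 h)⟩
  filter_upwards [(Finset.eventually_all _).2 h] with x' hx'
  unfold countLE countLT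
  rw [Finset.filter_congr hx']

theorem leftLim_step (hu : ∀ x, u x = v (countLE n z x)) (x : ℝ) :
    Function.leftLim u x = v (countLT n z x) := by
  refine leftLim_eq_of_tendsto (tendsto_const_nhds.congr' ?_)
  filter_upwards [eventually_countLE_eq_countLT n z x] with x' hx'
  rw [hu, hx']

theorem exists_eq_countLT (n : ℕ) (z : ℕ → ℝ) (x : ℝ) : ∃ x', countLE n z x' = countLT n z x :=
  (eventually_countLE_eq_countLT n z x).exists

theorem countLE_of_strictMono (hz : ∀ i k, i < k → k < n → z i < z k) {k : ℕ} (hk : k < n) :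
    countLE n z (z k) = k + 1 ∧ countLT n z (z k) = k := by
  have hz' : ∀ i k, i ≤ k → k < n → z i ≤ z k := fun i k h hk =>
    h.lt_or_eq.elim (fun h => (hz i k h hk).le) (fun h => h ▸ le_rfl)
  refine ⟨countLE_self hz hk, ?_⟩
  exact (counts_of_level hz' le_rfl hk fun i hi => ⟨fun h => by
    rcases lt_trichotomy i k with h1 | h1 | h1
    · exact absurd h (hz _ _ h1 hk).ne
    · omega
    · exact absurd h (hz _ _ h1 hi).ne', fun h => by rw [show i = k by omega]⟩).1

/-- The step function is the sequence `v` composed with the monotone counting function. As the jumps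
are at distinct points, the counting function takes every value up to its last one, so no state is
skipped. -/
theorem eVariationOn_step_Iic (hu : ∀ x, u x = v (countLE n z x))
    (hz : ∀ i k, i < k → k < n → z i < z k) (x : ℝ) :
    eVariationOn u (Iic x) = ∑ i ∈ Finset.range (countLE n z x), edist (v i) (v (i + 1)) := by
  have hz' : ∀ i k, i ≤ k → k < n → z i ≤ z k := fun i k h hk =>
    h.lt_or_eq.elim (fun h => (hz i k h hk).le) (fun h => h ▸ le_rfl)
  have h1 : u = v ∘ countLE n z := funext hu
  rw [h1, eVariationOn.comp_eq_of_monotoneOn _ _ ((countLE_mono n z).monotoneOn _),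
    ← eVariationOn_nat_Iic]
  congr 1
  ext m
  constructor
  · rintro ⟨x', hx', rfl⟩
    exact countLE_mono n z hx'
  · intro hm
    have hm : m ≤ countLE n z x := hm
    rcases Nat.eq_zero_or_pos m with rfl | hpos
    · rcases Nat.eq_zero_or_pos (countLE n z x) with h0 | h0
      · exact ⟨x, self_mem_Iic, h0⟩
      · have h00 := (lt_countLE_iff hz').1 h0
        refine ⟨z 0 - 1, (by simp only [mem_Iic]; linarith [h00.2]), ?_⟩
        exact Nat.le_zero.1 ((countLE_le_iff hz' h00.1).2 (by linarith))
    · have h0 := (lt_countLE_iff hz' (i := m - 1)).1 (by omega : m - 1 < countLE n z x)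
      exact ⟨z (m - 1), h0.2, by rw [(countLE_of_strictMono hz h0.1).1]; omega⟩

/-- Write `u` as a sum of jumps, each cut off at the last jump point R. The boundary terms at R
cancel because the jumps add up to `v n = 0`. -/
theorem integral_step_mul_deriv (hu : ∀ x, u x = v (countLE n z x))
    (hz : ∀ i k, i ≤ k → k < n → z i ≤ z k) (h0 : v 0 = 0) (hn : v n = 0) {φ : ℝ → ℝ}
    (hφ : ContDiff ℝ 1 φ) :
    -∫ x, u x * deriv φ x = ∑ i ∈ Finset.range n, (v (i + 1) - v i) * φ (z i) := by
  set R := z (n - 1)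
  have hR : ∀ i ∈ Finset.range n, z i ≤ R := fun i hi => by
    have := Finset.mem_range.1 hi
    exact hz _ _ (by omega) (by omega)
  have hsum : ∀ m, ∑ i ∈ Finset.range m, (v (i + 1) - v i) = v m := fun m => by
    rw [Finset.sum_range_sub, h0, sub_zero]
  have hpt : ∀ x, u x * deriv φ x = ∑ i ∈ Finset.range n,
      (v (i + 1) - v i) * (Icc (z i) R).indicator (deriv φ) x := fun x => by
    rcases le_or_gt x R with hx | hx
    · have h1 : u x = ∑ i ∈ Finset.range n, if z i ≤ x then v (i + 1) - v i else 0 := by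
        rw [hu, ← hsum, ← Finset.sum_filter]
        refine Finset.sum_congr ?_ fun _ _ => rfl
        ext i
        simp only [Finset.mem_range, Finset.mem_filter]
        exact lt_countLE_iff hz
      rw [h1, Finset.sum_mul]
      refine Finset.sum_congr rfl fun i _ => ?_
      by_cases h : z i ≤ x
      · rw [if_pos h, indicator_of_mem (show x ∈ Icc (z i) R from ⟨h, hx⟩)]
      · rw [if_neg h, indicator_of_notMem fun h' => h h'.1]; simp
    · have h1 : u x = 0 := by
        rw [hu, ← hn]
        congr 1
        apply le_antisymm (countLE_le _ _ _)
        rcases Nat.eq_zero_or_pos n with h | h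
        · omega
        · have := (lt_countLE_iff hz (x := x) (i := n - 1)).2 ⟨by omega, hx.le⟩
          omega
      rw [h1, zero_mul]
      refine (Finset.sum_eq_zero fun i _ => ?_).symm
      rw [indicator_of_notMem fun h' => not_lt.2 h'.2 hx, mul_zero]
  have hd : Continuous (deriv φ) := hφ.continuous_deriv le_rfl
  simp_rw [hpt]
  rw [integral_finsetSum _ fun i _ =>
    ((hd.continuousOn.integrableOn_Icc).integrable_indicator measurableSet_Icc).const_mul _,
    ← Finset.sum_neg_distrib]
  have hint : ∀ i ∈ Finset.range n, -∫ x, (v (i + 1) - v i) * (Icc (z i) R).indicator (deriv φ) x =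
      (v (i + 1) - v i) * φ (z i) - (v (i + 1) - v i) * φ R := fun i hi => by
    rw [integral_const_mul, integral_indicator measurableSet_Icc, integral_Icc_eq_integral_Ioc,
      ← intervalIntegral.integral_of_le (hR i hi), intervalIntegral.integral_deriv_eq_sub
        (fun x _ => (hφ.differentiable one_ne_zero) x) (hd.intervalIntegrable _ _)]
    ring
  rw [Finset.sum_congr rfl hint, Finset.sum_sub_distrib, ← Finset.sum_mul, hsum, hn, zero_mul,
    sub_zero]

end Step

/-! ### Waves at a fixed time -/

theorem edist_eq_ofReal_abs (a b : ℝ) : edist a b = ENNReal.ofReal |b - a| := by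
  rw [edist_dist, Real.dist_eq, abs_sub_comm]

/-- A finite measure on the line is determined by its values on left half-lines, and these are the
variations of `u`. -/
theorem waves_map_eq {A : Set ℝ} (hfin : volume A ≠ ⊤) {F u : ℝ → ℝ}
    {n : ℕ} {z v : ℕ → ℝ} (hu : ∀ x, u x = v (countLE n z x))
    (hz : ∀ i k, i < k → k < n → z i < z k)
    (hvar : ∀ x, Measure.map F (volume.restrict A) (Iic x) = eVariationOn u (Iic x)) :
    Measure.map F (volume.restrict A) =
      ∑ i ∈ Finset.range n, ENNReal.ofReal |v (i + 1) - v i| • Measure.dirac (z i) := by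
  have hz' : ∀ i k, i ≤ k → k < n → z i ≤ z k := fun i k h hk =>
    h.lt_or_eq.elim (fun h => (hz i k h hk).le) (fun h => h ▸ le_rfl)
  have : IsFiniteMeasure (volume.restrict A) := ⟨by simpa using hfin.lt_top⟩
  refine Measure.ext_of_Iic _ _ fun x => ?_
  rw [hvar, eVariationOn_step_Iic hu hz, Measure.finsetSum_apply]
  simp only [Measure.smul_apply, measurableSet_Iic, Measure.dirac_apply', smul_eq_mul]
  have : Finset.range (countLE n z x) = (Finset.range n).filter fun i => z i ≤ x := by
    ext i
    simp only [Finset.mem_range, Finset.mem_filter]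
    exact lt_countLE_iff hz'
  rw [this, Finset.sum_filter]
  refine Finset.sum_congr rfl fun i _ => ?_
  by_cases h : z i ≤ x
  · rw [if_pos h, indicator_of_mem (show z i ∈ Iic x from h), edist_eq_ofReal_abs]; simp
  · rw [if_neg h, indicator_of_notMem (show z i ∉ Iic x from h)]; simp

theorem volume_waves_at {A : Set ℝ} (hA : MeasurableSet A) (hfin : volume A ≠ ⊤) {F u : ℝ → ℝ}
    (hF : AEMeasurable F (volume.restrict A)) {n : ℕ} {z v : ℕ → ℝ}
    (hu : ∀ x, u x = v (countLE n z x)) (hz : ∀ i k, i < k → k < n → z i < z k)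
    (hvar : ∀ x, Measure.map F (volume.restrict A) (Iic x) = eVariationOn u (Iic x)) :
    (∀ i < n, volume {s ∈ A | F s = z i} = ENNReal.ofReal |v (i + 1) - v i|) ∧
      (∀ᵐ s ∂volume.restrict A, ∃ i < n, F s = z i) ∧
      volume A = ∑ i ∈ Finset.range n, ENNReal.ofReal |v (i + 1) - v i| := by
  have hmap := waves_map_eq hfin hu hz hvar
  have happly : ∀ s, MeasurableSet s → volume.restrict A (F ⁻¹' s) =
      ∑ i ∈ Finset.range n, ENNReal.ofReal |v (i + 1) - v i| * s.indicator 1 (z i) := fun s hs => by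
    rw [← Measure.map_apply_of_aemeasurable hF hs, hmap, Measure.finsetSum_apply]
    simp [hs]
  have hinj : ∀ i < n, ∀ k < n, z i = z k → i = k := fun i hi k hk h => by
    rcases lt_trichotomy i k with h1 | h1 | h1
    · exact absurd h (hz _ _ h1 hk).ne
    · exact h1
    · exact absurd h (hz _ _ h1 hi).ne'
  refine ⟨fun i hi => ?_, ?_, ?_⟩
  · have := happly {z i} (measurableSet_singleton _)
    rw [Measure.restrict_apply' hA, Finset.sum_eq_single i] at this
    · rw [indicator_of_mem (mem_singleton _)] at this
      simp only [Pi.one_apply, mul_one] at this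
      rw [← this]
      congr 1
      ext s
      exact ⟨fun h => ⟨h.2, h.1⟩, fun h => ⟨h.2, h.1⟩⟩
    · intro k hk hki
      rw [indicator_of_notMem (show z k ∉ ({z i} : Set ℝ) from
        fun h => hki (hinj _ (Finset.mem_range.1 hk) _ hi h)), mul_zero]
    · intro h
      exact absurd (Finset.mem_range.2 hi) h
  · have := happly (⋃ i ∈ Finset.range n, {z i})ᶜ
      (MeasurableSet.biUnion (Finset.countable_toSet _) fun i _ => measurableSet_singleton _).compl
    rw [Finset.sum_eq_zero] at this
    · rw [ae_iff]
      convert this using 2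
      ext s
      simp
    · intro i hi
      rw [indicator_of_notMem, mul_zero]
      simp only [mem_compl_iff, mem_iUnion, not_not]
      exact ⟨i, hi, rfl⟩
  · have := happly univ MeasurableSet.univ
    simpa using this

/-- Take a polynomial φ that equals the sign of the i-th jump at `z i`. Testing the derivative with
φ gives the total variation of `u`, that is, the measure of `A`, as the integral over `A` of φ(F) S.
The absolute value of this integrand is at most 1, so the integrand equals 1 almost everywhere. -/
theorem sign_waves_at {A : Set ℝ} (hA : MeasurableSet A) (hfin : volume A ≠ ⊤) {F u S : ℝ → ℝ}
    (hF : AEMeasurable F (volume.restrict A)) {n : ℕ} {z v : ℕ → ℝ}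
    (hu : ∀ x, u x = v (countLE n z x)) (hz : ∀ i k, i < k → k < n → z i < z k)
    (hvar : ∀ x, Measure.map F (volume.restrict A) (Iic x) = eVariationOn u (Iic x))
    (hv0 : v 0 = 0) (hvn : v n = 0) (hS : Measurable S) (hS1 : ∀ s ∈ A, S s = 1 ∨ S s = -1)
    (hder : ∀ φ : ℝ → ℝ, ContDiff ℝ 1 φ → -∫ x, u x * deriv φ x = ∫ s in A, φ (F s) * S s)
    (hne : ∀ i < n, v i ≠ v (i + 1)) :
    ∀ᵐ s ∂volume.restrict A, ∃ i < n, F s = z i ∧ S s = if v i < v (i + 1) then 1 else -1 := by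
  have hz' : ∀ i k, i ≤ k → k < n → z i ≤ z k := fun i k h hk =>
    h.lt_or_eq.elim (fun h => (hz i k h hk).le) (fun h => h ▸ le_rfl)
  obtain ⟨-, hpos, htot⟩ := volume_waves_at hA hfin hF hu hz hvar
  have : IsFiniteMeasure (volume.restrict A) := ⟨by simpa using hfin.lt_top⟩
  have hinj : Set.InjOn z (Finset.range n) := fun i hi k hk h => by
    have hi := Finset.mem_range.1 hi
    have hk := Finset.mem_range.1 hk
    rcases lt_trichotomy i k with h1 | h1 | h1
    · exact absurd h (hz _ _ h1 hk).ne
    · exact h1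
    · exact absurd h (hz _ _ h1 hi).ne'
  set ε : ℕ → ℝ := fun i => if v i < v (i + 1) then 1 else -1 with hε
  set P := Lagrange.interpolate (Finset.range n) z ε
  have hP : ∀ i < n, P.eval (z i) = ε i := fun i hi =>
    Lagrange.eval_interpolate_at_node _ hinj (Finset.mem_range.2 hi)
  have hPc : ContDiff ℝ 1 fun x => P.eval x := by simpa using P.contDiff_aeval (𝕜 := ℝ) 1
  have h1 := hder _ hPc
  rw [integral_step_mul_deriv hu hz' hv0 hvn hPc] at h1
  have h2 : ∑ i ∈ Finset.range n, (v (i + 1) - v i) * P.eval (z i) =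
      (volume.restrict A).real univ := by
    rw [Measure.real, Measure.restrict_apply_univ, htot, ENNReal.toReal_sum (by simp)]
    refine Finset.sum_congr rfl fun i hi => ?_
    have hi := Finset.mem_range.1 hi
    rw [hP i hi, ENNReal.toReal_ofReal (abs_nonneg _)]
    simp only [hε]
    rcases lt_or_gt_of_ne (hne i hi) with h | h
    · rw [if_pos h, abs_of_pos (by linarith), mul_one]
    · rw [if_neg (by linarith), abs_of_neg (by linarith)]; ring
  have hle : ∀ᵐ s ∂volume.restrict A, |P.eval (F s) * S s| ≤ 1 := by
    filter_upwards [hpos, ae_restrict_mem hA] with s ⟨i, hi, hs⟩ hsA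
    rw [hs, hP i hi, abs_mul]
    have e1 : |ε i| = 1 := by simp only [hε]; split_ifs <;> simp
    have e2 : |S s| = 1 := by rcases hS1 s hsA with h | h <;> simp [h]
    rw [e1, e2, one_mul]
  have hmeas : AEStronglyMeasurable (fun s => P.eval (F s) * S s) (volume.restrict A) :=
    ((P.continuous.measurable.comp_aemeasurable hF).mul hS.aemeasurable).aestronglyMeasurable
  have hint : Integrable (fun s => P.eval (F s) * S s) (volume.restrict A) :=
    Integrable.of_bound hmeas 1 (by simpa [Real.norm_eq_abs] using hle)
  have hzero : ∫ s in A, (1 - P.eval (F s) * S s) = 0 := by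
    rw [integral_sub (integrable_const _) hint, ← h1, h2]
    simp
  have hnn : 0 ≤ᵐ[volume.restrict A] fun s => 1 - P.eval (F s) * S s := by
    filter_upwards [hle] with s hs
    have := (abs_le.1 hs).2
    simp only [Pi.zero_apply]
    linarith
  have hae := (integral_eq_zero_iff_of_nonneg_ae hnn ((integrable_const _).sub hint)).1 hzero
  filter_upwards [hae, hpos, ae_restrict_mem hA] with s hs ⟨i, hi, hsi⟩ hsA
  refine ⟨i, hi, hsi, ?_⟩
  simp only [Pi.zero_apply] at hs
  rw [hsi, hP i hi] at hs
  change S s = ε i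
  have e1 : ε i = 1 ∨ ε i = -1 := by simp only [hε]; split_ifs <;> simp
  rcases e1 with h | h <;> rcases hS1 s hsA with h' | h' <;> rw [h, h'] at hs ⊢ <;> norm_num at hs

/-! ### Front patterns and fans -/

theorem piecewiseAffineFlux_lipschitz {f : ℝ → ℝ} (hf : ContDiff ℝ 2 f) (ν : ℕ) (a b : ℝ) :
    ∃ L, 0 ≤ L ∧ ∀ w ∈ Icc a b, ∀ w' ∈ Icc a b,
      |piecewiseAffineFlux f ν w - piecewiseAffineFlux f ν w'| ≤ L * |w - w'| := by
  have hN : (0 : ℝ) < 2 ^ ν := by positivity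
  set i : ℤ := ⌊2 ^ ν * a⌋
  -- The maximum keeps the interval between the nodes nondegenerate even if [a, b] is a point or
  -- empty.
  set k : ℤ := max (i + 1) ⌈2 ^ ν * b⌉
  have hi : (i : ℝ) / 2 ^ ν ≤ a := by
    rw [div_le_iff₀ hN, mul_comm]; exact Int.floor_le _
  have hk : b ≤ k / 2 ^ ν := by
    rw [le_div_iff₀ hN, mul_comm]
    exact (Int.le_ceil _).trans (Int.cast_le.2 (le_max_right _ _))
  have hik : (i : ℝ) / 2 ^ ν < k / 2 ^ ν := by
    rw [div_lt_div_iff_of_pos_right hN]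
    have : i < k := lt_of_lt_of_le (by omega) (le_max_left (i + 1) _)
    exact_mod_cast this
  obtain ⟨K, hK⟩ := isCompact_Icc.exists_bound_of_continuousOn
    (s := Icc ((i : ℝ) / 2 ^ ν) (k / 2 ^ ν)) (f := iteratedDeriv 2 f)
    (hf.continuous_iteratedDeriv 2 (by norm_num)).continuousOn
  obtain ⟨m, M, -, h⟩ := piecewiseAffineFlux_slope_bounds hf hik hK
  have key : ∀ p ∈ Icc a b, ∀ q ∈ Icc a b, p ≤ q →
      |piecewiseAffineFlux f ν q - piecewiseAffineFlux f ν p| ≤ max |m| |M| * (q - p) := by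
    intro p hp q hq hpq
    obtain ⟨h1, h2⟩ := h p q (hi.trans hp.1) hpq (hq.2.trans hk)
    have h3 : -max |m| |M| ≤ m := (neg_le_neg (le_max_left _ _)).trans (neg_abs_le m)
    have h4 : M ≤ max |m| |M| := (le_abs_self M).trans (le_max_right _ _)
    rw [abs_le]
    constructor <;> nlinarith [sub_nonneg.2 hpq]
  refine ⟨max |m| |M|, (abs_nonneg m).trans (le_max_left _ _), fun w hw w' hw' => ?_⟩
  rcases le_total w w' with h | h
  · rw [abs_sub_comm, abs_sub_comm w, abs_of_nonneg (sub_nonneg.2 h)]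
    exact key w hw w' hw' h
  · rw [abs_of_nonneg (sub_nonneg.2 h)]
    exact key w' hw' w hw h

/-- `IsFrontPattern` with the fronts numbered by natural numbers. -/
structure FrontPattern (u : ℝ → ℝ → ℝ) (t₀ t₁ : ℝ) (n : ℕ) (y c v : ℕ → ℝ) : Prop where
  lt : t₀ < t₁
  left_state : v 0 = 0
  right_state : v n = 0
  jump_ne : ∀ i < n, v i ≠ v (i + 1)
  ordered : ∀ t ∈ Ioo t₀ t₁, ∀ i k, i < k → k < n → y i + c i * (t - t₀) < y k + c k * (t - t₀)
  value : ∀ t ∈ Icc t₀ t₁, ∀ x, u t x = v (countLE n (fun i => y i + c i * (t - t₀)) x)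

theorem IsFrontPattern.exists_frontPattern {u : ℝ → ℝ → ℝ} {t₀ t₁ : ℝ} {n : ℕ} {y c : Fin n → ℝ}
    {v : ℕ → ℝ} (h : IsFrontPattern u t₀ t₁ n y c v) (hlt : t₀ < t₁) :
    ∃ y' c' : ℕ → ℝ, (∀ i : Fin n, y' i = y i ∧ c' i = c i) ∧ FrontPattern u t₀ t₁ n y' c' v := by
  set y' : ℕ → ℝ := fun i => if h : i < n then y ⟨i, h⟩ else 0 with hy'
  set c' : ℕ → ℝ := fun i => if h : i < n then c ⟨i, h⟩ else 0 with hc'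
  have hyc : ∀ i : Fin n, y' i = y i ∧ c' i = c i := fun i => by simp [hy', hc']
  refine ⟨y', c', hyc, hlt, h.left_state, h.right_state, h.jump_ne, ?_, ?_⟩
  · intro t ht i k hik hk
    have := h.ordered t ht (show (⟨i, hik.trans hk⟩ : Fin n) < ⟨k, hk⟩ from hik)
    simp only [← (hyc _).1, ← (hyc _).2] at this
    exact this
  · intro t ht x
    rw [h.value t ht]
    congr 1
    unfold countLE
    rw [Finset.card_filter, Finset.card_filter, ← Fin.sum_univ_eq_sum_range
      (fun i => if y' i + c' i * (t - t₀) ≤ x then 1 else 0)]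
    simp only [(hyc _).1, (hyc _).2]

namespace FrontPattern

variable {u : ℝ → ℝ → ℝ} {t₀ t₁ : ℝ} {n : ℕ} {y c v : ℕ → ℝ} (h : FrontPattern u t₀ t₁ n y c v)
include h

theorem start_mono {i k : ℕ} (hik : i ≤ k) (hk : k < n) : y i ≤ y k := by
  rcases hik.lt_or_eq with hik | rfl
  · have lim : ∀ i, Tendsto (fun t => y i + c i * (t - t₀)) (𝓝[>] t₀) (𝓝 (y i)) := fun i => by
      have : Continuous fun t => y i + c i * (t - t₀) := by fun_prop
      simpa using (this.tendsto t₀).mono_left nhdsWithin_le_nhds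
    refine le_of_tendsto_of_tendsto (lim i) (lim k) ?_
    filter_upwards [Ioo_mem_nhdsGT h.lt] with t ht
    exact (h.ordered t ht i k hik hk).le
  · exact le_rfl

theorem endpoint_mono {i k : ℕ} (hik : i ≤ k) (hk : k < n) :
    y i + c i * (t₁ - t₀) ≤ y k + c k * (t₁ - t₀) := by
  rcases hik.lt_or_eq with hik | rfl
  · have lim : ∀ i, Tendsto (fun t => y i + c i * (t - t₀)) (𝓝[<] t₁)
        (𝓝 (y i + c i * (t₁ - t₀))) := fun i => by
      have : Continuous fun t => y i + c i * (t - t₀) := by fun_prop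
      exact (this.tendsto t₁).mono_left nhdsWithin_le_nhds
    refine le_of_tendsto_of_tendsto (lim i) (lim k) ?_
    filter_upwards [Ioo_mem_nhdsLT h.lt] with t ht
    exact (h.ordered t ht i k hik hk).le
  · exact le_rfl

theorem midpoint_ordered {i k : ℕ} (hik : i < k) (hk : k < n) :
    y i + c i * ((t₁ - t₀) / 2) < y k + c k * ((t₁ - t₀) / 2) := by
  have := h.lt
  have := h.ordered ((t₀ + t₁) / 2) ⟨by linarith, by linarith⟩ i k hik hk
  rwa [show (t₀ + t₁) / 2 - t₀ = (t₁ - t₀) / 2 by ring] at this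

theorem speed_lt {i k : ℕ} (hik : i < k) (hk : k < n) (hy : y i = y k) : c i < c k := by
  have h1 := h.midpoint_ordered hik hk
  have h2 := h.lt
  rw [hy] at h1
  exact lt_of_mul_lt_mul_right (by linarith) (by linarith : 0 ≤ (t₁ - t₀) / 2)

theorem speed_lt_of_endpoint {i k : ℕ} (hik : i < k) (hk : k < n)
    (hy : y i + c i * (t₁ - t₀) = y k + c k * (t₁ - t₀)) : c k < c i := by
  have h1 := h.midpoint_ordered hik hk
  have h2 := h.lt
  refine lt_of_mul_lt_mul_right ?_ (by linarith : 0 ≤ (t₁ - t₀) / 2)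
  linarith

theorem value_start (x : ℝ) : u t₀ x = v (countLE n y x) := by
  have := h.value t₀ ⟨le_rfl, h.lt.le⟩ x
  simpa using this

theorem value_endpoint (x : ℝ) : u t₁ x = v (countLE n (fun i => y i + c i * (t₁ - t₀)) x) :=
  h.value t₁ ⟨h.lt.le, le_rfl⟩ x

/-- Follow the ray x + ξ(t - t₀) for a short time. Fronts starting left of x stay left of it and
fronts starting right of x stay right. Those starting at x are passed exactly if their speed is at
most ξ. -/
theorem riemannSolution_eq {g : ℝ → ℝ} (hg : SolvesRiemannProblemsAt g u t₀) (x ξ : ℝ) :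
    riemannSolution g (v (countLT n y x)) (v (countLE n y x)) ξ =
      v (countLT n y x + countLE (countLE n y x - countLT n y x)
        (fun i => c (countLT n y x + i)) ξ) := by
  have hy : ∀ i k, i ≤ k → k < n → y i ≤ y k := fun i k => h.start_mono
  obtain ⟨ε, hε, hsol⟩ := hg x
  rw [leftLim_step h.value_start, h.value_start] at hsol
  set lo := countLT n y x with hlo
  set hi := countLE n y x with hhi
  have hlohi : lo ≤ hi := countLT_le_countLE n y x
  have hhin : hi ≤ n := countLE_le n y x
  have hfan : ∀ i, lo ≤ i → i < hi → y i = x := fun i h1 h2 =>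
    le_antisymm ((lt_countLE_iff hy).1 h2).2 ((countLT_le_iff hy (by omega)).1 h1)
  have hc : ∀ i k, i ≤ k → k < hi - lo → c (lo + i) ≤ c (lo + k) := fun i k hik hk => by
    rcases hik.lt_or_eq with hik | rfl
    · exact (h.speed_lt (i := lo + i) (k := lo + k) (by omega) (by omega)
        ((hfan _ (by omega) (by omega)).trans (hfan _ (by omega) (by omega)).symm)).le
    · exact le_rfl
  have hev : ∀ i ∈ Finset.range n, ∀ᶠ t in 𝓝[>] t₀,
      (y i + c i * (t - t₀) ≤ x + ξ * (t - t₀) ↔ y i < x ∨ y i = x ∧ c i ≤ ξ) := fun i _ => by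
    have hcont : ContinuousAt (fun t => (x + ξ * (t - t₀)) - (y i + c i * (t - t₀))) t₀ := by
      fun_prop
    rcases lt_trichotomy (y i) x with hlt | heq | hgt
    · have := hcont.eventually (lt_mem_nhds
        (show 0 < x + ξ * (t₀ - t₀) - (y i + c i * (t₀ - t₀)) by simpa using hlt))
      filter_upwards [nhdsWithin_le_nhds this] with t ht
      exact ⟨fun _ => Or.inl hlt, fun _ => by linarith⟩
    · filter_upwards [self_mem_nhdsWithin] with t ht
      have ht : 0 < t - t₀ := sub_pos.2 ht
      rw [heq, add_le_add_iff_left, mul_le_mul_iff_left₀ ht]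
      simp
    · have := hcont.eventually (gt_mem_nhds
        (show x + ξ * (t₀ - t₀) - (y i + c i * (t₀ - t₀)) < 0 by simpa using hgt))
      filter_upwards [nhdsWithin_le_nhds this] with t ht
      constructor
      · intro h'; linarith
      · rintro (h' | h')
        · linarith
        · linarith [h'.1]
  have hx : ∀ᶠ t in 𝓝[>] t₀, x + ξ * (t - t₀) ∈ Ioo (x - ε) (x + ε) := by
    have : ContinuousAt (fun t => x + ξ * (t - t₀)) t₀ := by fun_prop
    exact nhdsWithin_le_nhds (this.eventually (Ioo_mem_nhds (by simpa using hε) (by simpa using hε)))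
  have he : ∀ᶠ t in 𝓝[>] t₀, t ∈ Ioo t₀ (t₀ + ε) := Ioo_mem_nhdsGT (by linarith)
  have hl : ∀ᶠ t in 𝓝[>] t₀, t ∈ Ioo t₀ t₁ := Ioo_mem_nhdsGT h.lt
  obtain ⟨t, ht, hx, ht1, ht2⟩ := (((Finset.eventually_all _).2 hev).and (hx.and (he.and hl))).exists
  have hpos : 0 < t - t₀ := sub_pos.2 ht2.1
  have h1 := hsol t ht1 _ hx
  rw [add_sub_cancel_left, mul_div_cancel_right₀ _ hpos.ne', h.value t ⟨ht2.1.le, ht2.2.le⟩] at h1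
  rw [← h1]
  congr 1
  have hz : ∀ i k, i ≤ k → k < n → y i + c i * (t - t₀) ≤ y k + c k * (t - t₀) :=
    fun i k hik hk => hik.lt_or_eq.elim (fun hik => (h.ordered t ht2 i k hik hk).le)
      (fun h => h ▸ le_rfl)
  refine eq_of_forall_lt_iff fun i => ?_
  rw [lt_countLE_iff hz]
  constructor
  · rintro ⟨hin, hi'⟩
    rcases (ht i (Finset.mem_range.2 hin)).1 hi' with h2 | ⟨h2, h3⟩
    · have := (lt_countLT_iff hy).2 ⟨hin, h2⟩
      omega
    · have h4 : i < hi := (lt_countLE_iff hy).2 ⟨hin, h2.le⟩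
      have h5 : lo ≤ i := (countLT_le_iff hy hin).2 h2.ge
      have := (lt_countLE_iff hc (i := i - lo) (x := ξ)).2
        ⟨by omega, by rwa [show lo + (i - lo) = i by omega]⟩
      omega
  · intro hi'
    rcases lt_or_ge i lo with h2 | h2
    · have := (lt_countLT_iff hy).1 h2
      exact ⟨this.1, (ht i (Finset.mem_range.2 this.1)).2 (Or.inl this.2)⟩
    · have := (lt_countLE_iff hc (i := i - lo) (x := ξ)).1 (by omega)
      rw [show lo + (i - lo) = i by omega] at this
      have hin : i < n := by omega
      exact ⟨hin, (ht i (Finset.mem_range.2 hin)).2 (Or.inr ⟨hfan i h2 (by omega), this.2⟩)⟩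

theorem fan {f : ℝ → ℝ} (hf : ContDiff ℝ 2 f) {ν : ℕ}
    (hg : SolvesRiemannProblemsAt (piecewiseAffineFlux f ν) u t₀) {k : ℕ} (hk : k < n) {a b : ℝ}
    (ha : a = v (countLT n y (y k))) (hb : b = v (countLE n y (y k))) :
    c k * (v (k + 1) - v k) = piecewiseAffineFlux f ν (v (k + 1)) - piecewiseAffineFlux f ν (v k) ∧
    ((a < b ∧ a ≤ v k ∧ v k < v (k + 1) ∧ v (k + 1) ≤ b ∧ ∀ w ∈ Icc a b,
      piecewiseAffineFlux f ν (v k) + c k * (w - v k) ≤ piecewiseAffineFlux f ν w) ∨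
    (b < a ∧ v k ≤ a ∧ v (k + 1) < v k ∧ b ≤ v (k + 1) ∧ ∀ w ∈ Icc b a,
      piecewiseAffineFlux f ν w ≤ piecewiseAffineFlux f ν (v k) + c k * (w - v k))) := by
  have hy : ∀ i k, i ≤ k → k < n → y i ≤ y k := fun i k => h.start_mono
  have hR := h.riemannSolution_eq hg (y k)
  set lo := countLT n y (y k) with hlo
  set hi := countLE n y (y k) with hhi
  have hlok : lo ≤ k := (countLT_le_iff hy hk).2 le_rfl
  have hkhi : k < hi := (lt_countLE_iff hy).2 ⟨hk, le_rfl⟩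
  have hhin : hi ≤ n := countLE_le n y (y k)
  have hfan : ∀ i, lo ≤ i → i < hi → y i = y k := fun i h1 h2 =>
    le_antisymm ((lt_countLE_iff hy).1 h2).2 ((countLT_le_iff hy (by omega)).1 h1)
  have hc : ∀ i k, i < k → k < hi - lo → c (lo + i) < c (lo + k) := fun i k hik hk =>
    h.speed_lt (by omega) (by omega)
      ((hfan _ (by omega) (by omega)).trans (hfan _ (by omega) (by omega)).symm)
  have hV : ∀ k < hi - lo, v (lo + k) ≠ v (lo + (k + 1)) := fun k hk =>
    h.jump_ne (lo + k) (by omega)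
  have e0 : lo + (hi - lo) = hi := by omega
  have e1 : lo + (k - lo) = k := by omega
  have e2 : lo + (k - lo + 1) = k + 1 := by omega
  -- Equal outer states fall into the first case and are ruled out there, since a front between them
  -- would increase strictly.
  rcases le_or_gt a b with hab | hab
  · obtain ⟨L, hL0, hL⟩ := piecewiseAffineFlux_lipschitz hf ν a b
    obtain ⟨h1, h2, h3, h4, h5⟩ := riemannSolution_fan_up (g := piecewiseAffineFlux f ν)
      (V := fun i => v (lo + i)) (c := fun i => c (lo + i)) (m := hi - lo) (k := k - lo)
      (by simpa only [e0, add_zero, ← ha, ← hb] using hL) hL0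
      (by simpa only [e0, add_zero, ← ha, ← hb] using hab) hc hV
      (by simpa only [e0, add_zero] using hR) (by omega)
    simp only [e0, e1, e2, add_zero, ← ha, ← hb] at h1 h2 h3 h4 h5
    exact ⟨h4, Or.inl ⟨by linarith, h1, h2, h3, h5⟩⟩
  · obtain ⟨L, hL0, hL⟩ := piecewiseAffineFlux_lipschitz hf ν b a
    obtain ⟨h1, h2, h3, h4, h5⟩ := riemannSolution_fan_down (g := piecewiseAffineFlux f ν)
      (V := fun i => v (lo + i)) (c := fun i => c (lo + i)) (m := hi - lo) (k := k - lo)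
      (by simpa only [e0, add_zero, ← ha, ← hb] using hL) hL0
      (by simpa only [e0, add_zero, ← ha, ← hb] using hab) hc hV
      (by simpa only [e0, add_zero] using hR) (by omega)
    simp only [e0, e1, e2, add_zero, ← ha, ← hb] at h1 h2 h3 h4 h5
    exact ⟨h4, Or.inr ⟨hab, h1, h2, h3, h5⟩⟩

end FrontPattern

/-! ### The states of a front pattern -/

theorem continuous_piecewiseAffineFlux {f : ℝ → ℝ} (hf : ContDiff ℝ 2 f) (ν : ℕ) :
    Continuous (piecewiseAffineFlux f ν) := by
  refine continuous_iff_continuousAt.2 fun x => ?_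
  obtain ⟨L, hL0, hL⟩ := piecewiseAffineFlux_lipschitz hf ν (x - 1) (x + 1)
  have : LipschitzOnWith ⟨L, hL0⟩ (piecewiseAffineFlux f ν) (Icc (x - 1) (x + 1)) :=
    LipschitzOnWith.of_dist_le_mul fun a ha b hb => by
      rw [Real.dist_eq, Real.dist_eq]; exact hL a ha b hb
  exact this.continuousOn.continuousAt (Icc_mem_nhds (by linarith) (by linarith))

theorem piecewiseAffineFlux_node_or_affine (f : ℝ → ℝ) (ν : ℕ) (b : ℝ) :
    (∃ k : ℤ, b = k / 2 ^ ν) ∨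
      ∃ s, ∀ᶠ w in 𝓝 b, piecewiseAffineFlux f ν w - piecewiseAffineFlux f ν b = s * (w - b) := by
  have hN : (0 : ℝ) < 2 ^ ν := by positivity
  obtain ⟨k, θ, h0, h1, rfl⟩ := exists_cell ν b
  rcases h0.eq_or_lt with rfl | h0
  · exact Or.inl ⟨k, by rw [add_zero]⟩
  right
  refine ⟨2 ^ ν * (f ((k + 1) / 2 ^ ν) - f (k / 2 ^ ν)), ?_⟩
  have hlt : (k : ℝ) / 2 ^ ν < (k + θ) / 2 ^ ν := by
    rw [div_lt_div_iff_of_pos_right hN]; linarith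
  have hgt : ((k : ℝ) + θ) / 2 ^ ν < (k + 1) / 2 ^ ν := by
    rw [div_lt_div_iff_of_pos_right hN]; linarith
  filter_upwards [Icc_mem_nhds hlt hgt] with w hw
  rw [mem_Icc, div_le_iff₀ hN, le_div_iff₀ hN] at hw
  have hw' : w = (k + (w * 2 ^ ν - k)) / 2 ^ ν := by field_simp; ring
  have e1 := piecewiseAffineFlux_cell f ν k (θ := w * 2 ^ ν - k) (by linarith) (by linarith)
  rw [← hw'] at e1
  rw [e1, piecewiseAffineFlux_cell f ν k h0.le h1.le]
  field_simp
  ring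

/-- Two support lines of different slopes at an interior point need a kink, and the flux has kinks
only at nodes. -/
theorem eq_node_of_support_below {f : ℝ → ℝ} {ν : ℕ} {A B b p q : ℝ} (hA : A < b) (hB : b < B)
    (hpq : p < q)
    (hp : ∀ w ∈ Icc A B, piecewiseAffineFlux f ν b + p * (w - b) ≤ piecewiseAffineFlux f ν w)
    (hq : ∀ w ∈ Icc A B, piecewiseAffineFlux f ν b + q * (w - b) ≤ piecewiseAffineFlux f ν w) :
    ∃ k : ℤ, b = k / 2 ^ ν := by
  rcases piecewiseAffineFlux_node_or_affine f ν b with h | ⟨s, hs⟩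
  · exact h
  exfalso
  obtain ⟨w, hw1, hw2⟩ := ((hs.filter_mono (nhdsWithin_le_nhds (s := Ioi b))).and
    (eventually_mem_set.2 (Ioo_mem_nhdsGT hB))).exists
  obtain ⟨w', hw1', hw2'⟩ := ((hs.filter_mono (nhdsWithin_le_nhds (s := Iio b))).and
    (eventually_mem_set.2 (Ioo_mem_nhdsLT hA))).exists
  have h1 := hq w ⟨hA.le.trans hw2.1.le, hw2.2.le⟩
  have h2 := hp w' ⟨hw2'.1.le, hw2'.2.le.trans hB.le⟩
  have h3 : q ≤ s := le_of_mul_le_mul_right (by linarith) (sub_pos.2 hw2.1)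
  have h4 : s ≤ p := le_of_mul_le_mul_right (by linarith) (sub_pos.2 hw2'.2)
  linarith

theorem eq_node_of_support_above {f : ℝ → ℝ} {ν : ℕ} {A B b p q : ℝ} (hA : A < b) (hB : b < B)
    (hpq : p < q)
    (hp : ∀ w ∈ Icc A B, piecewiseAffineFlux f ν w ≤ piecewiseAffineFlux f ν b + p * (w - b))
    (hq : ∀ w ∈ Icc A B, piecewiseAffineFlux f ν w ≤ piecewiseAffineFlux f ν b + q * (w - b)) :
    ∃ k : ℤ, b = k / 2 ^ ν := by
  rcases piecewiseAffineFlux_node_or_affine f ν b with h | ⟨s, hs⟩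
  · exact h
  exfalso
  obtain ⟨w, hw1, hw2⟩ := ((hs.filter_mono (nhdsWithin_le_nhds (s := Ioi b))).and
    (eventually_mem_set.2 (Ioo_mem_nhdsGT hB))).exists
  obtain ⟨w', hw1', hw2'⟩ := ((hs.filter_mono (nhdsWithin_le_nhds (s := Iio b))).and
    (eventually_mem_set.2 (Ioo_mem_nhdsLT hA))).exists
  have h1 := hp w ⟨hA.le.trans hw2.1.le, hw2.2.le⟩
  have h2 := hq w' ⟨hw2'.1.le, hw2'.2.le.trans hB.le⟩
  have h3 : s ≤ p := le_of_mul_le_mul_right (by linarith) (sub_pos.2 hw2.1)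
  have h4 : q ≤ s := le_of_mul_le_mul_right (by linarith) (sub_pos.2 hw2'.2)
  linarith

/-- A state is either a value of `u t₀`, possibly a limit from the left, or an inner state of a fan.
In the latter case it lies between the outer states, and the two adjacent fronts provide support
lines of different slopes, so it is a node. -/
theorem FrontPattern.state_mem {u : ℝ → ℝ → ℝ} {t₀ t₁ : ℝ} {n : ℕ} {y c v : ℕ → ℝ}
    (h : FrontPattern u t₀ t₁ n y c v) {f : ℝ → ℝ} (hf : ContDiff ℝ 2 f) {ν : ℕ}
    (hg : SolvesRiemannProblemsAt (piecewiseAffineFlux f ν) u t₀) {H : Set ℝ} (hH : Convex ℝ H)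
    (hu : ∀ x, u t₀ x ∈ {w ∈ H | ∃ k : ℤ, w = k / 2 ^ ν}) {k : ℕ} (hk : k ≤ n) :
    v k ∈ {w ∈ H | ∃ k : ℤ, w = k / 2 ^ ν} := by
  have hy : ∀ i k, i ≤ k → k < n → y i ≤ y k := fun i k => h.start_mono
  have hval := h.value_start
  rcases hk.lt_or_eq with hk | rfl
  · have hlo : v (countLT n y (y k)) ∈ {w ∈ H | ∃ k : ℤ, w = k / 2 ^ ν} := by
      obtain ⟨x', hx'⟩ := exists_eq_countLT n y (y k)
      rw [← hx', ← hval]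
      exact hu x'
    have hhi : v (countLE n y (y k)) ∈ {w ∈ H | ∃ k : ℤ, w = k / 2 ^ ν} := by
      rw [← hval]
      exact hu _
    rcases ((countLT_le_iff hy hk).2 le_rfl).eq_or_lt with heq | hlt
    · rwa [heq] at hlo
    have hyk : y (k - 1) = y k := le_antisymm (hy _ _ (by omega) hk)
      ((countLT_le_iff hy (by omega)).1 (by omega))
    have hc : c (k - 1) < c k := h.speed_lt (by omega) hk hyk
    have e : k - 1 + 1 = k := by omega
    obtain ⟨hRH, hfan⟩ := h.fan hf hg hk rfl rfl
    obtain ⟨hRH', hfan'⟩ := h.fan hf hg (k := k - 1) (by omega) (a := v (countLT n y (y k)))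
      (b := v (countLE n y (y k))) (by rw [hyk]) (by rw [hyk])
    rw [e] at hRH' hfan'
    generalize v (countLT n y (y k)) = a at *
    generalize v (countLE n y (y k)) = b at *
    rcases hfan with ⟨hab, h1, h2, h3, h4⟩ | ⟨hab, h1, h2, h3, h4⟩ <;>
    rcases hfan' with ⟨hab', h1', h2', h3', h4'⟩ | ⟨hab', h1', h2', h3', h4'⟩
    · refine ⟨hH.ordConnected.out hlo.1 hhi.1 ⟨by linarith, by linarith⟩, ?_⟩
      exact eq_node_of_support_below (A := a) (B := b) (by linarith) (by linarith) hc
        (fun w hw => by linarith [h4' w hw]) h4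
    · linarith
    · linarith
    · refine ⟨hH.ordConnected.out hhi.1 hlo.1 ⟨by linarith, by linarith⟩, ?_⟩
      exact eq_node_of_support_above (A := b) (B := a) (by linarith) (by linarith) hc
        (fun w hw => by linarith [h4' w hw]) h4
  · have : countLE k y (y (k - 1)) = k := by
      apply le_antisymm (countLE_le _ _ _)
      rcases Nat.eq_zero_or_pos k with h0 | h0
      · omega
      · have := (lt_countLE_iff hy (x := y (k - 1)) (i := k - 1)).2 ⟨by omega, le_rfl⟩
        omega
    rw [← this, ← hval]
    exact hu _

/-! ### Selections from graphs and fibers of monotone functions -/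

/-- The sets of times at which `F` follows a given curve are closed. They cover the rational times,
hence all times. On the open interval they are disjoint, so by connectedness one of them is
everything. -/
theorem exists_eqOn_Icc_of_rat {a b : ℝ} (hab : a < b) {F : ℝ → ℝ} (hF : ContinuousOn F (Icc a b))
    {n : ℕ} {z : ℕ → ℝ → ℝ} (hz : ∀ i, Continuous (z i))
    (hord : ∀ t ∈ Ioo a b, ∀ i k, i < k → k < n → z i t < z k t)
    (hq : ∀ q : ℚ, (q : ℝ) ∈ Ioo a b → ∃ i < n, F q = z i q) :
    ∃ i < n, ∀ t ∈ Icc a b, F t = z i t := by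
  set C : ℕ → Set ℝ := fun i => {t ∈ Icc a b | F t = z i t} with hC
  have hclosed : ∀ i, IsClosed (C i) := fun i => by
    have := (hF.sub (hz i).continuousOn).preimage_isClosed_of_isClosed isClosed_Icc
      (isClosed_singleton (x := (0 : ℝ)))
    convert this using 1
    ext t
    simp [hC, sub_eq_zero]
  have hdense : Icc a b ⊆ closure (Ioo a b ∩ range ((↑) : ℚ → ℝ)) := by
    rw [← closure_Ioo hab.ne]
    refine closure_minimal ?_ isClosed_closure
    exact (Rat.denseRange_cast (𝕜 := ℝ)).open_subset_closure_inter isOpen_Ioo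
  have hcover : Icc a b ⊆ ⋃ i ∈ Finset.range n, C i := by
    refine hdense.trans (closure_minimal ?_ (isClosed_biUnion_finset fun i _ => hclosed i))
    rintro _ ⟨ht, q, rfl⟩
    obtain ⟨i, hi, h⟩ := hq q ht
    simp only [mem_iUnion]
    exact ⟨i, Finset.mem_range.2 hi, Ioo_subset_Icc_self ht, h⟩
  obtain ⟨q, hqa, hqb⟩ := exists_rat_btwn hab
  obtain ⟨i, hi, hqi⟩ := hq q ⟨hqa, hqb⟩
  have hsub : Ioo a b ⊆ C i := by
    by_contra hcon
    rw [not_subset] at hcon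
    obtain ⟨t, ht, hti⟩ := hcon
    have hmem : ∀ t ∈ Ioo a b, t ∉ C i → t ∈ ⋃ k ∈ (Finset.range n).erase i, C k := by
      intro t ht hti
      have := hcover (Ioo_subset_Icc_self ht)
      simp only [mem_iUnion, Finset.mem_erase] at this ⊢
      obtain ⟨k, hk, hk'⟩ := this
      exact ⟨k, ⟨fun h => hti (h ▸ hk'), hk⟩, hk'⟩
    obtain ⟨t', ht', hi', hk'⟩ := isPreconnected_closed_iff.1 isPreconnected_Ioo (C i)
      (⋃ k ∈ (Finset.range n).erase i, C k) (hclosed i)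
      (isClosed_biUnion_finset fun k _ => hclosed k)
      (fun t ht => or_iff_not_imp_left.2 (hmem t ht))
      ⟨q, ⟨hqa, hqb⟩, ⟨hqa.le, hqb.le⟩, hqi⟩ ⟨t, ht, hmem t ht hti⟩
    simp only [mem_iUnion, Finset.mem_erase, Finset.mem_range] at hk'
    obtain ⟨k, ⟨hki, hk⟩, hk'⟩ := hk'
    have heq : z i t' = z k t' := hi'.2.symm.trans hk'.2
    rcases lt_or_gt_of_ne hki with h | h
    · exact (hord t' ht' k i h hi).ne' heq
    · exact (hord t' ht' i k h hk).ne heq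
  refine ⟨i, hi, fun t ht => ?_⟩
  rw [← closure_Ioo hab.ne] at ht
  exact (closure_minimal hsub (hclosed i) ht).2

/-- A fiber is the trace on `A` of an order connected set. -/
theorem measurableSet_fiber_of_monotoneOn {A : Set ℝ} (hA : MeasurableSet A) {β : Type*}
    [PartialOrder β] {f : ℝ → β} (hf : MonotoneOn f A) (b : β) :
    MeasurableSet {s ∈ A | f s = b} := by
  have : {s ∈ A | f s = b} = A ∩ {s | ∃ x ∈ A, ∃ y ∈ A, f x = b ∧ f y = b ∧ x ≤ s ∧ s ≤ y} := by
    ext s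
    constructor
    · rintro ⟨hs, hb⟩
      exact ⟨hs, s, hs, s, hs, hb, hb, le_rfl, le_rfl⟩
    · rintro ⟨hs, x, hx, y, hy, hxb, hyb, hxs, hsy⟩
      exact ⟨hs, le_antisymm (hyb ▸ hf hs hy hsy) (hxb ▸ hf hx hs hxs)⟩
  rw [this]
  refine hA.inter (OrdConnected.measurableSet ⟨?_⟩)
  rintro s ⟨x, hx, -, -, hxb, -, hxs, -⟩ s' ⟨-, -, y, hy, -, hyb, -, hsy⟩ r hr
  exact ⟨x, hx, y, hy, hxb, hyb, hxs.trans hr.1, hr.2.trans hsy⟩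

/-! ### Regular waves -/

theorem volume_waveInterval (u : ℝ → ℝ → ℝ) :
    volume (waveInterval u) = ENNReal.ofReal (eVariationOn (u 0) univ).toReal := by
  rw [waveInterval, Real.volume_Ioc, sub_zero]

theorem volume_aliveWaves_ne_top (u : ℝ → ℝ → ℝ) (T : ℝ → EReal) (t : ℝ) :
    volume (aliveWaves u T t) ≠ ⊤ :=
  ((measure_mono fun _ h => h.1).trans_lt
    (by rw [volume_waveInterval]; exact ENNReal.ofReal_lt_top)).ne

namespace IsWaveRepresentation

variable {u X : ℝ → ℝ → ℝ} {U S : ℝ → ℝ} {T : ℝ → EReal} (hX : IsWaveRepresentation u X U S T)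
include hX

theorem measurableSet_aliveWaves (t : ℝ) : MeasurableSet (aliveWaves u T t) :=
  measurableSet_Ioc.inter (measurableSet_lt measurable_const hX.measurable_time)

theorem monotoneOn_aliveWaves {t : ℝ} (ht : 0 ≤ t) : MonotoneOn (X t) (aliveWaves u T t) :=
  (hX.monotone_position t ht).mono fun _ h => ⟨h.1, h.2.le⟩

theorem aemeasurable_position {t : ℝ} (ht : 0 ≤ t) :
    AEMeasurable (X t) (volume.restrict (aliveWaves u T t)) :=
  aemeasurable_restrict_of_monotoneOn (hX.measurableSet_aliveWaves t) (hX.monotoneOn_aliveWaves ht)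

theorem integral_signedExistence {t : ℝ} (ht : 0 ≤ t) (φ : ℝ → ℝ) :
    ∫ s in waveInterval u, φ (X t s) * signedExistence S T t s =
      ∫ s in aliveWaves u T t, φ (X t s) * S s := by
  rw [setIntegral_eq_of_subset_of_forall_sdiff_eq_zero 
    (show MeasurableSet (waveInterval u) from measurableSet_Ioc)
    (show aliveWaves u T t ⊆ waveInterval u from fun _ h => h.1)]
  · refine setIntegral_congr_fun (hX.measurableSet_aliveWaves t) fun s hs => ?_
    simp only [signedExistence, if_pos (show 0 ≤ t ∧ (t : EReal) < T s from ⟨ht, hs.2⟩)]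
  · intro s hs
    have : ¬(0 ≤ t ∧ (t : EReal) < T s) := fun h => hs.2 ⟨hs.1, h.2⟩
    simp only [signedExistence, if_neg this, mul_zero]

variable {t₀ t₁ : ℝ} {n : ℕ} {y c v : ℕ → ℝ} (h : FrontPattern u t₀ t₁ n y c v) (h0 : 0 ≤ t₀)
  {t : ℝ} (ht : t ∈ Ioo t₀ t₁)
include h h0 ht

theorem volume_position :
    (∀ i < n, volume {s ∈ aliveWaves u T t | X t s = y i + c i * (t - t₀)} =
      ENNReal.ofReal |v (i + 1) - v i|) ∧
    volume (aliveWaves u T t) = ∑ i ∈ Finset.range n, ENNReal.ofReal |v (i + 1) - v i| := by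
  have h0t : 0 ≤ t := h0.trans ht.1.le
  have := volume_waves_at (hX.measurableSet_aliveWaves t) (volume_aliveWaves_ne_top u T t)
    (hX.aemeasurable_position h0t) (h.value t ⟨ht.1.le, ht.2.le⟩) (h.ordered t ht)
    (hX.variation t h0t)
  exact ⟨this.1, this.2.2⟩

theorem ae_sign_position : ∀ᵐ s ∂volume.restrict (aliveWaves u T t), ∃ i < n,
    X t s = y i + c i * (t - t₀) ∧ S s = if v i < v (i + 1) then 1 else -1 := by
  have h0t : 0 ≤ t := h0.trans ht.1.le
  exact sign_waves_at (hX.measurableSet_aliveWaves t) (volume_aliveWaves_ne_top u T t)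
    (hX.aemeasurable_position h0t) (h.value t ⟨ht.1.le, ht.2.le⟩) (h.ordered t ht)
    (hX.variation t h0t) h.left_state h.right_state hX.measurable_sign
    (fun s hs => hX.sign_eq s hs.1)
    (fun φ hφ => (hX.derivative t h0t φ hφ).trans (hX.integral_signedExistence h0t φ)) h.jump_ne

/-- The measure of the living waves is the total variation of `u`, which is constant inside a stage.
Since waves only disappear, almost none of them does so there. -/
theorem volume_aliveWaves_diff {t' : ℝ} (ht' : t' ∈ Ioo t₀ t₁) :
    volume (aliveWaves u T t \ aliveWaves u T t') = 0 := by
  have hanti : ∀ {a b : ℝ}, a ≤ b → aliveWaves u T b ⊆ aliveWaves u T a := fun hab s hs =>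
    ⟨hs.1, (EReal.coe_le_coe_iff.2 hab).trans_lt hs.2⟩
  rcases le_total t' t with hle | hle
  · rw [sdiff_eq_empty.2 (hanti hle), measure_empty]
  · rw [measure_sdiff (hanti hle) (hX.measurableSet_aliveWaves t').nullMeasurableSet (volume_aliveWaves_ne_top u T t'),
      (hX.volume_position h h0 ht).2, (hX.volume_position h h0 ht').2, tsub_self]

end IsWaveRepresentation

/-- What is known at a fixed time holds for almost every wave only. Imposing it at all rational
times costs a null set, and the Lipschitz continuity of the paths recovers all other times. -/
theorem exists_regular_waves {u X : ℝ → ℝ → ℝ} {U S : ℝ → ℝ} {T : ℝ → EReal}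
    (hX : IsWaveRepresentation u X U S T) {t : ℕ → ℝ} (ht0 : t 0 = 0) (ht : StrictMono t)
    {n : ℕ → ℕ} {y c v : ℕ → ℕ → ℝ}
    (h : ∀ j, FrontPattern u (t j) (t (j + 1)) (n j) (y j) (c j) (v j)) :
    ∃ G ⊆ waveInterval u, MeasurableSet G ∧ volume (waveInterval u \ G) = 0 ∧
      ∀ s ∈ G, ∀ j, T s ≤ t j ∨ (t (j + 1) : EReal) ≤ T s ∧
        ∃ i < n j, (S s = if v j i < v j (i + 1) then 1 else -1) ∧
          ∀ τ ∈ Icc (t j) (t (j + 1)), X τ s = y j i + c j i * (τ - t j) := by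
  have hnn : ∀ j, 0 ≤ t j := fun j => ht0 ▸ ht.monotone (Nat.zero_le j)
  have hJ : MeasurableSet (waveInterval u) := measurableSet_Ioc
  have hae : ∀ᵐ s ∂volume.restrict (waveInterval u),
      (∀ j, ∀ q : ℚ, (q : ℝ) ∈ Ioo (t j) (t (j + 1)) → s ∈ aliveWaves u T q → ∃ i < n j,
        X q s = y j i + c j i * (q - t j) ∧ S s = if v j i < v j (i + 1) then 1 else -1) ∧
      (∀ j, ∀ q : ℚ, (q : ℝ) ∈ Ioo (t j) (t (j + 1)) → ∀ q' : ℚ, (q' : ℝ) ∈ Ioo (t j) (t (j + 1)) →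
        s ∈ aliveWaves u T q → s ∈ aliveWaves u T q') := by
    refine Eventually.and ?_ ?_
    · rw [ae_all_iff]; intro j
      rw [ae_all_iff]; intro q
      by_cases hq : (q : ℝ) ∈ Ioo (t j) (t (j + 1))
      · have := hX.ae_sign_position (h j) (hnn j) hq
        rw [ae_restrict_iff' (hX.measurableSet_aliveWaves _)] at this
        filter_upwards [ae_restrict_of_ae this] with s hs _ using hs
      · exact ae_of_all _ fun s h' => absurd h' hq
    · rw [ae_all_iff]; intro j
      rw [ae_all_iff]; intro q
      by_cases hq : (q : ℝ) ∈ Ioo (t j) (t (j + 1))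
      · simp only [hq, true_imp_iff]
        rw [ae_all_iff]; intro q'
        by_cases hq' : (q' : ℝ) ∈ Ioo (t j) (t (j + 1))
        · have := hX.volume_aliveWaves_diff (h j) (hnn j) hq hq'
          filter_upwards [ae_restrict_of_ae (measure_eq_zero_iff_ae_notMem.1 this)] with s hs _ h1
          by_contra h2
          exact hs ⟨h1, h2⟩
        · exact ae_of_all _ fun s h' => absurd h' hq'
      · exact ae_of_all _ fun s h' => absurd h' hq
  rw [ae_restrict_iff' hJ, ae_iff] at hae
  -- The exceptional null set is enlarged so that `G` becomes measurable.
  set B := toMeasurable volume {s | ¬ (s ∈ waveInterval u → _)} with hB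
  have hB0 : volume B = 0 := by rw [hB, measure_toMeasurable]; exact hae
  refine ⟨waveInterval u \ B, sdiff_subset, hJ.diff (measurableSet_toMeasurable _ _),
    measure_mono_null (fun s hs => by_contra fun h' => hs.2 ⟨hs.1, h'⟩) hB0, fun s hs => ?_⟩
  obtain ⟨h1, h2⟩ := by_contra fun h' =>
    hs.2 (subset_toMeasurable _ _ (show s ∈ {s | ¬ (s ∈ waveInterval u → _)} from
      fun h'' => h' (h'' hs.1)))
  have hend : ∀ j, (∀ q : ℚ, (q : ℝ) ∈ Ioo (t j) (t (j + 1)) → s ∈ aliveWaves u T q) →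
      (t (j + 1) : EReal) ≤ T s := fun j hj => by
    refine le_of_forall_lt fun b hb => ?_
    obtain ⟨q, hq1, hq2⟩ := EReal.lt_iff_exists_rat_btwn.1
      (max_lt hb (EReal.coe_lt_coe_iff.2 (ht (Nat.lt_succ_self j))))
    have hq : (q : ℝ) ∈ Ioo (t j) (t (j + 1)) :=
      ⟨EReal.coe_lt_coe_iff.1 ((le_max_right _ _).trans_lt hq1), EReal.coe_lt_coe_iff.1 hq2⟩
    exact ((le_max_left _ _).trans_lt hq1).trans (hj q hq).2
  intro j
  by_cases hj : ∀ q : ℚ, (q : ℝ) ∈ Ioo (t j) (t (j + 1)) → s ∈ aliveWaves u T q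
  · right
    have hT := hend j hj
    refine ⟨hT, ?_⟩
    obtain ⟨K, hK⟩ := hX.lipschitz_position s hs.1
    have hcont : ContinuousOn (fun τ => X τ s) (Icc (t j) (t (j + 1))) :=
      hK.continuousOn.mono fun τ hτ =>
        ⟨(hnn j).trans hτ.1, (EReal.coe_le_coe_iff.2 hτ.2).trans hT⟩
    obtain ⟨i, hi, hXi⟩ := exists_eqOn_Icc_of_rat (ht (Nat.lt_succ_self j)) hcont (n := n j)
      (z := fun i τ => y j i + c j i * (τ - t j)) (fun i => by fun_prop) (h j).ordered
      fun q hq => by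
        obtain ⟨i, hi, hi', -⟩ := h1 j q hq (hj q hq)
        exact ⟨i, hi, hi'⟩
    refine ⟨i, hi, ?_, hXi⟩
    obtain ⟨q, hqa, hqb⟩ := exists_rat_btwn (ht (Nat.lt_succ_self j))
    obtain ⟨k, hk, hk', hS⟩ := h1 j q ⟨hqa, hqb⟩ (hj q ⟨hqa, hqb⟩)
    have heq : y j i + c j i * (q - t j) = y j k + c j k * (q - t j) :=
      (hXi q ⟨hqa.le, hqb.le⟩).symm.trans hk'
    have hik : i = k := by
      rcases lt_trichotomy i k with h' | h' | h'
      · exact absurd heq ((h j).ordered q ⟨hqa, hqb⟩ i k h' hk).ne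
      · exact h'
      · exact absurd heq ((h j).ordered q ⟨hqa, hqb⟩ k i h' hi).ne'
    rwa [hik]
  · left
    -- A wave that is missing at one rational time of the stage is missing at all of them, so it
    -- ended no later than the stage began.
    push Not at hj
    obtain ⟨q, hq, hqs⟩ := hj
    refine le_of_forall_gt fun b hb => ?_
    by_contra hcon
    obtain ⟨q', hq1, hq2⟩ := EReal.lt_iff_exists_rat_btwn.1
      (lt_min hb (EReal.coe_lt_coe_iff.2 (ht (Nat.lt_succ_self j))))
    have hq' : (q' : ℝ) ∈ Ioo (t j) (t (j + 1)) :=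
      ⟨EReal.coe_lt_coe_iff.1 hq1, EReal.coe_lt_coe_iff.1 (hq2.trans_le (min_le_right _ _))⟩
    exact hqs (h2 j q' hq' q hq ⟨hs.1, (hq2.trans_le (min_le_left _ _)).trans_le (not_lt.1 hcon)⟩)

/-! ### The model of a wavefront tracking approximation -/

/-- The stages of a wavefront tracking approximation and a set `G` of almost all waves, which
follow the fronts. -/
structure RegularWaves (f : ℝ → ℝ) (ν : ℕ) (u X : ℝ → ℝ → ℝ) (S : ℝ → ℝ) (T : ℝ → EReal) where
  t : ℕ → ℝ
  n : ℕ → ℕ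
  y : ℕ → ℕ → ℝ
  c : ℕ → ℕ → ℝ
  v : ℕ → ℕ → ℝ
  G : Set ℝ
  t_zero : t 0 = 0
  t_strictMono : StrictMono t
  tendsto_t : Tendsto t atTop atTop
  solves : ∀ j, SolvesRiemannProblemsAt (piecewiseAffineFlux f ν) u (t j)
  pattern : ∀ j, FrontPattern u (t j) (t (j + 1)) (n j) (y j) (c j) (v j)
  binary : ∀ j i i' k k', i < i' → i' < n j → k < k' → k' < n j →
    y j i + c j i * (t (j + 1) - t j) = y j i' + c j i' * (t (j + 1) - t j) →
    y j k + c j k * (t (j + 1) - t j) = y j k' + c j k' * (t (j + 1) - t j) → i = k ∧ i' = k'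
  subset : G ⊆ waveInterval u
  measurableSet : MeasurableSet G
  volume_sdiff : volume (waveInterval u \ G) = 0
  follows : ∀ s ∈ G, ∀ j, T s ≤ t j ∨ (t (j + 1) : EReal) ≤ T s ∧
    ∃ i < n j, (S s = if v j i < v j (i + 1) then 1 else -1) ∧
      ∀ τ ∈ Icc (t j) (t (j + 1)), X τ s = y j i + c j i * (τ - t j)

theorem IsWavefrontTracking.exists_regularWaves {f : ℝ → ℝ} {ν : ℕ} {u X : ℝ → ℝ → ℝ} {U S : ℝ → ℝ}
    {T : ℝ → EReal} (hu : IsWavefrontTracking f ν u) (hX : IsWaveRepresentation u X U S T) :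
    Nonempty (RegularWaves f ν u X S T) := by
  obtain ⟨-, t, ht0, ht, hlim, hj⟩ := hu
  have hN : ∀ j, ∃ (n : ℕ) (y c v : ℕ → ℝ), FrontPattern u (t j) (t (j + 1)) n y c v ∧
      ∀ i i' k k', i < i' → i' < n → k < k' → k' < n →
        y i + c i * (t (j + 1) - t j) = y i' + c i' * (t (j + 1) - t j) →
        y k + c k * (t (j + 1) - t j) = y k' + c k' * (t (j + 1) - t j) → i = k ∧ i' = k' := by
    intro j
    obtain ⟨-, n, y, c, v, hp, hb⟩ := hj j
    obtain ⟨y', c', heq, hp'⟩ := hp.exists_frontPattern (ht (Nat.lt_succ_self j))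
    refine ⟨n, y', c', v, hp', fun i i' k k' hii hi' hkk hk' e1 e2 => ?_⟩
    have := hb ⟨i, hii.trans hi'⟩ ⟨i', hi'⟩ ⟨k, hkk.trans hk'⟩ ⟨k', hk'⟩ hii hkk
      (by simpa only [← (heq _).1, ← (heq _).2] using e1)
      (by simpa only [← (heq _).1, ← (heq _).2] using e2)
    simpa only [Fin.mk.injEq] using this
  choose n y c v hp hb using hN
  obtain ⟨G, hG, hGm, hG0, hGs⟩ := exists_regular_waves hX ht0 ht hp
  exact ⟨⟨t, n, y, c, v, G, ht0, ht, hlim, fun j => (hj j).1, hp, hb, hG, hGm, hG0, hGs⟩⟩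

namespace RegularWaves

variable {f : ℝ → ℝ} {ν : ℕ} {u X : ℝ → ℝ → ℝ} {U S : ℝ → ℝ} {T : ℝ → EReal}
  (R : RegularWaves f ν u X S T)

/-- The regular waves that exist in stage `j`. -/
def alive (j : ℕ) : Set ℝ := {s ∈ R.G | (R.t (j + 1) : EReal) ≤ T s}

/-- The middle of stage `j`. -/
def mid (j : ℕ) : ℝ := (R.t j + R.t (j + 1)) / 2

/-- The position of front `i` of stage `j` at time `τ`. -/
def line (j i : ℕ) (τ : ℝ) : ℝ := R.y j i + R.c j i * (τ - R.t j)

/-- The front of stage `j` that contains the wave `s`. -/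
def front (j : ℕ) (s : ℝ) : ℕ := countLT (R.n j) (fun i => R.line j i (R.mid j)) (X (R.mid j) s)

theorem t_lt (j : ℕ) : R.t j < R.t (j + 1) := R.t_strictMono (Nat.lt_succ_self j)

theorem t_nonneg (j : ℕ) : 0 ≤ R.t j := R.t_zero ▸ R.t_strictMono.monotone (Nat.zero_le j)

theorem mid_mem (j : ℕ) : R.mid j ∈ Ioo (R.t j) (R.t (j + 1)) := by
  have := R.t_lt j
  constructor <;> unfold mid <;> linarith

theorem mid_nonneg (j : ℕ) : 0 ≤ R.mid j := (R.t_nonneg j).trans (R.mid_mem j).1.le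

theorem line_lt (j : ℕ) : ∀ i k, i < k → k < R.n j → R.line j i (R.mid j) < R.line j k (R.mid j) :=
  (R.pattern j).ordered _ (R.mid_mem j)

theorem alive_anti : Antitone R.alive := antitone_nat_of_succ_le fun j _ hs =>
  ⟨hs.1, (EReal.coe_le_coe_iff.2 (R.t_lt (j + 1)).le).trans hs.2⟩

/-- A regular wave never ends strictly inside a stage, so being alive at one time of the stage means
living through all of it. -/
theorem mem_alive_iff {j : ℕ} {s : ℝ} (hs : s ∈ R.G) {τ : ℝ} (hτ : τ ∈ Ico (R.t j) (R.t (j + 1))) :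
    s ∈ R.alive j ↔ (τ : EReal) < T s := by
  constructor
  · exact fun h => (EReal.coe_lt_coe_iff.2 hτ.2).trans_le h.2
  · intro h
    rcases R.follows s hs j with h' | ⟨h', -⟩
    · exact absurd (h.trans_le h') (not_lt.2 (EReal.coe_le_coe_iff.2 hτ.1))
    · exact ⟨hs, h'⟩

theorem front_spec {j : ℕ} {s : ℝ} (hs : s ∈ R.alive j) : R.front j s < R.n j ∧
    (S s = if R.v j (R.front j s) < R.v j (R.front j s + 1) then 1 else -1) ∧
    ∀ τ ∈ Icc (R.t j) (R.t (j + 1)), X τ s = R.line j (R.front j s) τ := by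
  rcases R.follows s hs.1 j with h' | ⟨-, i, hi, hS, hXi⟩
  · exact absurd (hs.2.trans h') (not_le.2 (EReal.coe_lt_coe_iff.2 (R.t_lt j)))
  · have : R.front j s = i := by
      rw [front, hXi _ ⟨(R.mid_mem j).1.le, (R.mid_mem j).2.le⟩]
      exact (countLE_of_strictMono (R.line_lt j) hi).2
    rw [this]
    exact ⟨hi, hS, hXi⟩

theorem position_mid {j : ℕ} {s : ℝ} (hs : s ∈ R.alive j) :
    X (R.mid j) s = R.line j (R.front j s) (R.mid j) :=
  (R.front_spec hs).2.2 _ ⟨(R.mid_mem j).1.le, (R.mid_mem j).2.le⟩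

theorem alive_subset (j : ℕ) : R.alive j ⊆ aliveWaves u T (R.mid j) := fun _ hs =>
  ⟨R.subset hs.1, (R.mem_alive_iff hs.1 ⟨(R.mid_mem j).1.le, (R.mid_mem j).2⟩).1 hs⟩

theorem aliveWaves_mid_sdiff (j : ℕ) : aliveWaves u T (R.mid j) \ R.alive j ⊆ waveInterval u \ R.G :=
  fun _ hs => ⟨hs.1.1, fun hG => hs.2
    ((R.mem_alive_iff hG ⟨(R.mid_mem j).1.le, (R.mid_mem j).2⟩).2 hs.1.2)⟩

theorem ae_mem_alive_iff (j : ℕ) : ∀ᵐ s, s ∈ R.alive j ↔ s ∈ aliveWaves u T (R.mid j) := by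
  filter_upwards [measure_eq_zero_iff_ae_notMem.1 R.volume_sdiff] with s hs
  exact ⟨fun h => R.alive_subset j h, fun h => by_contra fun h' =>
    hs (R.aliveWaves_mid_sdiff j ⟨h, h'⟩)⟩

theorem front_mono (hX : IsWaveRepresentation u X U S T) (j : ℕ) :
    MonotoneOn (R.front j) (R.alive j) := by
  intro s hs s' hs' hss
  by_contra hlt
  have h1 := R.line_lt j _ _ (not_le.1 hlt) (R.front_spec hs).1
  rw [← R.position_mid hs, ← R.position_mid hs'] at h1
  exact not_le.2 h1 (hX.monotoneOn_aliveWaves (R.mid_nonneg j) (R.alive_subset j hs)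
    (R.alive_subset j hs') hss)

theorem measurableSet_alive (hX : IsWaveRepresentation u X U S T) (j : ℕ) :
    MeasurableSet (R.alive j) :=
  R.measurableSet.inter (measurableSet_le measurable_const hX.measurable_time)

theorem front_eq_iff {j : ℕ} {s : ℝ} (hs : s ∈ R.alive j) {i : ℕ} (hi : i < R.n j) :
    R.front j s = i ↔ X (R.mid j) s = R.line j i (R.mid j) := by
  rw [R.position_mid hs]
  refine ⟨fun h => by rw [h], fun h => ?_⟩
  rcases lt_trichotomy (R.front j s) i with h' | h' | h'
  · exact absurd h (R.line_lt j _ _ h' hi).ne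
  · exact h'
  · exact absurd h (R.line_lt j _ _ h' (R.front_spec hs).1).ne'

theorem volume_front (hX : IsWaveRepresentation u X U S T) (j : ℕ) {i : ℕ} (hi : i < R.n j) :
    volume {s ∈ R.alive j | R.front j s = i} = ENNReal.ofReal |R.v j (i + 1) - R.v j i| := by
  rw [← (hX.volume_position (R.pattern j) (R.t_nonneg j) (R.mid_mem j)).1 i hi]
  refine measure_congr (eventuallyEq_set.2 ?_)
  filter_upwards [R.ae_mem_alive_iff j] with s hs
  constructor
  · rintro ⟨h1, h2⟩
    exact ⟨hs.1 h1, (R.front_eq_iff h1 hi).1 h2⟩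
  · rintro ⟨h1, h2⟩
    exact ⟨hs.2 h1, (R.front_eq_iff (hs.2 h1) hi).2 h2⟩

/-- At the middle of a stage the fronts are at distinct points, so the waves at the position of `s`
are those of its front, up to a null set. They share one sign, and the integral becomes that sign
times the rank of `s`. -/
theorem value_eq (hX : IsWaveRepresentation u X U S T) {j : ℕ} {s : ℝ} (hs : s ∈ R.alive j) :
    U s = R.v j (R.front j s) +
      S s * (volume ({s' ∈ R.alive j | R.front j s' = R.front j s} ∩ Iio s)).toReal := by
  have hm := R.mid_mem j
  have hpos := R.front_spec hs
  rw [hX.value _ (R.mid_nonneg j) s (R.alive_subset j hs),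
    leftLim_step ((R.pattern j).value _ ⟨hm.1.le, hm.2.le⟩)]
  congr 1
  have hset : ({s' ∈ aliveWaves u T (R.mid j) | s' < s ∧ X (R.mid j) s' = X (R.mid j) s} : Set ℝ)
      =ᵐ[volume] ({s' ∈ R.alive j | R.front j s' = R.front j s} ∩ Iio s : Set ℝ) := by
    refine eventuallyEq_set.2 ?_
    filter_upwards [R.ae_mem_alive_iff j] with s' hs'
    constructor
    · rintro ⟨h1, h2, h3⟩
      exact ⟨⟨hs'.2 h1, (R.front_eq_iff (hs'.2 h1) hpos.1).2 (h3.trans (R.position_mid hs))⟩, h2⟩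
    · rintro ⟨⟨h1, h2⟩, h3⟩
      exact ⟨hs'.1 h1, h3, ((R.front_eq_iff h1 hpos.1).1 h2).trans (R.position_mid hs).symm⟩
  have hmeas : MeasurableSet ({s' ∈ R.alive j | R.front j s' = R.front j s} ∩ Iio s) :=
    (measurableSet_fiber_of_monotoneOn (R.measurableSet_alive hX j) (R.front_mono hX j) _).inter
      measurableSet_Iio
  rw [setIntegral_congr_set hset, setIntegral_congr_fun hmeas (g := fun _ => S s)]
  · rw [setIntegral_const, smul_eq_mul, mul_comm, Measure.real]
  · rintro s' ⟨⟨h1, h2⟩, -⟩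
    have h3 : 0 ≤ R.mid j ∧ (R.mid j : EReal) < T s' :=
      ⟨R.mid_nonneg j, (R.alive_subset j h1).2⟩
    simp only [signedExistence, if_pos h3]
    rw [(R.front_spec h1).2.1, hpos.2.1, h2]

theorem state_mem (hf : ContDiff ℝ 2 f) (h0 : ∀ x, ∃ k : ℤ, u 0 x = k / 2 ^ ν) (j : ℕ) :
    ∀ i ≤ R.n j, R.v j i ∈ {w ∈ convexHull ℝ (range (u 0)) | ∃ k : ℤ, w = k / 2 ^ ν} := by
  have key : ∀ j, (∀ x, u (R.t j) x ∈ {w ∈ convexHull ℝ (range (u 0)) | ∃ k : ℤ, w = k / 2 ^ ν}) →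
      ∀ i ≤ R.n j, R.v j i ∈ {w ∈ convexHull ℝ (range (u 0)) | ∃ k : ℤ, w = k / 2 ^ ν} :=
    fun j hj i hi => (R.pattern j).state_mem hf (R.solves j) (convex_convexHull ℝ _) hj hi
  refine key j ?_
  induction j with
  | zero =>
    rw [R.t_zero]
    exact fun x => ⟨subset_convexHull ℝ _ (mem_range_self x), h0 x⟩
  | succ j ih =>
    intro x
    rw [(R.pattern j).value_endpoint]
    exact key j ih _ (countLE_le _ _ _)

/-- The model of the regular waves. -/
def toModel (hf : ContDiff ℝ 2 f) (h0 : ∀ x, ∃ k : ℤ, u 0 x = k / 2 ^ ν)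
    (hX : IsWaveRepresentation u X U S T) {K : ℝ} (hK0 : 0 ≤ K)
    (hK : ∀ w ∈ convexHull ℝ (range (u 0)), |iteratedDeriv 2 f w| ≤ K) : FrontModel where
  flux := piecewiseAffineFlux f ν
  K := K
  L := (eVariationOn (u 0) univ).toReal
  states := {w ∈ convexHull ℝ (range (u 0)) | ∃ k : ℤ, w = k / 2 ^ ν}
  value := U
  sign := S
  alive := R.alive
  front := R.front
  num := R.n
  state := R.v
  speed := R.c
  start := R.y
  endpoint := fun j i => R.y j i + R.c j i * (R.t (j + 1) - R.t j)
  K_nonneg := hK0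
  continuous_flux := (continuous_piecewiseAffineFlux hf ν).continuousOn
  slope_bounds := by
    rintro _ ⟨ha, i, rfl⟩ _ ⟨hb, k, rfl⟩ hab
    exact piecewiseAffineFlux_slope_bounds hf hab fun w hw =>
      hK w ((convex_convexHull ℝ _).ordConnected.out ha hb hw)
  second_difference := by
    rintro _ ⟨hp, i, rfl⟩ _ ⟨hq, k, rfl⟩ _ ⟨hr, l, rfl⟩ hpq hqr
    have e : (i : ℝ) / 2 ^ ν + l / 2 ^ ν - k / 2 ^ ν = ((i + l - k : ℤ) : ℝ) / 2 ^ ν := by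
      push_cast; ring
    have := second_difference_le hf (convex_convexHull ℝ _) hK hp hr hpq hqr
    rw [e] at this ⊢
    simpa only [piecewiseAffineFlux_node] using this
  state_mem := R.state_mem hf h0
  alive_anti := R.alive_anti
  alive_zero := fun s hs => Ioc_subset_Icc_self (R.subset hs.1)
  measurableSet_front := fun j i =>
    measurableSet_fiber_of_monotoneOn (R.measurableSet_alive hX j) (R.front_mono hX j) i
  front_lt := fun j s hs => (R.front_spec hs).1
  front_mono := fun j s hs s' hs' hss => R.front_mono hX j hs hs' hss
  volume_front := fun j i hi => R.volume_front hX j hi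
  state_ne := fun j => (R.pattern j).jump_ne
  sign_eq := fun j s hs => (R.front_spec hs).2.1
  value_eq := fun _ _ hs => R.value_eq hX hs
  speed_eq := fun j i hi => ((R.pattern j).fan hf (R.solves j) hi rfl rfl).1
  start_mono := fun j i k => (R.pattern j).start_mono
  endpoint_mono := fun j i k => (R.pattern j).endpoint_mono
  speed_lt := fun j i k => (R.pattern j).speed_lt
  speed_lt_of_endpoint := fun j i k => (R.pattern j).speed_lt_of_endpoint
  binary := R.binary
  start_eq_endpoint := fun j s hs => by
    have h1 := (R.front_spec hs).2.2 (R.t (j + 1)) ⟨le_rfl, (R.t_lt (j + 1)).le⟩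
    have h2 := (R.front_spec (R.alive_anti (Nat.le_succ j) hs)).2.2 (R.t (j + 1))
      ⟨(R.t_lt j).le, le_rfl⟩
    have h3 := h1.symm.trans h2
    simpa only [line, sub_self, mul_zero, add_zero] using h3
  state_left := fun j x => by
    rw [← leftLim_step (R.pattern j).value_endpoint, leftLim_step (R.pattern (j + 1)).value_start]
  state_right := fun j x => by
    rw [← (R.pattern j).value_endpoint, (R.pattern (j + 1)).value_start]
  fan_ne := fun j k hk => by
    rcases ((R.pattern j).fan hf (R.solves j) hk rfl rfl).2 with h | h
    · exact h.1.ne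
    · exact h.1.ne'
  fan_up := fun j k hk a b ha hb hab => by
    rcases ((R.pattern j).fan hf (R.solves j) hk ha hb).2 with h | h
    · exact h.2
    · exact absurd h.1 (not_lt.2 hab.le)
  fan_down := fun j k hk a b ha hb hab => by
    rcases ((R.pattern j).fan hf (R.solves j) hk ha hb).2 with h | h
    · exact absurd h.1 (not_lt.2 hab.le)
    · exact h.2

end RegularWaves

/-! ### The total variation of the speeds -/

namespace RegularWaves

variable {f : ℝ → ℝ} {ν : ℕ} {u X : ℝ → ℝ → ℝ} {U S : ℝ → ℝ} {T : ℝ → EReal}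
  (R : RegularWaves f ν u X S T)

theorem exists_stage {τ : ℝ} (hτ : 0 ≤ τ) : ∃ j, τ ∈ Ico (R.t j) (R.t (j + 1)) := by
  obtain ⟨m, hm⟩ := (R.tendsto_t.eventually_gt_atTop τ).exists
  classical
  have hex : ∃ m, τ < R.t m := ⟨m, hm⟩
  have h0 : Nat.find hex ≠ 0 := fun h => by
    have := Nat.find_spec hex
    rw [h, R.t_zero] at this
    exact not_lt.2 hτ this
  refine ⟨Nat.find hex - 1, not_lt.1 (Nat.find_min hex (by omega)), ?_⟩
  rw [show Nat.find hex - 1 + 1 = Nat.find hex by omega]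
  exact Nat.find_spec hex

/-- The stage to which the time `τ` belongs. -/
def stage (τ : ℝ) : ℕ := if h : 0 ≤ τ then (R.exists_stage h).choose else 0

theorem stage_spec {τ : ℝ} (hτ : 0 ≤ τ) : τ ∈ Ico (R.t (R.stage τ)) (R.t (R.stage τ + 1)) := by
  rw [stage, dif_pos hτ]
  exact (R.exists_stage hτ).choose_spec

theorem stage_eq {τ : ℝ} {j : ℕ} (hτ : τ ∈ Ico (R.t j) (R.t (j + 1))) : R.stage τ = j := by
  have h := R.stage_spec ((R.t_nonneg j).trans hτ.1)
  have h1 := R.t_strictMono.lt_iff_lt.1 (h.1.trans_lt hτ.2)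
  have h2 := R.t_strictMono.lt_iff_lt.1 (hτ.1.trans_lt h.2)
  omega

theorem stage_mono : MonotoneOn R.stage (Ici 0) := fun τ hτ τ' hτ' hle => by
  have := R.t_strictMono.lt_iff_lt.1
    ((R.stage_spec hτ).1.trans_lt (hle.trans_lt (R.stage_spec hτ').2))
  omega

theorem waveSpeed_eq {j : ℕ} {s : ℝ} (hs : s ∈ R.alive j) {τ : ℝ}
    (hτ : τ ∈ Ico (R.t j) (R.t (j + 1))) : waveSpeed X τ s = R.c j (R.front j s) := by
  have hd : HasDerivWithinAt (R.line j (R.front j s)) (R.c j (R.front j s)) (Ici τ) τ := by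
    unfold line
    simpa using (((hasDerivAt_id τ).sub_const (R.t j)).const_mul
      (R.c j (R.front j s))).const_add (R.y j (R.front j s)) |>.hasDerivWithinAt
  have hev : (fun τ' => X τ' s) =ᶠ[𝓝[≥] τ] R.line j (R.front j s) := by
    filter_upwards [Ico_mem_nhdsGE hτ.2] with τ' hτ'
    exact (R.front_spec hs).2.2 τ' ⟨hτ.1.trans hτ'.1, hτ'.2.le⟩
  exact (hd.congr_of_eventuallyEq_of_mem hev self_mem_Ici).derivWithin
    (uniqueDiffOn_Ici τ τ self_mem_Ici)

/-- On the lifetime of a regular wave the speed is a function of the stage, which is monotone in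
time. The stages visited are exactly those in which the wave is alive. -/
theorem waveSpeedVariation_eq {s : ℝ} (hs : s ∈ R.G) :
    waveSpeedVariation X T s = ∑' j, (R.alive (j + 1)).indicator
      (fun s => edist (R.c j (R.front j s)) (R.c (j + 1) (R.front (j + 1) s))) s := by
  have heq : EqOn (fun τ => waveSpeed X τ s) ((fun j => R.c j (R.front j s)) ∘ R.stage)
      {τ : ℝ | 0 ≤ τ ∧ (τ : EReal) < T s} := fun τ hτ =>
    R.waveSpeed_eq ((R.mem_alive_iff hs (R.stage_spec hτ.1)).2 hτ.2) (R.stage_spec hτ.1)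
  rw [waveSpeedVariation, eVariationOn.congr heq, eVariationOn.comp_eq_of_monotoneOn _ _
    (R.stage_mono.mono fun τ hτ => hτ.1)]
  have himage : R.stage '' {τ : ℝ | 0 ≤ τ ∧ (τ : EReal) < T s} = {j | s ∈ R.alive j} := by
    ext j
    constructor
    · rintro ⟨τ, hτ, rfl⟩
      exact (R.mem_alive_iff hs (R.stage_spec hτ.1)).2 hτ.2
    · intro hj
      have hmem : R.t j ∈ Ico (R.t j) (R.t (j + 1)) := ⟨le_rfl, R.t_lt j⟩
      exact ⟨R.t j, ⟨R.t_nonneg j, (R.mem_alive_iff hs hmem).1 hj⟩, R.stage_eq hmem⟩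
  rw [himage, eVariationOn_nat_lower _ {j | s ∈ R.alive j} fun _ hi _ hk => R.alive_anti hk hi]
  refine tsum_congr fun j => ?_
  by_cases h : s ∈ R.alive (j + 1)
  · rw [indicator_of_mem h, indicator_of_mem (show j + 1 ∈ {j | s ∈ R.alive j} from h),
      Nat.add_sub_cancel]
  · rw [indicator_of_notMem h, indicator_of_notMem (show j + 1 ∉ {j | s ∈ R.alive j} from h)]

theorem measurable_indicator_front (hX : IsWaveRepresentation u X U S T) (j : ℕ) :
    Measurable ((R.alive j).indicator (R.front j)) := by
  refine measurable_to_countable' fun i => ?_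
  have h1 := measurableSet_fiber_of_monotoneOn (R.measurableSet_alive hX j) (R.front_mono hX j) i
  -- The indicator vanishes off the living waves, so their complement joins the fiber over 0.
  by_cases hi : i = 0
  · convert h1.union (R.measurableSet_alive hX j).compl using 1
    ext s
    by_cases hs : s ∈ R.alive j <;> simp [hs, hi]
  · convert h1 using 1
    ext s
    by_cases hs : s ∈ R.alive j <;> simp [hs, Ne.symm hi]

theorem measurable_indicator_jump (hX : IsWaveRepresentation u X U S T) (j : ℕ) :
    Measurable ((R.alive (j + 1)).indicator
      (fun s => edist (R.c j (R.front j s)) (R.c (j + 1) (R.front (j + 1) s)))) := by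
  have h : Measurable fun s => edist (R.c j ((R.alive j).indicator (R.front j) s))
      (R.c (j + 1) ((R.alive (j + 1)).indicator (R.front (j + 1)) s)) :=
    (measurable_from_nat.comp (R.measurable_indicator_front hX j)).edist
      (measurable_from_nat.comp (R.measurable_indicator_front hX (j + 1)))
  convert h.indicator (R.measurableSet_alive hX (j + 1)) using 1
  refine indicator_congr fun s hs => ?_
  rw [indicator_of_mem hs, indicator_of_mem (R.alive_anti (Nat.le_succ j) hs)]

theorem ae_waveSpeedVariation_eq : ∀ᵐ s ∂volume.restrict (waveInterval u),
    waveSpeedVariation X T s = ∑' j, (R.alive (j + 1)).indicator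
      (fun s => edist (R.c j (R.front j s)) (R.c (j + 1) (R.front (j + 1) s))) s := by
  rw [ae_restrict_iff' (show MeasurableSet (waveInterval u) from measurableSet_Ioc)]
  filter_upwards [measure_eq_zero_iff_ae_notMem.1 R.volume_sdiff] with s hs hsJ
  exact R.waveSpeedVariation_eq (by_contra fun h => hs ⟨hsJ, h⟩)

include R in
theorem lintegral_waveSpeedVariation_le (hf : ContDiff ℝ 2 f)
    (h0 : ∀ x, ∃ k : ℤ, u 0 x = k / 2 ^ ν) (hX : IsWaveRepresentation u X U S T) {K : ℝ}
    (hK0 : 0 ≤ K) (hK : ∀ w ∈ convexHull ℝ (range (u 0)), |iteratedDeriv 2 f w| ≤ K) :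
    ∫⁻ s in waveInterval u, waveSpeedVariation X T s ≤
      3 * ENNReal.ofReal K * eVariationOn (u 0) univ ^ 2 := by
  have hsub : ∀ j, R.alive j ⊆ waveInterval u := fun j s hs => R.subset hs.1
  rw [lintegral_congr_ae R.ae_waveSpeedVariation_eq,
    lintegral_tsum fun j => (R.measurable_indicator_jump hX j).aemeasurable]
  have hint : ∀ j, ∫⁻ s in waveInterval u, (R.alive (j + 1)).indicator
      (fun s => edist (R.c j (R.front j s)) (R.c (j + 1) (R.front (j + 1) s))) s =
      ∫⁻ s in R.alive (j + 1), (R.toModel hf h0 hX hK0 hK).jump j s := fun j => by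
    rw [lintegral_indicator (R.measurableSet_alive hX (j + 1)), Measure.restrict_restrict
      (R.measurableSet_alive hX (j + 1)), inter_eq_left.2 (hsub _)]
    rfl
  simp_rw [hint]
  refine (R.toModel hf h0 hX hK0 hK).total_variation_bound.trans ?_
  have hvol : volume (R.alive 0) ≤ eVariationOn (u 0) univ :=
    (measure_mono (hsub 0)).trans ((volume_waveInterval u).trans_le ENNReal.ofReal_toReal_le)
  change 3 * ENNReal.ofReal K * volume (R.alive 0) ^ 2 ≤ _
  gcongr

include R in
-- The initial datum takes finitely many values, so their hull is compact and f'' is bounded on it.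
theorem supSecondDeriv_ne_top (hf : ContDiff ℝ 2 f) :
    supSecondDeriv f (convexHull ℝ (range (u 0))) ≠ ⊤ := by
  have hfin : (range (u 0)).Finite := by
    refine ((Finset.range (R.n 0 + 1)).finite_toSet.image (R.v 0)).subset ?_
    rintro _ ⟨x, rfl⟩
    have := (R.pattern 0).value_start x
    rw [R.t_zero] at this
    exact ⟨_, Finset.mem_coe.2 (Finset.mem_range.2 (Nat.lt_succ_of_le (countLE_le _ _ x))), this.symm⟩
  obtain ⟨K, hK⟩ := (hfin.isCompact_convexHull (𝕜 := ℝ)).exists_bound_of_continuousOn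
    (f := iteratedDeriv 2 f) (hf.continuous_iteratedDeriv 2 le_rfl).continuousOn
  refine ((iSup₂_le fun w hw => ?_).trans_lt (ENNReal.ofReal_lt_top (r := K))).ne
  rw [← ofReal_norm]
  exact ENNReal.ofReal_le_ofReal (hK w hw)

end RegularWaves

theorem mainTheorem12 (f : ℝ → ℝ) (hf : ContDiff ℝ 2 f) (ν : ℕ)
    (u : ℝ → ℝ → ℝ) (hu : IsWavefrontTracking f ν u)
    (X : ℝ → ℝ → ℝ) (U S : ℝ → ℝ) (T : ℝ → EReal) (hX : IsWaveRepresentation u X U S T) :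
    AEMeasurable (waveSpeedVariation X T) (volume.restrict (waveInterval u)) ∧
      ∫⁻ s in waveInterval u, waveSpeedVariation X T s ≤
        3 * supSecondDeriv f (convexHull ℝ (range (u 0))) * eVariationOn (u 0) univ ^ 2 := by
  obtain ⟨R⟩ := hu.exists_regularWaves hX
  have hK := R.supSecondDeriv_ne_top hf
  -- The sum of the jumps of speed over the stages is a measurable function that agrees with the
  -- variation for almost every wave.
  refine ⟨⟨_, Measurable.tsum fun j => R.measurable_indicator_jump hX j,
    R.ae_waveSpeedVariation_eq⟩, ?_⟩
  have := R.lintegral_waveSpeedVariation_le hf hu.1 hX ENNReal.toReal_nonneg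
    (K := (supSecondDeriv f (convexHull ℝ (range (u 0)))).toReal) fun w hw => by
      rw [← Real.norm_eq_abs, ← toReal_enorm]
      exact ENNReal.toReal_mono hK (le_iSup₂ (f := fun w _ => ‖iteratedDeriv 2 f w‖ₑ) w hw)
  rwa [ENNReal.ofReal_toReal hK] at this

end
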